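/- Let $k$ be a field, $\bar k$ a separable closure of $k$ and $\Gamma=\mathrm{Gal}(\bar k/k)$. $\mathrm{Ext}_\Gamma$ denotes Ext groups in the category of discrete $\Gamma$-modules. For a smooth geometrically integral $k$-variety $X$ (separated and of finite type over $k$) put $\overline X=X\times_k\bar k$, let $\bar k(X)$ be the function field of $\overline X$ and $\bar k[X]=\Gamma(\overline X,\mathcal O_{\overline X})$. Let $\mathrm{ob}(X)\in\mathrm{Ext}^1_\Gamma(\bar k(X)^\times/\bar k^\times,\bar k^\times)$ be the class of $$1\to\bar k^\times\to\bar k(X)^\times\to\bar k(X)^\times/\bar k^\times\to1.$$ If $\bar k[X]^\times=\bar k^\times$, let $e(X)\in\mathrm{Ext}^2_\Gamma(\mathrm{Pic}\,\overline X,\bar k^\times)$ be the class of $$1\to\bar k^\times\to\bar k(X)^\times\to\mathrm{Div}\,\overline X\to\mathrm{Pic}\,\overline X\to1,$$ and let $\delta_X:\mathrm{Ext}^1_\Gamma(\bar k(X)^\times/\bar k^\times,\bar k^\times)\to\mathrm{Ext}^2_\Gamma(\mathrm{Pic}\,\overline X,\bar k^\times)$ be the connecting homomorphism of the long exact sequence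 attached to $1\to\bar k(X)^\times/\bar k^\times\to\mathrm{Div}\,\overline X\to\mathrm{Pic}\,\overline X\to1$. **Theorem 2.1.** Let $X$ and $Y$ be smooth geometrically integral varieties over $k$. (1) Let $\pi:\bar k(X)^\times/\bar k^\times\oplus\bar k(Y)^\times/\bar k^\times\to\bar k(X\times_kY)^\times/\bar k^\times$ be the $\Gamma$-morphism that multiplies the pullbacks of functions along the two projections. Let $${\pi^*}':\mathrm{Ext}^1_\Gamma(\bar k(X\times_kY)^\times/\bar k^\times,\bar k^\times)\to\mathrm{Ext}^1_\Gamma(\bar k(X)^\times/\bar k^\times,\bar k^\times)\oplus\mathrm{Ext}^1_\Gamma(\bar k(Y)^\times/\bar k^\times,\bar k^\times)$$ be pullback of extensions along $\pi$ followed by the canonical isomorphism $\mathrm{Ext}^1_\Gamma(A\oplus B,\bar k^\times)\cong\mathrm{Ext}^1_\Gamma(A,\bar k^\times)\oplus\mathrm{Ext}^1_\Gamma(B,\bar k^\times)$. Then ${\pi^*}'(\mathrm{ob}(X\times_kY))=(\mathrm{ob}(X),\mathrm{ob}(Y))$. If $\pi$ is an isomorphism, then $\mathrm{ob}(X\times_kY)=0$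 if and only if $\mathrm{ob}(X)=0$ and $\mathrm{ob}(Y)=0$. (2) Assume $\bar k[X]^\times=\bar k^\times=\bar k[Y]^\times$. Then $\bar k[X\times_kY]^\times=\bar k^\times$, so $e(X\times_kY)$ is defined. Let $\psi:\mathrm{Pic}\,\overline X\oplus\mathrm{Pic}\,\overline Y\to\mathrm{Pic}(\overline X\times_{\bar k}\overline Y)$ be the $\Gamma$-morphism given by pullback of line bundles along the projections, and let $${\psi^*}':\mathrm{Ext}^2_\Gamma(\mathrm{Pic}(\overline X\times_{\bar k}\overline Y),\bar k^\times)\to\mathrm{Ext}^2_\Gamma(\mathrm{Pic}\,\overline X,\bar k^\times)\oplus\mathrm{Ext}^2_\Gamma(\mathrm{Pic}\,\overline Y,\bar k^\times)$$ be pullback along $\psi$ followed by the analogous canonical isomorphism. Then: - ${\psi^*}'(e(X\times_kY))=(e(X),e(Y))$; - ${\psi^*}'\circ\delta_{X\times_kY}=(\delta_X\oplus\delta_Y)\circ{\pi^*}'$, and the homomorphisms $\delta_{X\times_kY},\delta_X,\delta_Y$ are injective; - if $\pi$ or $\psi$ is an isomorphism, then $e(X\times_kY)=0$ if and only if $e(X)=0$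 and $e(Y)=0$, and $\mathrm{ob}(X\times_kY)=0$ if and only if $\mathrm{ob}(X)=0$ and $\mathrm{ob}(Y)=0$. -/

import Mathlib

open CategoryTheory Limits AlgebraicGeometry TopologicalSpace

universe u

set_option linter.unusedSectionVars false

noncomputable section

namespace ElementaryObstruction

/-! ### Auxiliary facts on representations -/

lemma rep_limit_ext {G : Type u} [Group G] {R : Type} [Ring R] {J : Type} [SmallCategory J]
    (F : J ⥤ Rep.{u} R G) (c : Cone F) (hc : IsLimit c) (a b : c.pt)
    (h : ∀ j, (c.π.app j).hom a = (c.π.app j).hom b) : a = b := by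
  have : PreservesLimitsOfSize.{0, 0} (forget₂ (Rep.{u} R G) (ModuleCat.{u} R)) :=
    preservesLimitsOfSize_shrink.{0, u, 0, u} _
  have : PreservesLimitsOfSize.{0, 0} (forget (ModuleCat.{u} R)) :=
    preservesLimitsOfSize_shrink.{0, u, 0, u} _
  have hl := isLimitOfPreserves (forget₂ (Rep.{u} R G) (ModuleCat.{u} R)) hc
  exact Concrete.isLimit_ext _ hl a b h

lemma rep_exact {G : Type u} [Group G] {R : Type} [Ring R] (S : ShortComplex (Rep.{u} R G))
    (h : ∀ x, S.g.hom x = 0 → ∃ y, S.f.hom y = x) : S.Exact := by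
  rw [← ShortComplex.exact_map_iff_of_faithful _ (forget₂ (Rep.{u} R G) (ModuleCat.{u} R)),
    ShortComplex.moduleCat_exact_iff]
  exact h

/-! ### Discrete modules over a topological group -/

section Discrete

variable (G : Type u) [Group G] [TopologicalSpace G]

/-- A `G`-module is discrete if the stabilizer of each of its elements is open. -/
def isDiscrete : ObjectProperty (Rep.{u} ℤ G) :=
  fun A => ∀ a : A, IsOpen {g : G | A.ρ g a = a}

variable {G}

lemma isDiscrete_of_injective {A B : Rep.{u} ℤ G} (φ : A ⟶ B)
    (hφ : Function.Injective φ.hom) (hB : isDiscrete G B) : isDiscrete G A := by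
  intro a
  convert hB (φ.hom a) using 1
  ext g
  simp only [Set.mem_ofPred_eq, ← Rep.hom_comm_apply]
  exact hφ.eq_iff.symm

instance isDiscrete_closedUnderSubobjects : (isDiscrete G).IsClosedUnderSubobjects where
  prop_of_mono φ _ hB := isDiscrete_of_injective φ ((Rep.mono_iff_injective φ).1 inferInstance) hB

variable [IsTopologicalGroup G]

/-- To be open it suffices that the stabilizer contains an open neighbourhood of `1`. -/
lemma isOpen_stabilizer_of_le {M : Type*} [CommGroup M] (ρ : G →* Monoid.End M) (m : M)
    (U : Set G) (hU : IsOpen U) (h1 : (1 : G) ∈ U) (h : ∀ g ∈ U, ρ g m = m) :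
    IsOpen {g : G | ρ g m = m} := by
  rw [isOpen_iff_mem_nhds]
  intro g hg
  have : (fun x => g * x) '' U ∈ nhds g :=
    (isOpenMap_mul_left g U hU).mem_nhds ⟨1, h1, mul_one g⟩
  refine Filter.mem_of_superset this ?_
  rintro _ ⟨x, hx, rfl⟩
  have hg' : ρ g m = m := hg
  change ρ (g * x) m = m
  rw [map_mul]
  change ρ g (ρ x m) = m
  rw [h x hx, hg']

instance isDiscrete_closedUnderQuotients : (isDiscrete G).IsClosedUnderQuotients where
  prop_of_epi {A B} φ _ hA := by
    intro b
    obtain ⟨a, rfl⟩ := (Rep.epi_iff_surjective φ).1 inferInstance b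
    rw [isOpen_iff_mem_nhds]
    intro g hg
    have h1 : (fun x => g * x) '' {x : G | A.ρ x a = a} ∈ nhds g :=
      (isOpenMap_mul_left g _ (hA a)).mem_nhds ⟨1, by simp, mul_one g⟩
    refine Filter.mem_of_superset h1 ?_
    rintro _ ⟨x, hx, rfl⟩
    have hx' : A.ρ x a = a := hx
    have hg' : B.ρ g (φ.hom a) = φ.hom a := hg
    simp only [Set.mem_ofPred_eq, map_mul, Module.End.mul_apply]
    rw [← Rep.hom_comm_apply φ x a, hx', hg']

instance isDiscrete_containsZero : (isDiscrete G).ContainsZero where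
  exists_zero := ⟨Rep.trivial ℤ G PUnit.{u + 1},
    (Rep.isZero_iff ℤ G _).2 (inferInstanceAs (Subsingleton PUnit)), fun a => by
      convert isOpen_univ
      ext g
      simp⟩

instance isDiscrete_closedUnderFiniteProducts : (isDiscrete G).IsClosedUnderFiniteProducts where
  isClosedUnderLimitsOfShape J _ := by
    constructor
    rintro A ⟨p⟩
    obtain ⟨⟨F, π, hF⟩, hP⟩ := p
    intro a
    have : {g : G | A.ρ g a = a} =
        ⋂ j : Discrete J, {g : G | (F.obj j).ρ g (Rep.Hom.hom (π.app j) a) = Rep.Hom.hom (π.app j) a} := by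
      ext g
      simp only [Set.mem_ofPred_eq, Set.mem_iInter]
      constructor
      · intro h j
        exact (Rep.hom_comm_apply (π.app j) g a).symm.trans (congrArg _ h)
      · intro h
        exact rep_limit_ext _ _ hF _ _ fun j => (Rep.hom_comm_apply (π.app j) g a).trans (h j)
    rw [this]
    exact isOpen_iInter_of_finite fun j => hP j _

variable (G) in
/-- The abelian category of discrete `G`-modules (for `G` profinite these are the
`G`-modules of Galois cohomology). -/
abbrev DiscMod := (isDiscrete G).FullSubcategory

instance : Abelian (DiscMod G) := inferInstance

/-- `Ext` groups exist in the category of discrete `G`-modules. -/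
instance : HasExt.{u + 1} (DiscMod G) := HasExt.standard _

/-- A commutative group (written multiplicatively) with an action of `G` by automorphisms and with
open stabilizers, as a discrete `G`-module. -/
def DiscMod.of (M : Type u) [CommGroup M] (ρ : G →* Monoid.End M)
    (h : ∀ m : M, IsOpen {g : G | ρ g m = m}) : DiscMod G :=
  ⟨Rep.of (X := Additive M)
    { toFun := fun g => (MonoidHom.toAdditive (ρ g)).toIntLinearMap
      map_one' := by ext m; simp; rfl
      map_mul' := fun g g' => by ext m; simp; rfl }, fun m => h m.toMul⟩

/-- An equivariant homomorphism, as a morphism of discrete `G`-modules. -/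
def DiscMod.ofHom {M N : Type u} [CommGroup M] [CommGroup N] {ρ : G →* Monoid.End M}
    {τ : G →* Monoid.End N} {hM : ∀ m : M, IsOpen {g : G | ρ g m = m}}
    {hN : ∀ n : N, IsOpen {g : G | τ g n = n}} (φ : M →* N)
    (hφ : ∀ g m, φ (ρ g m) = τ g (φ m)) :
    DiscMod.of M ρ hM ⟶ DiscMod.of N τ hN :=
  ObjectProperty.homMk (Rep.ofHom ⟨(MonoidHom.toAdditive φ).toIntLinearMap, fun g => by
    ext m; exact hφ g m.toMul⟩)

/-- Two equivariant homomorphisms with trivial composition compose to zero. -/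
lemma DiscMod.ofHom_comp_eq_zero {L M N : Type u} [CommGroup L] [CommGroup M] [CommGroup N]
    {ρ : G →* Monoid.End L} {τ : G →* Monoid.End M} {υ : G →* Monoid.End N}
    {hL : ∀ m : L, IsOpen {g : G | ρ g m = m}}
    {hM : ∀ m : M, IsOpen {g : G | τ g m = m}}
    {hN : ∀ m : N, IsOpen {g : G | υ g m = m}}
    (φ : L →* M) (hφ : ∀ g m, φ (ρ g m) = τ g (φ m))
    (ψ : M →* N) (hψ : ∀ g m, ψ (τ g m) = υ g (ψ m)) (h : ∀ m, ψ (φ m) = 1) :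
    (DiscMod.ofHom φ hφ : DiscMod.of L ρ hL ⟶ DiscMod.of M τ hM) ≫
      (DiscMod.ofHom ψ hψ : DiscMod.of M τ hM ⟶ DiscMod.of N υ hN) = 0 := by
  ext m
  exact h m.toMul

/-- A short exact sequence of commutative groups with equivariant maps gives a short exact
sequence of discrete `G`-modules. -/
lemma DiscMod.shortExact {L M N : Type u} [CommGroup L] [CommGroup M] [CommGroup N]
    {ρ : G →* Monoid.End L} {τ : G →* Monoid.End M} {υ : G →* Monoid.End N}
    {hL : ∀ m : L, IsOpen {g : G | ρ g m = m}}
    {hM : ∀ m : M, IsOpen {g : G | τ g m = m}}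
    {hN : ∀ m : N, IsOpen {g : G | υ g m = m}}
    (φ : L →* M) (hφ : ∀ g m, φ (ρ g m) = τ g (φ m))
    (ψ : M →* N) (hψ : ∀ g m, ψ (τ g m) = υ g (ψ m))
    (w : (DiscMod.ofHom φ hφ : DiscMod.of L ρ hL ⟶ DiscMod.of M τ hM) ≫
      (DiscMod.ofHom ψ hψ : DiscMod.of M τ hM ⟶ DiscMod.of N υ hN) = 0)
    (h1 : Function.Injective φ) (h2 : ψ.ker ≤ φ.range) (h3 : Function.Surjective ψ) :
    (ShortComplex.mk _ _ w).ShortExact := by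
  have hm : Mono (DiscMod.ofHom φ hφ : DiscMod.of L ρ hL ⟶ DiscMod.of M τ hM) :=
    (isDiscrete G).ι.mono_of_mono_map ((Rep.mono_iff_injective _).2 h1)
  have he : Epi (DiscMod.ofHom ψ hψ : DiscMod.of M τ hM ⟶ DiscMod.of N υ hN) :=
    (isDiscrete G).ι.epi_of_epi_map ((Rep.epi_iff_surjective _).2 h3)
  have p1 : (isDiscrete G).ι.PreservesHomology :=
    { preservesKernels := fun _ _ f => (isDiscrete G).preservesKernels_ι f
      preservesCokernels := fun _ _ f => (isDiscrete G).preservesCokernels_ι f }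
  refine ⟨?_⟩
  rw [← ShortComplex.exact_map_iff_of_faithful _ (isDiscrete G).ι]
  refine rep_exact _ fun x hx => ?_
  obtain ⟨y, hy⟩ := h2 (show Additive.toMul x ∈ ψ.ker from hx)
  exact ⟨Additive.ofMul y, hy⟩

end Discrete

/-! ### Function fields, Cartier divisors and the Picard group -/

section Schemes

variable {X Y Z : Scheme.{u}}

/-- Restriction of invertible functions. -/
def resUnit {U V : X.Opens} (h : V ≤ U) : Γ(X, U)ˣ →* Γ(X, V)ˣ :=
  Units.map (X.presheaf.map (homOfLE h).op).hom.toMonoidHom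

/-- Pullback of invertible functions along a morphism. -/
def pullUnit (f : X ⟶ Y) {U : Y.Opens} {V : X.Opens} (h : V ≤ f ⁻¹ᵁ U) : Γ(Y, U)ˣ →* Γ(X, V)ˣ :=
  Units.map (f.appLE U V h).hom.toMonoidHom

@[simp]
lemma resUnit_resUnit {U V W : X.Opens} (h : V ≤ U) (h' : W ≤ V) (s : Γ(X, U)ˣ) :
    resUnit h' (resUnit h s) = resUnit (h'.trans h) s := by
  ext
  simp only [resUnit, Units.coe_map]
  change (X.presheaf.map _ ≫ X.presheaf.map _) _ = _
  rw [← Functor.map_comp]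
  rfl

@[simp]
lemma resUnit_pullUnit (f : X ⟶ Y) {U : Y.Opens} {V W : X.Opens} (h : V ≤ f ⁻¹ᵁ U) (h' : W ≤ V)
    (s : Γ(Y, U)ˣ) : resUnit h' (pullUnit f h s) = pullUnit f (h'.trans h) s := by
  ext
  simp only [resUnit, pullUnit, Units.coe_map]
  change (f.appLE U V h ≫ X.presheaf.map _) _ = _
  rw [Scheme.Hom.appLE_map]
  rfl

@[simp]
lemma pullUnit_resUnit (f : X ⟶ Y) {U U' : Y.Opens} {V : X.Opens} (h : U' ≤ U)
    (h' : V ≤ f ⁻¹ᵁ U') (s : Γ(Y, U)ˣ) :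
    pullUnit f h' (resUnit h s) = pullUnit f (h'.trans (f.preimage_mono h)) s := by
  ext
  simp only [resUnit, pullUnit, Units.coe_map]
  change (Y.presheaf.map _ ≫ f.appLE U' V h') _ = _
  rw [Scheme.Hom.map_appLE]
  rfl

@[simp]
lemma pullUnit_pullUnit (f : X ⟶ Y) (g : Y ⟶ Z) {U : Z.Opens} {V : Y.Opens} {W : X.Opens}
    (h : V ≤ g ⁻¹ᵁ U) (h' : W ≤ f ⁻¹ᵁ V) (s : Γ(Z, U)ˣ) :
    pullUnit f h' (pullUnit g h s) = pullUnit (f ≫ g) (h'.trans (f.preimage_mono h)) s := by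
  ext
  simp only [pullUnit, Units.coe_map]
  change (g.appLE U V h ≫ f.appLE V W h') _ = _
  rw [Scheme.Hom.appLE_comp_appLE]
  rfl

lemma pullUnit_id {U V : X.Opens} (h : V ≤ 𝟙 X ⁻¹ᵁ U) (s : Γ(X, U)ˣ) :
    pullUnit (𝟙 X) h s = resUnit h s := by
  ext
  simp only [resUnit, pullUnit, Units.coe_map]
  change ((𝟙 X : X ⟶ X).appLE U V h) _ = _
  rw [Scheme.Hom.appLE, Scheme.Hom.id_app]
  simp
  rfl

/-! #### Line bundles by transition functions -/

variable (X) in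
/-- A line bundle on a scheme given by transition functions: an open cover (indexed by the points
of the scheme, `x ∈ U x`) and invertible functions `g x y` on `U x ∩ U y` with
`g x y * g y z = g x z` on triple intersections. -/
structure LineCocycle where
  U : X → X.Opens
  mem : ∀ x, x ∈ U x
  g : ∀ x y, Γ(X, U x ⊓ U y)ˣ
  cocycle : ∀ x y z,
    resUnit (show U x ⊓ U y ⊓ U z ≤ U x ⊓ U y from inf_le_left) (g x y) *
      resUnit (show U x ⊓ U y ⊓ U z ≤ U y ⊓ U z from inf_le_inf_right _ inf_le_right) (g y z) =
    resUnit (show U x ⊓ U y ⊓ U z ≤ U x ⊓ U z from inf_le_inf_right _ inf_le_left) (g x z)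

/-- Two line bundles given by transition functions are isomorphic: on a common refinement `W` of
the two covers there are invertible functions `a x` on `W x` with `g x y * a y = a x * g' x y`. -/
def LineCocycle.Iso (c d : LineCocycle X) : Prop :=
  ∃ (W : X → X.Opens) (_ : ∀ x, x ∈ W x) (hc : ∀ x, W x ≤ c.U x) (hd : ∀ x, W x ≤ d.U x)
    (a : ∀ x, Γ(X, W x)ˣ), ∀ x y,
      resUnit (inf_le_inf (hc x) (hc y)) (c.g x y) *
        resUnit (show W x ⊓ W y ≤ W y from inf_le_right) (a y) =
      resUnit (show W x ⊓ W y ≤ W x from inf_le_left) (a x) *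
        resUnit (inf_le_inf (hd x) (hd y)) (d.g x y)

variable (X) in
/-- Isomorphism of line bundles is an equivalence relation. -/
instance LineCocycle.setoid : Setoid (LineCocycle X) where
  r := LineCocycle.Iso
  iseqv :=
    { refl := fun c => ⟨c.U, c.mem, fun _ => le_rfl, fun _ => le_rfl, fun _ => 1, fun x y => by
        simp⟩
      symm := by
        rintro c d ⟨W, hW, hc, hd, a, h⟩
        refine ⟨W, hW, hd, hc, fun x => (a x)⁻¹, fun x y => ?_⟩
        have := h x y
        simp only [map_inv]
        rw [mul_inv_eq_iff_eq_mul, mul_assoc, this, inv_mul_cancel_left]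
      trans := by
        rintro c d e ⟨W, hW, hc, hd, a, h⟩ ⟨W', hW', hd', he, b, h'⟩
        refine ⟨fun x => W x ⊓ W' x, fun x => ⟨hW x, hW' x⟩, fun x => inf_le_left.trans (hc x),
          fun x => inf_le_right.trans (he x),
          fun x => resUnit inf_le_left (a x) * resUnit inf_le_right (b x), fun x y => ?_⟩
        have h1 := congrArg (resUnit (show (W x ⊓ W' x) ⊓ (W y ⊓ W' y) ≤ W x ⊓ W y from
          inf_le_inf inf_le_left inf_le_left)) (h x y)
        have h2 := congrArg (resUnit (show (W x ⊓ W' x) ⊓ (W y ⊓ W' y) ≤ W' x ⊓ W' y from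
          inf_le_inf inf_le_right inf_le_right)) (h' x y)
        simp only [map_mul, resUnit_resUnit] at h1 h2 ⊢
        rw [← mul_assoc, h1, mul_assoc, h2, mul_assoc] }

/-- The tensor product of line bundles. -/
def LineCocycle.mul (c d : LineCocycle X) : LineCocycle X where
  U x := c.U x ⊓ d.U x
  mem x := ⟨c.mem x, d.mem x⟩
  g x y := resUnit (inf_le_inf inf_le_left inf_le_left) (c.g x y) *
    resUnit (inf_le_inf inf_le_right inf_le_right) (d.g x y)
  cocycle x y z := by
    have h1 := congrArg (resUnit (show (c.U x ⊓ d.U x) ⊓ (c.U y ⊓ d.U y) ⊓ (c.U z ⊓ d.U z) ≤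
      c.U x ⊓ c.U y ⊓ c.U z from inf_le_inf (inf_le_inf inf_le_left inf_le_left) inf_le_left))
      (c.cocycle x y z)
    have h2 := congrArg (resUnit (show (c.U x ⊓ d.U x) ⊓ (c.U y ⊓ d.U y) ⊓ (c.U z ⊓ d.U z) ≤
      d.U x ⊓ d.U y ⊓ d.U z from inf_le_inf (inf_le_inf inf_le_right inf_le_right) inf_le_right))
      (d.cocycle x y z)
    simp only [map_mul, resUnit_resUnit] at h1 h2 ⊢
    rw [mul_mul_mul_comm, h1, h2]

/-- The dual line bundle. -/
def LineCocycle.inv (c : LineCocycle X) : LineCocycle X where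
  U := c.U
  mem := c.mem
  g x y := (c.g x y)⁻¹
  cocycle x y z := by
    simp only [map_inv]
    rw [← mul_inv, c.cocycle x y z]

variable (X) in
/-- The trivial line bundle. -/
def LineCocycle.one : LineCocycle X where
  U _ := ⊤
  mem _ := trivial
  g _ _ := 1
  cocycle x y z := by simp

/-- The pullback of a line bundle. -/
def LineCocycle.pullback (f : X ⟶ Y) (c : LineCocycle Y) : LineCocycle X where
  U x := f ⁻¹ᵁ c.U (f x)
  mem x := c.mem (f x)
  g x y := pullUnit f (show f ⁻¹ᵁ c.U (f x) ⊓ f ⁻¹ᵁ c.U (f y) ≤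
    f ⁻¹ᵁ (c.U (f x) ⊓ c.U (f y)) from le_rfl) (c.g (f x) (f y))
  cocycle x y z := by
    have := congrArg (pullUnit f (show f ⁻¹ᵁ c.U (f x) ⊓ f ⁻¹ᵁ c.U (f y) ⊓ f ⁻¹ᵁ c.U (f z) ≤
      f ⁻¹ᵁ (c.U (f x) ⊓ c.U (f y) ⊓ c.U (f z)) from le_rfl)) (c.cocycle (f x) (f y) (f z))
    simpa only [map_mul, pullUnit_resUnit, resUnit_pullUnit] using this

lemma LineCocycle.res_mul (c d : LineCocycle X) {V : X.Opens} (x y : X)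
    (h : V ≤ (c.mul d).U x ⊓ (c.mul d).U y) (hc : V ≤ c.U x ⊓ c.U y) (hd : V ≤ d.U x ⊓ d.U y) :
    resUnit h ((c.mul d).g x y) = resUnit hc (c.g x y) * resUnit hd (d.g x y) := by
  have h' : V ≤ (c.U x ⊓ d.U x) ⊓ (c.U y ⊓ d.U y) := h
  change resUnit h' (resUnit _ (c.g x y) * resUnit _ (d.g x y)) = _
  rw [map_mul, resUnit_resUnit, resUnit_resUnit]

lemma LineCocycle.pull_mul (f : X ⟶ Y) (c d : LineCocycle Y) {V : X.Opens} (x y : Y)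
    (h : V ≤ f ⁻¹ᵁ ((c.mul d).U x ⊓ (c.mul d).U y)) (hc : V ≤ f ⁻¹ᵁ (c.U x ⊓ c.U y))
    (hd : V ≤ f ⁻¹ᵁ (d.U x ⊓ d.U y)) :
    pullUnit f h ((c.mul d).g x y) = pullUnit f hc (c.g x y) * pullUnit f hd (d.g x y) := by
  have h' : V ≤ f ⁻¹ᵁ ((c.U x ⊓ d.U x) ⊓ (c.U y ⊓ d.U y)) := h
  change pullUnit f h' (resUnit _ (c.g x y) * resUnit _ (d.g x y)) = _
  rw [map_mul, pullUnit_resUnit, pullUnit_resUnit]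

lemma LineCocycle.res_inv (c : LineCocycle X) {V : X.Opens} (x y : X)
    (h : V ≤ c.inv.U x ⊓ c.inv.U y) (hc : V ≤ c.U x ⊓ c.U y) :
    resUnit h (c.inv.g x y) = (resUnit hc (c.g x y))⁻¹ := by
  change resUnit hc (c.g x y)⁻¹ = _
  rw [map_inv]

lemma LineCocycle.res_one {V : X.Opens} (x y : X)
    (h : V ≤ (LineCocycle.one X).U x ⊓ (LineCocycle.one X).U y) :
    resUnit h ((LineCocycle.one X).g x y) = 1 :=
  map_one _

lemma LineCocycle.res_pullback (f : X ⟶ Y) (c : LineCocycle Y) {V : X.Opens} (x y : X)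
    (h : V ≤ (c.pullback f).U x ⊓ (c.pullback f).U y)
    (h' : V ≤ f ⁻¹ᵁ (c.U (f x) ⊓ c.U (f y))) :
    resUnit h ((c.pullback f).g x y) = pullUnit f h' (c.g (f x) (f y)) := by
  have h'' : V ≤ f ⁻¹ᵁ c.U (f x) ⊓ f ⁻¹ᵁ c.U (f y) := h
  change resUnit h'' (pullUnit f _ (c.g (f x) (f y))) = _
  rw [resUnit_pullUnit]

lemma LineCocycle.mul_congr {c c' d d' : LineCocycle X} (h : c ≈ c') (h' : d ≈ d') :
    c.mul d ≈ c'.mul d' := by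
  obtain ⟨W, hW, hc, hd, a, h⟩ := h
  obtain ⟨W', hW', hc', hd', b, h'⟩ := h'
  refine ⟨fun x => W x ⊓ W' x, fun x => ⟨hW x, hW' x⟩, fun x => inf_le_inf (hc x) (hc' x),
    fun x => inf_le_inf (hd x) (hd' x),
    fun x => resUnit inf_le_left (a x) * resUnit inf_le_right (b x), fun x y => ?_⟩
  have h1 := congrArg (resUnit (show (W x ⊓ W' x) ⊓ (W y ⊓ W' y) ≤ W x ⊓ W y from
    inf_le_inf inf_le_left inf_le_left)) (h x y)
  have h2 := congrArg (resUnit (show (W x ⊓ W' x) ⊓ (W y ⊓ W' y) ≤ W' x ⊓ W' y from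
    inf_le_inf inf_le_right inf_le_right)) (h' x y)
  simp only [map_mul, resUnit_resUnit] at h1 h2
  rw [LineCocycle.res_mul c d x y _ (inf_le_inf (inf_le_left.trans (hc x)) (inf_le_left.trans (hc y)))
    (inf_le_inf (inf_le_right.trans (hc' x)) (inf_le_right.trans (hc' y))),
    LineCocycle.res_mul c' d' x y _ (inf_le_inf (inf_le_left.trans (hd x)) (inf_le_left.trans (hd y)))
    (inf_le_inf (inf_le_right.trans (hd' x)) (inf_le_right.trans (hd' y)))]
  simp only [map_mul, resUnit_resUnit]
  rw [mul_mul_mul_comm, h1, h2, mul_mul_mul_comm]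

lemma LineCocycle.inv_congr {c c' : LineCocycle X} (h : c ≈ c') : c.inv ≈ c'.inv := by
  obtain ⟨W, hW, hc, hd, a, h⟩ := h
  refine ⟨W, hW, hc, hd, fun x => (a x)⁻¹, fun x y => ?_⟩
  rw [LineCocycle.res_inv c x y _ (inf_le_inf (hc x) (hc y)),
    LineCocycle.res_inv c' x y _ (inf_le_inf (hd x) (hd y)), map_inv, map_inv, ← mul_inv,
    ← mul_inv, h x y]

lemma LineCocycle.pullback_congr (f : X ⟶ Y) {c c' : LineCocycle Y} (h : c ≈ c') :
    c.pullback f ≈ c'.pullback f := by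
  obtain ⟨W, hW, hc, hd, a, h⟩ := h
  refine ⟨fun x => f ⁻¹ᵁ W (f x), fun x => hW (f x), fun x => f.preimage_mono (hc (f x)),
    fun x => f.preimage_mono (hd (f x)), fun x => pullUnit f le_rfl (a (f x)), fun x y => ?_⟩
  have := congrArg (pullUnit f (show f ⁻¹ᵁ W (f x) ⊓ f ⁻¹ᵁ W (f y) ≤
    f ⁻¹ᵁ (W (f x) ⊓ W (f y)) from le_rfl)) (h (f x) (f y))
  have hc' : f ⁻¹ᵁ W (f x) ⊓ f ⁻¹ᵁ W (f y) ≤ f ⁻¹ᵁ (c.U (f x) ⊓ c.U (f y)) :=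
    f.preimage_mono (inf_le_inf (hc _) (hc _))
  have hd' : f ⁻¹ᵁ W (f x) ⊓ f ⁻¹ᵁ W (f y) ≤ f ⁻¹ᵁ (c'.U (f x) ⊓ c'.U (f y)) :=
    f.preimage_mono (inf_le_inf (hd _) (hd _))
  rw [LineCocycle.res_pullback f c x y _ hc', LineCocycle.res_pullback f c' x y _ hd']
  simpa only [map_mul, pullUnit_resUnit, resUnit_pullUnit] using this

/-- Line bundles with the same transition functions on smaller opens are isomorphic. -/
lemma LineCocycle.iso_of_eq {c d : LineCocycle X} (W : X → X.Opens) (hW : ∀ x, x ∈ W x)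
    (hc : ∀ x, W x ≤ c.U x) (hd : ∀ x, W x ≤ d.U x)
    (h : ∀ x y, resUnit (inf_le_inf (hc x) (hc y)) (c.g x y) =
      resUnit (inf_le_inf (hd x) (hd y)) (d.g x y)) : c ≈ d :=
  ⟨W, hW, hc, hd, fun _ => 1, fun x y => by simp [h x y]⟩

variable (X) in
/-- The Picard group: isomorphism classes of line bundles, with the tensor product. -/
def Pic : Type u := Quotient (LineCocycle.setoid X)

lemma LineCocycle.mul_assoc_iso (c d e : LineCocycle X) :
    (c.mul d).mul e ≈ c.mul (d.mul e) := by
  have hc : ∀ x, c.U x ⊓ d.U x ⊓ e.U x ≤ c.U x := fun x => inf_le_left.trans inf_le_left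
  have hd : ∀ x, c.U x ⊓ d.U x ⊓ e.U x ≤ d.U x := fun x => inf_le_left.trans inf_le_right
  have he : ∀ x, c.U x ⊓ d.U x ⊓ e.U x ≤ e.U x := fun x => inf_le_right
  refine LineCocycle.iso_of_eq (fun x => c.U x ⊓ d.U x ⊓ e.U x)
    (fun x => ⟨⟨c.mem x, d.mem x⟩, e.mem x⟩) (fun _ => le_rfl)
    (fun x => le_inf (hc x) (le_inf (hd x) (he x))) fun x y => ?_
  rw [LineCocycle.res_mul (c.mul d) e x y _ (inf_le_inf (le_inf (hc x) (hd x))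
      (le_inf (hc y) (hd y))) (inf_le_inf (he x) (he y)),
    LineCocycle.res_mul c (d.mul e) x y _ (inf_le_inf (hc x) (hc y))
      (inf_le_inf (le_inf (hd x) (he x)) (le_inf (hd y) (he y))),
    LineCocycle.res_mul c d x y _ (inf_le_inf (hc x) (hc y)) (inf_le_inf (hd x) (hd y)),
    LineCocycle.res_mul d e x y _ (inf_le_inf (hd x) (hd y)) (inf_le_inf (he x) (he y)),
    mul_assoc]

lemma LineCocycle.one_mul_iso (c : LineCocycle X) : (LineCocycle.one X).mul c ≈ c := by
  refine LineCocycle.iso_of_eq c.U c.mem (fun _ => le_inf le_top le_rfl)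
    (fun _ => le_rfl) fun x y => ?_
  rw [LineCocycle.res_mul _ c x y _ (le_inf le_top le_top) le_rfl, LineCocycle.res_one, one_mul]

lemma LineCocycle.inv_mul_iso (c : LineCocycle X) : c.inv.mul c ≈ LineCocycle.one X := by
  have h1 : ∀ x, c.U x ≤ c.inv.U x := fun _ => le_rfl
  have h2 : ∀ x, c.U x ≤ (c.inv.mul c).U x := fun x => le_inf (h1 x) le_rfl
  refine LineCocycle.iso_of_eq c.U c.mem h2 (fun _ => le_top) fun x y => ?_
  rw [LineCocycle.res_mul _ c x y _ (inf_le_inf (h1 x) (h1 y)) le_rfl, LineCocycle.res_one,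
    LineCocycle.res_inv c x y _ le_rfl, inv_mul_cancel]

lemma LineCocycle.mul_comm_iso (c d : LineCocycle X) : c.mul d ≈ d.mul c := by
  refine LineCocycle.iso_of_eq (fun x => c.U x ⊓ d.U x)
    (fun x => ⟨c.mem x, d.mem x⟩) (fun _ => le_rfl) (fun _ => (inf_comm _ _).le) fun x y => ?_
  rw [LineCocycle.res_mul c d x y _ (inf_le_inf inf_le_left inf_le_left)
      (inf_le_inf inf_le_right inf_le_right),
    LineCocycle.res_mul d c x y _ (inf_le_inf inf_le_right inf_le_right)
      (inf_le_inf inf_le_left inf_le_left), mul_comm]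

lemma LineCocycle.pullback_mul_iso (f : X ⟶ Y) (c d : LineCocycle Y) :
    (c.mul d).pullback f ≈ (c.pullback f).mul (d.pullback f) := by
  have hc : ∀ x, f ⁻¹ᵁ c.U (f x) ⊓ f ⁻¹ᵁ d.U (f x) ≤ f ⁻¹ᵁ c.U (f x) := fun x => inf_le_left
  have hd : ∀ x, f ⁻¹ᵁ c.U (f x) ⊓ f ⁻¹ᵁ d.U (f x) ≤ f ⁻¹ᵁ d.U (f x) := fun x => inf_le_right
  have h1 : ∀ x, f ⁻¹ᵁ c.U (f x) ⊓ f ⁻¹ᵁ d.U (f x) ≤ ((c.mul d).pullback f).U x :=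
    fun _ => le_rfl
  have h2 : ∀ x, f ⁻¹ᵁ c.U (f x) ⊓ f ⁻¹ᵁ d.U (f x) ≤ ((c.pullback f).mul (d.pullback f)).U x :=
    fun _ => le_rfl
  refine LineCocycle.iso_of_eq (fun x => f ⁻¹ᵁ c.U (f x) ⊓ f ⁻¹ᵁ d.U (f x))
    (fun x => ⟨c.mem (f x), d.mem (f x)⟩) h1 h2 fun x y => ?_
  refine (LineCocycle.res_pullback f (c.mul d) x y _ le_rfl).trans ?_
  refine Eq.trans ?_ (LineCocycle.res_mul (c.pullback f) (d.pullback f) x y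
    (inf_le_inf (h2 x) (h2 y)) (inf_le_inf (hc x) (hc y)) (inf_le_inf (hd x) (hd y))).symm
  refine Eq.trans ?_ (congrArg₂ (· * ·)
    (LineCocycle.res_pullback f c x y _ (inf_le_inf (hc x) (hc y)))
    (LineCocycle.res_pullback f d x y _ (inf_le_inf (hd x) (hd y)))).symm
  exact LineCocycle.pull_mul f c d (f x) (f y) _ _ _

lemma LineCocycle.pullback_id_iso (c : LineCocycle X) : c.pullback (𝟙 X) ≈ c := by
  have h1 : ∀ x, c.U x ≤ (c.pullback (𝟙 X)).U x := fun _ => le_rfl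
  refine LineCocycle.iso_of_eq c.U c.mem h1 (fun _ => le_rfl) fun x y => ?_
  exact (LineCocycle.res_pullback (𝟙 X) c x y _ le_rfl).trans (pullUnit_id _ _)

lemma LineCocycle.pullback_comp_iso (f : X ⟶ Y) (g : Y ⟶ Z) (c : LineCocycle Z) :
    c.pullback (f ≫ g) ≈ (c.pullback g).pullback f := by
  have h1 : ∀ x, f ⁻¹ᵁ g ⁻¹ᵁ c.U (g (f x)) ≤ (c.pullback (f ≫ g)).U x := fun _ => le_rfl
  have h2 : ∀ x, f ⁻¹ᵁ g ⁻¹ᵁ c.U (g (f x)) ≤ ((c.pullback g).pullback f).U x := fun _ => le_rfl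
  refine LineCocycle.iso_of_eq (fun x => f ⁻¹ᵁ g ⁻¹ᵁ c.U (g (f x)))
    (fun x => c.mem (g (f x))) h1 h2 fun x y => ?_
  refine (LineCocycle.res_pullback (f ≫ g) c x y _ le_rfl).trans ?_
  refine Eq.trans ?_ (LineCocycle.res_pullback f (c.pullback g) x y _ le_rfl).symm
  exact (pullUnit_pullUnit f g _ _ (c.g (g (f x)) (g (f y)))).symm

instance : CommGroup (Pic X) where
  mul := Quotient.map₂ LineCocycle.mul fun _ _ h _ _ h' => LineCocycle.mul_congr h h'
  one := Quotient.mk _ (LineCocycle.one X)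
  inv := Quotient.map LineCocycle.inv fun _ _ h => LineCocycle.inv_congr h
  mul_assoc := by
    rintro ⟨c⟩ ⟨d⟩ ⟨e⟩
    exact Quotient.sound (LineCocycle.mul_assoc_iso c d e)
  one_mul := by
    rintro ⟨c⟩
    exact Quotient.sound (LineCocycle.one_mul_iso c)
  mul_one := by
    rintro ⟨c⟩
    exact Quotient.sound (Setoid.trans (LineCocycle.mul_comm_iso _ _) (LineCocycle.one_mul_iso c))
  inv_mul_cancel := by
    rintro ⟨c⟩
    exact Quotient.sound (LineCocycle.inv_mul_iso c)
  mul_comm := by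
    rintro ⟨c⟩ ⟨d⟩
    exact Quotient.sound (LineCocycle.mul_comm_iso c d)

/-- The isomorphism class of a line bundle. -/
def Pic.mk (c : LineCocycle X) : Pic X := Quotient.mk _ c

lemma Pic.mk_mul (c d : LineCocycle X) : Pic.mk (c.mul d) = Pic.mk c * Pic.mk d := rfl

lemma Pic.mk_one : Pic.mk (LineCocycle.one X) = 1 := rfl

lemma Pic.mk_eq_mk {c d : LineCocycle X} : Pic.mk c = Pic.mk d ↔ c ≈ d := Quotient.eq

lemma Pic.mk_surjective : Function.Surjective (Pic.mk : LineCocycle X → Pic X) :=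
  Quotient.mk_surjective

/-- Pullback of line bundles, on Picard groups. -/
def Pic.map (f : X ⟶ Y) : Pic Y →* Pic X :=
  MonoidHom.mk' (fun c => Quotient.map (LineCocycle.pullback f)
    (fun _ _ h => LineCocycle.pullback_congr f h) c) (by
      rintro ⟨c⟩ ⟨d⟩
      exact Quotient.sound (LineCocycle.pullback_mul_iso f c d))

lemma Pic.map_mk (f : X ⟶ Y) (c : LineCocycle Y) : Pic.map f (Pic.mk c) = Pic.mk (c.pullback f) :=
  rfl

lemma Pic.map_eq_id (f : X ⟶ X) (h : f = 𝟙 X) (c : Pic X) : Pic.map f c = c := by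
  subst h
  obtain ⟨c, rfl⟩ := Pic.mk_surjective c
  exact Quotient.sound (LineCocycle.pullback_id_iso c)

lemma Pic.map_eq_comp (f : X ⟶ Y) (g : Y ⟶ Z) (h : X ⟶ Z) (e : h = f ≫ g) (c : Pic Z) :
    Pic.map h c = Pic.map f (Pic.map g c) := by
  subst e
  obtain ⟨c, rfl⟩ := Pic.mk_surjective c
  exact Quotient.sound (LineCocycle.pullback_comp_iso f g c)

end Schemes

/-! #### Rational functions and Cartier divisors on integral schemes -/

section Integral

variable {X Y Z : Scheme.{u}} [IsIntegral X] [IsIntegral Y] [IsIntegral Z]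

lemma genericPoint_mem {U : X.Opens} {x : X} (hx : x ∈ U) : genericPoint X ∈ U :=
  ((genericPoint_spec X).mem_open_set_iff U.isOpen).mpr ⟨x, trivial, hx⟩

/-- The germ at the generic point of an invertible function. -/
def germUnit {U : X.Opens} (hU : genericPoint X ∈ U) : Γ(X, U)ˣ →* X.functionFieldˣ :=
  Units.map (X.presheaf.germ U (genericPoint X) hU).hom.toMonoidHom

lemma germUnit_injective {U : X.Opens} (hU : genericPoint X ∈ U) :
    Function.Injective (germUnit hU) :=
  Units.map_injective (germ_injective_of_isIntegral (X := X) _ hU)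

@[simp]
lemma germUnit_resUnit {U V : X.Opens} (h : V ≤ U) (hV : genericPoint X ∈ V) (s : Γ(X, U)ˣ) :
    germUnit hV (resUnit h s) = germUnit (h hV) s := by
  ext
  simp only [germUnit, resUnit, Units.coe_map]
  change X.presheaf.germ V _ hV (X.presheaf.map _ _) = _
  rw [TopCat.Presheaf.germ_res_apply]
  rfl

/-- The group of rational functions that are invertible at the point `x`. -/
def localUnits (x : X) : Subgroup X.functionFieldˣ :=
  (Units.map (algebraMap (X.presheaf.stalk x) X.functionField).toMonoidHom).range

lemma germUnit_mem_localUnits {U : X.Opens} {x : X} (hx : x ∈ U) (s : Γ(X, U)ˣ) :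
    germUnit (genericPoint_mem hx) s ∈ localUnits x := by
  refine ⟨Units.map (X.presheaf.germ U x hx).hom.toMonoidHom s, ?_⟩
  ext
  have : Nonempty U := ⟨⟨x, hx⟩⟩
  exact Scheme.algebraMap_germ_eq_germToFunctionField X hx _

/-- A rational function which is regular at all points of an open set `U` is (the germ of) a
section over `U`. -/
lemma exists_section_of_forall_mem_range {U : X.Opens} (hU : genericPoint X ∈ U)
    (f : X.functionField)
    (h : ∀ x ∈ U, f ∈ (algebraMap (X.presheaf.stalk x) X.functionField).range) :
    ∃ s : Γ(X, U), X.presheaf.germ U (genericPoint X) hU s = f := by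
  have key : ∀ x : U, ∃ (V : X.Opens) (hV : V ≤ U) (hx : x.1 ∈ V) (s : Γ(X, V)),
      X.presheaf.germ V (genericPoint X) (genericPoint_mem hx) s = f := by
    intro x
    obtain ⟨t, ht⟩ := h x.1 x.2
    obtain ⟨V, hV, s, rfl⟩ := X.presheaf.exists_germ_eq t
    refine ⟨V ⊓ U, inf_le_right, ⟨hV, x.2⟩, X.presheaf.map (homOfLE inf_le_left).op s, ?_⟩
    rw [TopCat.Presheaf.germ_res_apply, ← ht]
    have : Nonempty V := ⟨⟨x, hV⟩⟩
    exact (Scheme.algebraMap_germ_eq_germToFunctionField X hV _).symm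
  choose V hV hx s hs using key
  obtain ⟨t, ht, -⟩ := X.sheaf.existsUnique_gluing' V U (fun x => homOfLE (hV x))
    (fun x hxU => Opens.mem_iSup.2 ⟨⟨x, hxU⟩, hx ⟨x, hxU⟩⟩) s (by
      intro x y
      apply germ_injective_of_isIntegral (X := X) (genericPoint X)
        (show genericPoint X ∈ V x ⊓ V y from ⟨genericPoint_mem (hx x), genericPoint_mem (hx y)⟩)
      refine (TopCat.Presheaf.germ_res_apply X.presheaf _ _ _ _).trans ?_
      refine Eq.trans ?_ (TopCat.Presheaf.germ_res_apply X.presheaf _ _ _ _).symm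
      rw [hs, hs])
  refine ⟨t, ?_⟩
  have h1 := ht ⟨_, hU⟩
  rw [← hs ⟨_, hU⟩, ← h1]
  exact (TopCat.Presheaf.germ_res_apply X.presheaf _ _ _ _).symm

/-- A rational function which is invertible at all points of an open set `U` is (the germ of) an
invertible section over `U`. -/
lemma exists_unit_section {U : X.Opens} (hU : genericPoint X ∈ U) (f : X.functionFieldˣ)
    (h : ∀ x ∈ U, f ∈ localUnits x) : ∃ s : Γ(X, U)ˣ, germUnit hU s = f := by
  have hreg : ∀ f : X.functionFieldˣ, (∀ x ∈ U, f ∈ localUnits x) →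
      ∃ s : Γ(X, U), X.presheaf.germ U (genericPoint X) hU s = f := by
    intro f hf
    refine exists_section_of_forall_mem_range hU f fun x hx => ?_
    obtain ⟨t, rfl⟩ := hf x hx
    exact ⟨t, rfl⟩
  obtain ⟨s, hs⟩ := hreg f h
  obtain ⟨t, ht⟩ := hreg f⁻¹ fun x hx => inv_mem (h x hx)
  have hst : s * t = 1 := by
    apply germ_injective_of_isIntegral (X := X) (genericPoint X) hU
    rw [map_mul, map_one, hs, ht, Units.mul_inv]
  refine ⟨⟨s, t, hst, (mul_comm t s).trans hst⟩, ?_⟩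
  ext
  exact hs

lemma map_genericPoint (f : X ⟶ Y) [IsDominant f] : f (genericPoint X) = genericPoint Y := by
  have h1 := (genericPoint_spec X).image f.continuous
  have h2 : closure (f '' Set.univ) = Set.univ := by
    rw [Set.image_univ]
    exact f.denseRange.closure_range
  rw [h2] at h1
  exact h1.eq (genericPoint_spec Y)

/-- Pullback of rational functions along a dominant morphism of integral schemes. -/
def functionFieldMap (f : X ⟶ Y) [IsDominant f] : Y.functionField →+* X.functionField :=
  (Y.presheaf.stalkSpecializes (specializes_of_eq (map_genericPoint f)) ≫
    f.stalkMap (genericPoint X)).hom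

lemma functionFieldMap_germ (f : X ⟶ Y) [IsDominant f] {U : Y.Opens} (hU : genericPoint Y ∈ U)
    {V : X.Opens} (hV : genericPoint X ∈ V) (h : V ≤ f ⁻¹ᵁ U) (s : Γ(Y, U)) :
    functionFieldMap f (Y.presheaf.germ U (genericPoint Y) hU s) =
      X.presheaf.germ V (genericPoint X) hV (f.appLE U V h s) := by
  have h' : f (genericPoint X) ∈ U := by rwa [map_genericPoint]
  change (Y.presheaf.germ U (genericPoint Y) hU ≫ Y.presheaf.stalkSpecializes _ ≫
    f.stalkMap (genericPoint X)) s = _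
  rw [TopCat.Presheaf.germ_stalkSpecializes_assoc, Scheme.Hom.germ_stalkMap, Scheme.Hom.appLE,
    ← X.presheaf.germ_res (homOfLE h) _ hV]
  rfl

lemma functionFieldMap_eq_id (f : X ⟶ X) [IsDominant f] (h : f = 𝟙 X) (s : X.functionField) :
    functionFieldMap f s = s := by
  subst h
  obtain ⟨U, hU, s, rfl⟩ := X.presheaf.exists_germ_eq s
  rw [functionFieldMap_germ (𝟙 X) hU hU le_rfl]
  have h1 : (𝟙 X : X ⟶ X).appLE U U le_rfl = 𝟙 _ := by
    simp only [Scheme.Hom.appLE, Scheme.Hom.id_app]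
    exact (Category.id_comp _).trans (X.presheaf.map_id _)
  rw [h1]
  rfl

lemma functionFieldMap_eq_comp (f : X ⟶ Y) (g : Y ⟶ Z) (h : X ⟶ Z) [IsDominant f] [IsDominant g]
    [IsDominant h] (e : h = f ≫ g) (s : Z.functionField) :
    functionFieldMap h s = functionFieldMap f (functionFieldMap g s) := by
  subst e
  obtain ⟨U, hU, s, rfl⟩ := Z.presheaf.exists_germ_eq s
  have hV : genericPoint Y ∈ g ⁻¹ᵁ U := by
    change g (genericPoint Y) ∈ U; rwa [map_genericPoint]
  have hW : genericPoint X ∈ f ⁻¹ᵁ g ⁻¹ᵁ U := by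
    change f (genericPoint X) ∈ g ⁻¹ᵁ U; rwa [map_genericPoint]
  rw [functionFieldMap_germ g hU hV le_rfl, functionFieldMap_germ f hV hW le_rfl,
    functionFieldMap_germ (f ≫ g) hU hW le_rfl]
  congr 1
  change _ = (g.appLE _ _ _ ≫ f.appLE _ _ _) s
  rw [Scheme.Hom.appLE_comp_appLE]

/-- Pullback of nonzero rational functions along a dominant morphism of integral schemes. -/
def ratMap (f : X ⟶ Y) [IsDominant f] : Y.functionFieldˣ →* X.functionFieldˣ :=
  Units.map (functionFieldMap f).toMonoidHom

lemma ratMap_eq_id (f : X ⟶ X) [IsDominant f] (h : f = 𝟙 X) (s : X.functionFieldˣ) :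
    ratMap f s = s := by
  ext; exact functionFieldMap_eq_id f h _

lemma ratMap_eq_comp (f : X ⟶ Y) (g : Y ⟶ Z) (h : X ⟶ Z) [IsDominant f] [IsDominant g]
    [IsDominant h] (e : h = f ≫ g) (s : Z.functionFieldˣ) :
    ratMap h s = ratMap f (ratMap g s) := by
  ext; exact functionFieldMap_eq_comp f g h e _

lemma ratMap_germUnit (f : X ⟶ Y) [IsDominant f] {U : Y.Opens} (hU : genericPoint Y ∈ U)
    {V : X.Opens} (hV : genericPoint X ∈ V) (h : V ≤ f ⁻¹ᵁ U) (s : Γ(Y, U)ˣ) :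
    ratMap f (germUnit hU s) = germUnit hV (pullUnit f h s) := by
  ext; exact functionFieldMap_germ f hU hV h _

lemma ratMap_mem_localUnits (f : X ⟶ Y) [IsDominant f] (x : X) {s : Y.functionFieldˣ}
    (hs : s ∈ localUnits (f x)) : ratMap f s ∈ localUnits x := by
  obtain ⟨t, rfl⟩ := hs
  refine ⟨Units.map (f.stalkMap x).hom.toMonoidHom t, ?_⟩
  ext
  obtain ⟨U, hU, t', ht'⟩ := Y.presheaf.exists_germ_eq (t : Y.presheaf.stalk (f x))
  change algebraMap (X.presheaf.stalk x) X.functionField (f.stalkMap x t) =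
    functionFieldMap f (algebraMap (Y.presheaf.stalk (f x)) Y.functionField t)
  have hU' : x ∈ f ⁻¹ᵁ U := hU
  have : Nonempty U := ⟨⟨_, hU⟩⟩
  have : Nonempty (f ⁻¹ᵁ U : X.Opens) := ⟨⟨_, hU'⟩⟩
  rw [← ht', Scheme.algebraMap_germ_eq_germToFunctionField Y hU, Scheme.Hom.germ_stalkMap_apply,
    Scheme.algebraMap_germ_eq_germToFunctionField X hU',
    functionFieldMap_germ f _ (genericPoint_mem hU') le_rfl, Scheme.Hom.appLE]
  simp

variable (X) in
/-- The group of Cartier divisors of an integral scheme, i.e. the global sections of the sheaf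
`K^× / O^×`: families of classes in `K^× / O_x^×` which are locally given by a single rational
function. On a smooth scheme over a field, whose local rings are factorial, Cartier divisors are the
same as Weil divisors. -/
def CartierDiv : Subgroup (∀ x : X, X.functionFieldˣ ⧸ localUnits x) where
  carrier := {D | ∀ x, ∃ (U : X.Opens) (_ : x ∈ U) (f : X.functionFieldˣ),
    ∀ y ∈ U, D y = QuotientGroup.mk f}
  one_mem' x := ⟨⊤, trivial, 1, fun _ _ => rfl⟩
  mul_mem' := by
    intro D E hD hE x
    obtain ⟨U, hU, f, hf⟩ := hD x
    obtain ⟨V, hV, g, hg⟩ := hE x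
    exact ⟨U ⊓ V, ⟨hU, hV⟩, f * g, fun y hy => by
      rw [Pi.mul_apply, hf y hy.1, hg y hy.2, QuotientGroup.mk_mul]⟩
  inv_mem' := by
    intro D hD x
    obtain ⟨U, hU, f, hf⟩ := hD x
    exact ⟨U, hU, f⁻¹, fun y hy => by rw [Pi.inv_apply, hf y hy, QuotientGroup.mk_inv]⟩

variable (X) in
/-- The principal divisor of a nonzero rational function. -/
def principalDiv : X.functionFieldˣ →* CartierDiv X where
  toFun f := ⟨fun _ => QuotientGroup.mk f, fun _ => ⟨⊤, trivial, f, fun _ _ => rfl⟩⟩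
  map_one' := rfl
  map_mul' _ _ := rfl

/-- Pullback of germs of Cartier divisors. -/
def localDivMap (f : X ⟶ Y) [IsDominant f] (x : X) :
    Y.functionFieldˣ ⧸ localUnits (f x) →* X.functionFieldˣ ⧸ localUnits x :=
  QuotientGroup.map (localUnits (f x)) (localUnits x) (ratMap f) fun _ hs =>
    Subgroup.mem_comap.2 (ratMap_mem_localUnits f x hs)

/-- Pullback of Cartier divisors along a dominant morphism of integral schemes. -/
def CartierDiv.map (f : X ⟶ Y) [IsDominant f] : CartierDiv Y →* CartierDiv X where
  toFun D := ⟨fun x => localDivMap f x (D.1 (f x)), fun x => by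
      obtain ⟨U, hU, s, hs⟩ := D.2 (f x)
      exact ⟨f ⁻¹ᵁ U, hU, ratMap f s, fun y hy =>
        congrArg (localDivMap f y) (hs (f y) hy)⟩⟩
  map_one' := by ext x; exact map_one (localDivMap f x)
  map_mul' D E := by ext x; exact map_mul (localDivMap f x) _ _

lemma CartierDiv.map_apply (f : X ⟶ Y) [IsDominant f] (D : CartierDiv Y) (x : X)
    (s : Y.functionFieldˣ) (h : D.1 (f x) = QuotientGroup.mk s) :
    (CartierDiv.map f D).1 x = QuotientGroup.mk (ratMap f s) := by
  exact congrArg (localDivMap f x) h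

lemma CartierDiv.map_eq_id (f : X ⟶ X) [IsDominant f] (h : f = 𝟙 X) (D : CartierDiv X) :
    CartierDiv.map f D = D := by
  ext x
  have hx : f x = x := by rw [h]; rfl
  obtain ⟨s, hs⟩ := QuotientGroup.mk_surjective (D.1 x)
  rw [CartierDiv.map_apply f D x s (by subst h; exact hs.symm), ratMap_eq_id f h, hs]

lemma CartierDiv.map_eq_comp (f : X ⟶ Y) (g : Y ⟶ Z) (h : X ⟶ Z) [IsDominant f] [IsDominant g]
    [IsDominant h] (e : h = f ≫ g) (D : CartierDiv Z) :
    CartierDiv.map h D = CartierDiv.map f (CartierDiv.map g D) := by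
  ext x
  obtain ⟨s, hs⟩ := QuotientGroup.mk_surjective (D.1 (g (f x)))
  rw [CartierDiv.map_apply h D x s (by subst e; exact hs.symm),
    CartierDiv.map_apply f _ x (ratMap g s) (CartierDiv.map_apply g D _ s hs.symm),
    ratMap_eq_comp f g h e]

lemma CartierDiv.map_principalDiv (f : X ⟶ Y) [IsDominant f] (s : Y.functionFieldˣ) :
    CartierDiv.map f (principalDiv Y s) = principalDiv X (ratMap f s) := rfl

/-- An effective way of recording a Cartier divisor: an open cover with rational functions whose
quotients are invertible on the overlaps. -/
structure LocalEquations (X : Scheme.{u}) [IsIntegral X] where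
  U : X → X.Opens
  mem : ∀ x, x ∈ U x
  f : X → X.functionFieldˣ
  unit : ∀ x y, ∀ z ∈ U x ⊓ U y, f x / f y ∈ localUnits z

/-- The invertible section `f x / f y` on the overlap `U x ∩ U y`. -/
def LocalEquations.sec (e : LocalEquations X) (x y : X) : Γ(X, e.U x ⊓ e.U y)ˣ :=
  (exists_unit_section (U := e.U x ⊓ e.U y)
    ⟨genericPoint_mem (e.mem x), genericPoint_mem (e.mem y)⟩ (e.f x / e.f y) (e.unit x y)).choose

lemma LocalEquations.germUnit_sec (e : LocalEquations X) (x y : X)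
    (h : genericPoint X ∈ e.U x ⊓ e.U y) : germUnit h (e.sec x y) = e.f x / e.f y :=
  (exists_unit_section (U := e.U x ⊓ e.U y) h (e.f x / e.f y) (e.unit x y)).choose_spec

/-- The line bundle `O(D)` of a divisor `D` with local equations `f x`: its transition functions
are `f x / f y`. -/
def LocalEquations.toLineCocycle (e : LocalEquations X) : LineCocycle X where
  U := e.U
  mem := e.mem
  g := e.sec
  cocycle x y z := by
    have hη : genericPoint X ∈ e.U x ⊓ e.U y ⊓ e.U z :=
      ⟨⟨genericPoint_mem (e.mem x), genericPoint_mem (e.mem y)⟩, genericPoint_mem (e.mem z)⟩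
    apply germUnit_injective hη
    rw [map_mul, germUnit_resUnit, germUnit_resUnit, germUnit_resUnit, e.germUnit_sec,
      e.germUnit_sec, e.germUnit_sec, div_mul_div_cancel]

/-- Local equations of the same divisor define isomorphic line bundles. -/
lemma LocalEquations.mk_eq (e e' : LocalEquations X)
    (h : ∀ x, ∀ z ∈ e.U x ⊓ e'.U x, e.f x / e'.f x ∈ localUnits z) :
    Pic.mk e.toLineCocycle = Pic.mk e'.toLineCocycle := by
  have hη : ∀ x, genericPoint X ∈ e.U x ⊓ e'.U x := fun x =>
    ⟨genericPoint_mem (e.mem x), genericPoint_mem (e'.mem x)⟩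
  choose a ha using fun x => exists_unit_section (hη x) (e.f x / e'.f x) (h x)
  have hc : ∀ x, e.U x ⊓ e'.U x ≤ e.toLineCocycle.U x := fun x => inf_le_left
  have hd : ∀ x, e.U x ⊓ e'.U x ≤ e'.toLineCocycle.U x := fun x => inf_le_right
  refine Pic.mk_eq_mk.2 ⟨fun x => e.U x ⊓ e'.U x, fun x => ⟨e.mem x, e'.mem x⟩, hc, hd, a,
    fun x y => ?_⟩
  have hxy : genericPoint X ∈ (e.U x ⊓ e'.U x) ⊓ (e.U y ⊓ e'.U y) := ⟨hη x, hη y⟩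
  apply germUnit_injective hxy
  rw [map_mul, map_mul, germUnit_resUnit, germUnit_resUnit, germUnit_resUnit, germUnit_resUnit, ha,
    ha]
  have h1 := e.germUnit_sec x y ⟨(hη x).1, (hη y).1⟩
  have h2 := e'.germUnit_sec x y ⟨(hη x).2, (hη y).2⟩
  refine (congrArg (· * (e.f y / e'.f y)) h1).trans
    (Eq.trans ?_ (congrArg ((e.f x / e'.f x) * ·) h2).symm)
  rw [div_mul_div_cancel, div_mul_div_cancel]

/-- The local equations `e` define the divisor `D`. -/
def LocalEquations.Defines (e : LocalEquations X) (D : CartierDiv X) : Prop :=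
  ∀ x, ∀ y ∈ e.U x, D.1 y = QuotientGroup.mk (e.f x)

lemma mk_eq_mk_iff_div_mem {x : X} (f g : X.functionFieldˣ) :
    (QuotientGroup.mk f : X.functionFieldˣ ⧸ localUnits x) = QuotientGroup.mk g ↔
      f / g ∈ localUnits x := by
  rw [QuotientGroup.eq_iff_div_mem]

lemma LocalEquations.exists_defines (D : CartierDiv X) :
    ∃ e : LocalEquations X, e.Defines D := by
  choose U hU f hf using D.2
  exact ⟨⟨U, hU, f, fun x y z hz => by
    rw [← mk_eq_mk_iff_div_mem, ← hf x z hz.1, ← hf y z hz.2]⟩, hf⟩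

lemma LocalEquations.mk_eq_of_defines {D : CartierDiv X} {e e' : LocalEquations X}
    (h : e.Defines D) (h' : e'.Defines D) :
    Pic.mk e.toLineCocycle = Pic.mk e'.toLineCocycle :=
  e.mk_eq e' fun x z hz => by
    rw [← mk_eq_mk_iff_div_mem, ← h x z hz.1, ← h' x z hz.2]

/-- The class in the Picard group of the line bundle `O(D)`. -/
def CartierDiv.cls (D : CartierDiv X) : Pic X :=
  Pic.mk (LocalEquations.exists_defines D).choose.toLineCocycle

lemma CartierDiv.cls_eq {D : CartierDiv X} {e : LocalEquations X} (h : e.Defines D) :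
    CartierDiv.cls D = Pic.mk e.toLineCocycle :=
  LocalEquations.mk_eq_of_defines (LocalEquations.exists_defines D).choose_spec h

lemma CartierDiv.cls_mul (D E : CartierDiv X) : CartierDiv.cls (D * E) = CartierDiv.cls D * CartierDiv.cls E := by
  obtain ⟨d, hd⟩ := LocalEquations.exists_defines D
  obtain ⟨e, he⟩ := LocalEquations.exists_defines E
  let p : LocalEquations X :=
    { U := fun x => d.U x ⊓ e.U x
      mem := fun x => ⟨d.mem x, e.mem x⟩
      f := fun x => d.f x * e.f x
      unit := fun x y z hz => by
        rw [mul_div_mul_comm]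
        exact mul_mem (d.unit x y z ⟨hz.1.1, hz.2.1⟩) (e.unit x y z ⟨hz.1.2, hz.2.2⟩) }
  have hp : p.Defines (D * E) := fun x y hy => by
    change D.1 y * E.1 y = _
    rw [hd x y hy.1, he x y hy.2, ← QuotientGroup.mk_mul]
  rw [CartierDiv.cls_eq hd, CartierDiv.cls_eq he, CartierDiv.cls_eq hp, ← Pic.mk_mul, Pic.mk_eq_mk]
  have h1 : ∀ x, d.U x ⊓ e.U x ≤ (d.toLineCocycle.mul e.toLineCocycle).U x := fun _ => le_rfl
  refine LineCocycle.iso_of_eq p.U p.mem (fun _ => le_rfl) h1 fun x y => ?_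
  have hη : ∀ x, genericPoint X ∈ d.U x ⊓ e.U x := fun x =>
    ⟨genericPoint_mem (d.mem x), genericPoint_mem (e.mem x)⟩
  have hxy : genericPoint X ∈ p.U x ⊓ p.U y := ⟨hη x, hη y⟩
  apply germUnit_injective hxy
  have hdd : p.U x ⊓ p.U y ≤ d.U x ⊓ d.U y := inf_le_inf inf_le_left inf_le_left
  have hee : p.U x ⊓ p.U y ≤ e.U x ⊓ e.U y := inf_le_inf inf_le_right inf_le_right
  refine Eq.trans ?_ (congrArg (germUnit hxy) (LineCocycle.res_mul d.toLineCocycle e.toLineCocycle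
    x y (inf_le_inf (h1 x) (h1 y)) hdd hee)).symm
  refine (germUnit_resUnit _ hxy _).trans ((p.germUnit_sec x y hxy).trans (Eq.trans ?_
    ((map_mul _ _ _).trans (congrArg₂ (· * ·)
      ((germUnit_resUnit hdd hxy _).trans (d.germUnit_sec x y (hdd hxy)))
      ((germUnit_resUnit hee hxy _).trans (e.germUnit_sec x y (hee hxy))))).symm))
  exact mul_div_mul_comm _ _ _ _

variable (X) in
/-- The homomorphism `D ↦ O(D)` from Cartier divisors to the Picard group. -/
def divToPic : CartierDiv X →* Pic X := MonoidHom.mk' CartierDiv.cls CartierDiv.cls_mul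

lemma divToPic_map (f : X ⟶ Y) [IsDominant f] (D : CartierDiv Y) :
    divToPic X (CartierDiv.map f D) = Pic.map f (divToPic Y D) := by
  obtain ⟨d, hd⟩ := LocalEquations.exists_defines D
  let p : LocalEquations X :=
    { U := fun x => f ⁻¹ᵁ d.U (f x)
      mem := fun x => d.mem (f x)
      f := fun x => ratMap f (d.f (f x))
      unit := fun x y z hz => by
        rw [← map_div]
        exact ratMap_mem_localUnits f z (d.unit (f x) (f y) (f z) hz) }
  have hp : p.Defines (CartierDiv.map f D) := fun x y hy =>
    CartierDiv.map_apply f D y _ (hd (f x) (f y) hy)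
  change CartierDiv.cls _ = Pic.map f (CartierDiv.cls _)
  rw [CartierDiv.cls_eq hd, CartierDiv.cls_eq hp, Pic.map_mk, Pic.mk_eq_mk]
  have h1 : ∀ x, f ⁻¹ᵁ d.U (f x) ≤ (d.toLineCocycle.pullback f).U x := fun _ => le_rfl
  refine LineCocycle.iso_of_eq p.U p.mem (fun _ => le_rfl) h1 fun x y => ?_
  have hxy : genericPoint X ∈ p.U x ⊓ p.U y :=
    ⟨genericPoint_mem (p.mem x), genericPoint_mem (p.mem y)⟩
  apply germUnit_injective hxy
  have hη : genericPoint Y ∈ d.U (f x) ⊓ d.U (f y) :=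
    ⟨genericPoint_mem (d.mem (f x)), genericPoint_mem (d.mem (f y))⟩
  refine Eq.trans ?_ (congrArg (germUnit hxy) (LineCocycle.res_pullback f d.toLineCocycle
    x y (inf_le_inf (h1 x) (h1 y)) le_rfl)).symm
  rw [germUnit_resUnit]
  refine (p.germUnit_sec x y hxy).trans ?_
  refine Eq.trans ?_ (ratMap_germUnit f hη hxy le_rfl (d.sec (f x) (f y)))
  rw [d.germUnit_sec, map_div]

/-- A divisor `D` with trivial `O(D)` is principal. -/
lemma ker_divToPic_le : (divToPic X).ker ≤ (principalDiv X).range := by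
  intro D hD
  obtain ⟨d, hd⟩ := LocalEquations.exists_defines D
  have h0 : Pic.mk d.toLineCocycle = Pic.mk (LineCocycle.one X) :=
    (CartierDiv.cls_eq hd).symm.trans hD
  obtain ⟨W, hW, hc, hd', a, h⟩ := Pic.mk_eq_mk.1 h0
  have hη : ∀ x, genericPoint X ∈ W x := fun x => genericPoint_mem (hW x)
  have key : ∀ x y, d.f x / d.f y * germUnit (hη y) (a y) = germUnit (hη x) (a x) := by
    intro x y
    have hxy : genericPoint X ∈ W x ⊓ W y := ⟨hη x, hη y⟩
    have := congrArg (germUnit hxy) (h x y)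
    rw [LineCocycle.res_one, mul_one, map_mul, germUnit_resUnit, germUnit_resUnit,
      germUnit_resUnit] at this
    rw [← this]
    exact congrArg (· * _) (d.germUnit_sec x y ⟨hc x (hη x), hc y (hη y)⟩).symm
  let x₀ : X := genericPoint X
  refine ⟨d.f x₀ / germUnit (hη x₀) (a x₀), ?_⟩
  ext x
  have h1 : d.f x₀ / germUnit (hη x₀) (a x₀) = d.f x / germUnit (hη x) (a x) := by
    rw [← key x x₀, div_mul_eq_mul_div, div_div_eq_mul_div, div_eq_div_iff_mul_eq_mul]
    rw [mul_comm (d.f x), mul_assoc, mul_comm (germUnit _ _) (d.f x), ← mul_assoc, ← mul_assoc,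
      mul_comm (d.f x₀) (d.f x)]
  change QuotientGroup.mk (d.f x₀ / germUnit (hη x₀) (a x₀)) = D.1 x
  rw [hd x x (d.mem x), h1, mk_eq_mk_iff_div_mem, div_right_comm, div_self', one_div]
  exact inv_mem (germUnit_mem_localUnits (hW x) (a x))

lemma divToPic_principalDiv (f : X.functionFieldˣ) : divToPic X (principalDiv X f) = 1 := by
  let p : LocalEquations X :=
    { U := fun _ => ⊤
      mem := fun _ => trivial
      f := fun _ => f
      unit := fun x y z _ => by rw [div_self']; exact one_mem _ }
  have hp : p.Defines (principalDiv X f) := fun _ _ _ => rfl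
  change CartierDiv.cls _ = _
  rw [CartierDiv.cls_eq hp, ← Pic.mk_one, Pic.mk_eq_mk]
  refine LineCocycle.iso_of_eq p.U p.mem (fun _ => le_rfl) (fun _ => le_rfl) fun x y => ?_
  have hxy : genericPoint X ∈ p.U x ⊓ p.U y := ⟨trivial, trivial⟩
  apply germUnit_injective hxy
  rw [LineCocycle.res_one, germUnit_resUnit, map_one]
  exact (p.germUnit_sec x y hxy).trans (div_self' _)

/-- On an integral scheme every line bundle is of the form `O(D)`. -/
lemma divToPic_surjective : Function.Surjective (divToPic X) := by
  intro c
  obtain ⟨c, rfl⟩ := Pic.mk_surjective c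
  have hη : ∀ x y, genericPoint X ∈ c.U x ⊓ c.U y := fun x y =>
    ⟨genericPoint_mem (c.mem x), genericPoint_mem (c.mem y)⟩
  have hcoc : ∀ x y z, germUnit (hη x y) (c.g x y) * germUnit (hη y z) (c.g y z) =
      germUnit (hη x z) (c.g x z) := by
    intro x y z
    have h3 : genericPoint X ∈ c.U x ⊓ c.U y ⊓ c.U z := ⟨hη x y, (hη y z).2⟩
    have := congrArg (germUnit h3) (c.cocycle x y z)
    rwa [map_mul, germUnit_resUnit, germUnit_resUnit, germUnit_resUnit] at this
  let x₀ : X := genericPoint X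
  have hdiv : ∀ x y, germUnit (hη x x₀) (c.g x x₀) / germUnit (hη y x₀) (c.g y x₀) =
      germUnit (hη x y) (c.g x y) := fun x y => by
    rw [div_eq_iff_eq_mul, hcoc]
  let p : LocalEquations X :=
    { U := c.U
      mem := c.mem
      f := fun x => germUnit (hη x x₀) (c.g x x₀)
      unit := fun x y z hz => by
        rw [hdiv]
        exact germUnit_mem_localUnits hz _ }
  let D : CartierDiv X := ⟨fun x => QuotientGroup.mk (p.f x), fun x =>
    ⟨c.U x, c.mem x, p.f x, fun y hy => by
      rw [mk_eq_mk_iff_div_mem]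
      exact p.unit y x y ⟨c.mem y, hy⟩⟩⟩
  have hp : p.Defines D := fun x y hy => by
    change QuotientGroup.mk (p.f y) = _
    rw [mk_eq_mk_iff_div_mem]
    exact p.unit y x y ⟨c.mem y, hy⟩
  refine ⟨D, ?_⟩
  change CartierDiv.cls _ = _
  rw [CartierDiv.cls_eq hp, Pic.mk_eq_mk]
  refine LineCocycle.iso_of_eq c.U c.mem (fun _ => le_rfl) (fun _ => le_rfl) fun x y => ?_
  apply germUnit_injective (hη x y)
  rw [germUnit_resUnit, germUnit_resUnit]
  exact (p.germUnit_sec x y (hη x y)).trans (hdiv x y)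

/-- A rational function with trivial divisor is a global invertible function. -/
lemma ker_principalDiv_le :
    (principalDiv X).ker ≤ (germUnit (X := X) (U := ⊤) trivial).range := by
  intro f hf
  obtain ⟨s, hs⟩ := exists_unit_section (X := X) (U := ⊤) trivial f fun x _ => by
    have h1 : (principalDiv X f).1 x = 1 := by rw [show principalDiv X f = 1 from hf]; rfl
    exact (QuotientGroup.eq_one_iff f).1 h1
  exact ⟨s, hs⟩

lemma principalDiv_germUnit (s : Γ(X, ⊤)ˣ) :
    principalDiv X (germUnit (X := X) (U := ⊤) trivial s) = 1 := by
  ext x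
  exact (QuotientGroup.eq_one_iff _).2
    (germUnit_mem_localUnits (U := ⊤) (x := x) trivial s)

end Integral

/-! ### Base change to the separable closure and the Galois action -/

section Galois

variable {k : Type u} [Field k] (K : Type u) [Field K] [Algebra k K]
variable {X Y : Scheme.{u}} (f : X ⟶ Spec (.of k)) (g : Y ⟶ Spec (.of k))

/-- The base change of a `k`-scheme `f : X ⟶ Spec k` to the extension field `K`. -/
def geom : Scheme.{u} := pullback f (Spec.map (CommRingCat.ofHom (algebraMap k K)))

/-- The projection to the original scheme. -/
def geomToBase : geom K f ⟶ X := pullback.fst _ _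

/-- The structure morphism of the base change. -/
def geomStr : geom K f ⟶ Spec (.of K) := pullback.snd _ _

lemma geom_isPullback : IsPullback (geomToBase K f) (geomStr K f) f
    (Spec.map (CommRingCat.ofHom (algebraMap k K))) := IsPullback.of_hasPullback _ _

instance geom_isIntegral [GeometricallyIntegral f] : IsIntegral (geom K f) :=
  GeometricallyIntegral.geometrically_isIntegral _ _ _ (geom_isPullback K f)

/-- The morphism `Spec σ` for an automorphism `σ`. -/
def specGal (σ : Gal(K/k)) : Spec (.of K) ⟶ Spec (.of K) :=
  Spec.map (CommRingCat.ofHom (σ : K →+* K))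

/-- The automorphism of the base change of `X` to `K` induced by `σ`; it acts on functions by
`a ⊗ c ↦ a ⊗ σ c`. -/
def galAct (σ : Gal(K/k)) : geom K f ⟶ geom K f :=
  (geom_isPullback K f).lift (geomToBase K f) (geomStr K f ≫ specGal K σ) (by
    rw [Category.assoc, specGal, ← Spec.map_comp, ← CommRingCat.ofHom_comp, (geom_isPullback K f).w]
    congr 3
    ext c
    exact (σ.commutes c).symm)

@[simp]
lemma galAct_toBase (σ : Gal(K/k)) : galAct K f σ ≫ geomToBase K f = geomToBase K f :=
  (geom_isPullback K f).lift_fst _ _ _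

@[simp]
lemma galAct_str (σ : Gal(K/k)) : galAct K f σ ≫ geomStr K f = geomStr K f ≫ specGal K σ :=
  (geom_isPullback K f).lift_snd _ _ _

lemma specGal_mul (σ τ : Gal(K/k)) : specGal K (σ * τ) = specGal K σ ≫ specGal K τ := by
  rw [specGal, specGal, specGal, ← Spec.map_comp, ← CommRingCat.ofHom_comp]
  rfl

lemma galAct_one : galAct K f 1 = 𝟙 _ := by
  apply (geom_isPullback K f).hom_ext
  · simp
  · rw [galAct_str, Category.id_comp, specGal]
    change geomStr K f ≫ Spec.map (𝟙 (CommRingCat.of K)) = _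
    rw [Spec.map_id, Category.comp_id]

lemma galAct_mul (σ τ : Gal(K/k)) : galAct K f (σ * τ) = galAct K f σ ≫ galAct K f τ := by
  apply (geom_isPullback K f).hom_ext
  · simp
  · rw [galAct_str, Category.assoc, galAct_str, ← Category.assoc, galAct_str, Category.assoc,
      specGal_mul]

instance galAct_isIso (σ : Gal(K/k)) : IsIso (galAct K f σ) :=
  ⟨galAct K f σ⁻¹, by rw [← galAct_mul, mul_inv_cancel, galAct_one],
    by rw [← galAct_mul, inv_mul_cancel, galAct_one]⟩

instance galAct_isDominant (σ : Gal(K/k)) : IsDominant (galAct K f σ) := inferInstance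

/-- The constant functions on the base change. -/
def const : K →+* Γ(geom K f, ⊤) :=
  ((Scheme.ΓSpecIso (.of K)).inv ≫ (geomStr K f).appTop).hom

/-- The invertible constant functions. -/
def constUnits : Kˣ →* Γ(geom K f, ⊤)ˣ := Units.map (const K f).toMonoidHom

/-- The condition `K[X]^× = K^×` : all invertible functions on the base change are constant. -/
def OnlyConstantUnits : Prop := Function.Surjective (constUnits K f)

lemma galAct_const (σ : Gal(K/k)) (c : K) :
    (galAct K f σ).appTop (const K f c) = const K f (σ c) := by
  change ((Scheme.ΓSpecIso (.of K)).inv ≫ (geomStr K f).appTop ≫ (galAct K f σ).appTop) c = _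
  rw [← Scheme.Hom.comp_appTop, galAct_str, Scheme.Hom.comp_appTop, specGal,
    ← Category.assoc, ← Scheme.ΓSpecIso_inv_naturality]
  rfl

lemma galAct_preimage_le (σ : Gal(K/k)) (U : X.Opens) :
    geomToBase K f ⁻¹ᵁ U ≤ galAct K f σ ⁻¹ᵁ geomToBase K f ⁻¹ᵁ U := by
  rw [← Scheme.Hom.comp_preimage, galAct_toBase]

variable [GeometricallyIntegral f] [GeometricallyIntegral g]

/-- The constants in the function field. -/
def constRat : Kˣ →* (geom K f).functionFieldˣ :=
  (germUnit (X := geom K f) (U := ⊤) trivial).comp (constUnits K f)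

lemma constRat_injective : Function.Injective (constRat K f) := by
  refine (germUnit_injective _).comp (Units.map_injective ?_)
  have : Nontrivial Γ(geom K f, ⊤) := inferInstance
  exact (const K f).injective

lemma functionFieldMap_const (σ : Gal(K/k)) (c : K) :
    functionFieldMap (galAct K f σ)
      ((geom K f).presheaf.germ ⊤ (genericPoint (geom K f)) trivial (const K f c)) =
      (geom K f).presheaf.germ ⊤ (genericPoint (geom K f)) trivial (const K f (σ c)) := by
  rw [functionFieldMap_germ (galAct K f σ) (U := ⊤) trivial (V := ⊤) trivial le_top, ← galAct_const]
  congr 1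
  simp [Scheme.Hom.appLE]
  rfl

lemma ratMap_constRat (σ : Gal(K/k)) (c : Kˣ) :
    ratMap (galAct K f σ) (constRat K f c) = constRat K f (Units.map (σ : K →* K) c) := by
  ext
  exact functionFieldMap_const K f σ c

/-- Rational functions fixed by a neighbourhood of `1` in the Galois group. -/
def discreteSubring : Subring (geom K f).functionField where
  carrier := {φ | ∃ U : Set Gal(K/k), IsOpen U ∧ 1 ∈ U ∧
    ∀ σ ∈ U, functionFieldMap (galAct K f σ) φ = φ}
  one_mem' := ⟨Set.univ, isOpen_univ, trivial, fun _ _ => map_one _⟩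
  zero_mem' := ⟨Set.univ, isOpen_univ, trivial, fun _ _ => map_zero _⟩
  mul_mem' := by
    rintro a b ⟨U, hU, h1, hf⟩ ⟨V, hV, h1', hg⟩
    exact ⟨U ∩ V, hU.inter hV, ⟨h1, h1'⟩, fun σ hσ => by rw [map_mul, hf σ hσ.1, hg σ hσ.2]⟩
  add_mem' := by
    rintro a b ⟨U, hU, h1, hf⟩ ⟨V, hV, h1', hg⟩
    exact ⟨U ∩ V, hU.inter hV, ⟨h1, h1'⟩, fun σ hσ => by rw [map_add, hf σ hσ.1, hg σ hσ.2]⟩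
  neg_mem' := by
    rintro a ⟨U, hU, h1, hf⟩
    exact ⟨U, hU, h1, fun σ hσ => by rw [map_neg, hf σ hσ]⟩

end Galois

section Discreteness

variable {k : Type u} [Field k] (K : Type u) [Field K] [Algebra k K]
variable {X Y : Scheme.{u}} (f : X ⟶ Spec (.of k))

/-- Functions on the preimage of an affine open set are generated by functions on the open set
and by constants. -/
lemma geom_section_mem {U : X.Opens} (hU : IsAffineOpen U) {V : (geom K f).Opens}
    (hV : V = geomToBase K f ⁻¹ᵁ U ⊓ geomStr K f ⁻¹ᵁ ⊤) (S : Subring Γ(geom K f, V))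
    (h1 : ∀ a, (geomToBase K f).appLE U V (hV.trans_le inf_le_left) a ∈ S)
    (h2 : ∀ c, (geomStr K f).appLE ⊤ V (hV.trans_le inf_le_right) c ∈ S) (s : Γ(geom K f, V)) :
    s ∈ S := by
  have hp := (isIso_pushoutSection_iff (geom_isPullback K f) (US := ⊤) (UT := ⊤) (UX := U)
    (UY := V) le_top le_top hV).1 (isIso_pushoutSection_of_isAffineOpen _ _ _ _
      (isAffineOpen_top _) (isAffineOpen_top _) hU)
  let i : CommRingCat.of S ⟶ Γ(geom K f, V) := CommRingCat.ofHom S.subtype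
  let a : Γ(X, U) ⟶ CommRingCat.of S := CommRingCat.ofHom
    (((geomToBase K f).appLE U V (hV.trans_le inf_le_left)).hom.codRestrict S h1)
  let b : Γ(Spec (.of K), ⊤) ⟶ CommRingCat.of S := CommRingCat.ofHom (R := Γ(Spec (.of K), ⊤))
    (((geomStr K f).appLE ⊤ V (hV.trans_le inf_le_right)).hom.codRestrict S h2)
  have hi : Mono i := ConcreteCategory.mono_of_injective _ Subtype.val_injective
  have ha : a ≫ i = (geomToBase K f).appLE U V (hV.trans_le inf_le_left) := rfl
  have hb : b ≫ i = (geomStr K f).appLE ⊤ V (hV.trans_le inf_le_right) := rfl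
  let d := hp.desc a b (by rw [← cancel_mono i, Category.assoc, Category.assoc, ha, hb, hp.w])
  have hd : d ≫ i = 𝟙 _ := hp.hom_ext
    (by rw [← Category.assoc, hp.inl_desc, ha, Category.comp_id])
    (by rw [← Category.assoc, hp.inr_desc, hb, Category.comp_id])
  have : i (d s) = s := congr($(hd) s)
  rw [← this]
  exact (d s).2

instance geomToBase_isAffineHom : IsAffineHom (geomToBase K f) := MorphismProperty.of_isPullback (geom_isPullback K f).flip inferInstance

variable [Algebra.IsIntegral k K]

lemma exists_open_fixing_const (c : K) : ∃ U : Set Gal(K/k), IsOpen U ∧ 1 ∈ U ∧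
    ∀ σ ∈ U, σ c = c :=
  ⟨_, stabilizer_isOpen_of_isIntegral c, one_mem (MulAction.stabilizer Gal(K/k) c), fun _ h => h⟩

variable [GeometricallyIntegral f]

lemma germ_mem_discreteSubring {U : X.Opens} (hU : IsAffineOpen U)
    (hη : genericPoint (geom K f) ∈ geomToBase K f ⁻¹ᵁ U) (s : Γ(geom K f, geomToBase K f ⁻¹ᵁ U)) :
    (geom K f).presheaf.germ _ _ hη s ∈ discreteSubring K f := by
  have hV : geomToBase K f ⁻¹ᵁ U = geomToBase K f ⁻¹ᵁ U ⊓ geomStr K f ⁻¹ᵁ ⊤ := (inf_top_eq _).symm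
  refine geom_section_mem K f hU hV ((discreteSubring K f).comap
    ((geom K f).presheaf.germ _ _ hη).hom) (fun a => ?_) (fun c => ?_) s
  · refine ⟨Set.univ, isOpen_univ, trivial, fun σ _ => ?_⟩
    change functionFieldMap (galAct K f σ) ((geom K f).presheaf.germ _ _ hη _) =
      (geom K f).presheaf.germ _ _ hη _
    rw [functionFieldMap_germ (galAct K f σ) hη hη (galAct_preimage_le K f σ U)]
    congr 1
    change ((geomToBase K f).appLE U _ _ ≫ (galAct K f σ).appLE _ _ _) a = _
    rw [Scheme.Hom.appLE_comp_appLE]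
    simp only [galAct_toBase]
  · obtain ⟨c, rfl⟩ : ∃ c' : K, (Scheme.ΓSpecIso (.of K)).inv c' = c :=
      ⟨(Scheme.ΓSpecIso (.of K)).hom c, congr($((Scheme.ΓSpecIso (.of K)).hom_inv_id) c)⟩
    obtain ⟨W, hW, h1, hf⟩ := exists_open_fixing_const K c (k := k)
    refine ⟨W, hW, h1, fun σ hσ => ?_⟩
    have key : (geom K f).presheaf.germ _ _ hη ((geomStr K f).appLE ⊤ _ (hV.trans_le inf_le_right)
        ((Scheme.ΓSpecIso (.of K)).inv c)) =
        (geom K f).presheaf.germ ⊤ (genericPoint (geom K f)) trivial (const K f c) := by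
      rw [← (geom K f).presheaf.germ_res_apply (homOfLE le_top) _ hη]
      rfl
    change functionFieldMap (galAct K f σ) ((geom K f).presheaf.germ _ _ hη _) =
      (geom K f).presheaf.germ _ _ hη _
    rw [key, functionFieldMap_const, hf σ hσ]

/-- The Galois action on the function field is discrete. -/
lemma exists_open_fixing_rat (φ : (geom K f).functionField) : ∃ U : Set Gal(K/k), IsOpen U ∧ 1 ∈ U ∧
    ∀ σ ∈ U, functionFieldMap (galAct K f σ) φ = φ := by
  obtain ⟨_, ⟨U, hU, rfl⟩, hx, -⟩ := X.isBasis_affineOpens.exists_subset_of_mem_open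
    (Set.mem_univ (geomToBase K f (genericPoint (geom K f)))) isOpen_univ
  have hη : genericPoint (geom K f) ∈ geomToBase K f ⁻¹ᵁ U := hx
  have hV : IsAffineOpen (geomToBase K f ⁻¹ᵁ U) := IsAffineOpen.preimage hU _
  have : Nonempty (geomToBase K f ⁻¹ᵁ U : (geom K f).Opens) := ⟨⟨_, hη⟩⟩
  have := functionField_isFractionRing_of_isAffineOpen (geom K f) _ hV
  obtain ⟨a, b, hb, rfl⟩ := IsFractionRing.div_surjective (A := Γ(geom K f, geomToBase K f ⁻¹ᵁ U)) φ
  obtain ⟨W, hW, h1, hW'⟩ := germ_mem_discreteSubring K f hU hη a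
  obtain ⟨W', hW2, h2, hW2'⟩ := germ_mem_discreteSubring K f hU hη b
  refine ⟨W ∩ W', hW.inter hW2, ⟨h1, h2⟩, fun σ hσ => ?_⟩
  rw [map_div₀]
  exact congrArg₂ (· / ·) (hW' σ hσ.1) (hW2' σ hσ.2)

lemma exists_open_fixing_ratUnit (φ : (geom K f).functionFieldˣ) :
    ∃ U : Set Gal(K/k), IsOpen U ∧ 1 ∈ U ∧ ∀ σ ∈ U, ratMap (galAct K f σ) φ = φ := by
  obtain ⟨U, hU, h1, h⟩ := exists_open_fixing_rat K f φ.1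
  exact ⟨U, hU, h1, fun σ hσ => Units.ext (h σ hσ)⟩

/-- Small Galois automorphisms fix the germs of a divisor near a point. -/
lemma exists_open_fixing_div_near (D : CartierDiv (geom K f)) (x : geom K f) :
    ∃ V : (geom K f).Opens, x ∈ V ∧ ∃ U : Set Gal(K/k), IsOpen U ∧ 1 ∈ U ∧
      ∀ σ ∈ U, ∀ y ∈ V, (CartierDiv.map (galAct K f σ) D).1 y = D.1 y := by
  obtain ⟨_, ⟨U, hU, rfl⟩, hx, -⟩ := X.isBasis_affineOpens.exists_subset_of_mem_open
    (Set.mem_univ (geomToBase K f x)) isOpen_univ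
  have hA : IsAffineOpen (geomToBase K f ⁻¹ᵁ U) := IsAffineOpen.preimage hU _
  have hxA : x ∈ geomToBase K f ⁻¹ᵁ U := hx
  have hη := genericPoint_mem hxA
  obtain ⟨W, hxW, φ, hφ⟩ := D.2 x
  obtain ⟨b, hb, hxb⟩ := hA.exists_basicOpen_le ⟨x, hxW⟩ hxA
  obtain ⟨S, hS, h1, hS'⟩ := germ_mem_discreteSubring K f hU hη b
  obtain ⟨T, hT, h2, hT'⟩ := exists_open_fixing_ratUnit K f φ
  refine ⟨(geom K f).basicOpen b, hxb, S ∩ T, hS.inter hT, ⟨h1, h2⟩, fun σ hσ y hy => ?_⟩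
  have hb' : (galAct K f σ).appLE _ _ (galAct_preimage_le K f σ U) b = b := by
    apply germ_injective_of_isIntegral (X := geom K f) _ hη
    exact (functionFieldMap_germ (galAct K f σ) hη hη (galAct_preimage_le K f σ U) b).symm.trans
      (hS' σ hσ.1)
  have hy' : galAct K f σ y ∈ (geom K f).basicOpen b := by
    rw [← hb', Scheme.Hom.appLE, CommRingCat.comp_apply, Scheme.basicOpen_res] at hy
    have := hy.2
    rw [← Scheme.preimage_basicOpen] at this
    exact this
  rw [CartierDiv.map_apply _ D y φ (hφ _ (hb hy')), hφ y (hb hy), hT' σ hσ.2]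

/-- The Galois action on divisors is discrete. -/
lemma exists_open_fixing_div [QuasiCompact f] (D : CartierDiv (geom K f)) :
    ∃ U : Set Gal(K/k), IsOpen U ∧ 1 ∈ U ∧ ∀ σ ∈ U, CartierDiv.map (galAct K f σ) D = D := by
  have : QuasiCompact (geomStr K f) := MorphismProperty.of_isPullback (geom_isPullback K f)
    inferInstance
  have : CompactSpace (geom K f) := QuasiCompact.compactSpace_of_compactSpace (geomStr K f)
  choose V hV U hU h1 h using exists_open_fixing_div_near K f D
  obtain ⟨t, -, ht⟩ := (isCompact_univ (X := geom K f)).elim_nhds_subcover (fun x => (V x : Set _))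
    (fun x _ => (V x).isOpen.mem_nhds (hV x))
  refine ⟨⋂ x ∈ t, U x, isOpen_biInter_finset fun x _ => hU x,
    Set.mem_iInter₂.2 fun x _ => h1 x, fun σ hσ => ?_⟩
  ext y
  obtain ⟨x, hx, hy⟩ := Set.mem_iUnion₂.1 (ht (Set.mem_univ y))
  exact h x σ (Set.mem_iInter₂.1 hσ x hx) y hy

end Discreteness

/-! ### The Galois modules and the obstruction classes -/

instance CartierDiv.commGroup (X : Scheme.{u}) [IsIntegral X] : CommGroup (CartierDiv X) :=
  { (CartierDiv X).toGroup with
    mul_comm := fun D E => Subtype.ext (funext fun x => mul_comm (D.1 x) (E.1 x)) }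

section Modules

variable (k : Type u) [Field k] (K : Type u) [Field K] [Algebra k K]
variable {X Y : Scheme.{u}}

/-- The Galois action on `K^×`. -/
def constAction : Gal(K/k) →* Monoid.End Kˣ where
  toFun σ := Units.map (σ : K →* K)
  map_one' := rfl
  map_mul' _ _ := rfl

variable {k}
variable (f : X ⟶ Spec (.of k))

/-- The Galois action on the Picard group of the base change. -/
def picAction : Gal(K/k) →* Monoid.End (Pic (geom K f)) where
  toFun σ := Pic.map (galAct K f σ)
  map_one' := MonoidHom.ext fun c => Pic.map_eq_id _ (galAct_one K f) c
  map_mul' σ τ := MonoidHom.ext fun c => Pic.map_eq_comp _ _ _ (galAct_mul K f σ τ) c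

variable [GeometricallyIntegral f]

/-- The Galois action on the multiplicative group of the function field of the base change. -/
def ratAction : Gal(K/k) →* Monoid.End (geom K f).functionFieldˣ where
  toFun σ := ratMap (galAct K f σ)
  map_one' := MonoidHom.ext fun c => ratMap_eq_id _ (galAct_one K f) c
  map_mul' σ τ := MonoidHom.ext fun c => ratMap_eq_comp _ _ _ (galAct_mul K f σ τ) c

/-- The group `K(X)^× / K^×`. -/
abbrev RatQuot : Type u := (geom K f).functionFieldˣ ⧸ (constRat K f).range

lemma constRat_range_le (σ : Gal(K/k)) :
    (constRat K f).range ≤ (constRat K f).range.comap (ratMap (galAct K f σ)) := by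
  rintro _ ⟨c, rfl⟩
  exact ⟨_, (ratMap_constRat K f σ c).symm⟩

/-- The Galois action on `K(X)^× / K^×`. -/
def ratQuotAction : Gal(K/k) →* Monoid.End (RatQuot K f) where
  toFun σ := QuotientGroup.map _ _ (ratMap (galAct K f σ)) (constRat_range_le K f σ)
  map_one' := QuotientGroup.monoidHom_ext _ <| MonoidHom.ext fun c =>
    congrArg QuotientGroup.mk (ratMap_eq_id _ (galAct_one K f) c)
  map_mul' σ τ := QuotientGroup.monoidHom_ext _ <| MonoidHom.ext fun c =>
    congrArg QuotientGroup.mk (ratMap_eq_comp _ _ _ (galAct_mul K f σ τ) c)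

/-- The Galois action on the divisors of the base change. -/
def divAction : Gal(K/k) →* Monoid.End (CartierDiv (geom K f)) where
  toFun σ := CartierDiv.map (galAct K f σ)
  map_one' := MonoidHom.ext fun c => CartierDiv.map_eq_id _ (galAct_one K f) c
  map_mul' σ τ := MonoidHom.ext fun c => CartierDiv.map_eq_comp _ _ _ (galAct_mul K f σ τ) c

/-- A surjective equivariant map carries discreteness to its target. -/
lemma isOpen_stabilizer_of_surjective {M N : Type*} [CommGroup M] [CommGroup N]
    (ρ : Gal(K/k) →* Monoid.End M) (τ : Gal(K/k) →* Monoid.End N) (φ : M →* N)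
    (hφ : ∀ σ m, φ (ρ σ m) = τ σ (φ m)) (hs : Function.Surjective φ)
    (h : ∀ m, ∃ U : Set Gal(K/k), IsOpen U ∧ 1 ∈ U ∧ ∀ σ ∈ U, ρ σ m = m) (n : N) :
    IsOpen {σ | τ σ n = n} := by
  obtain ⟨m, rfl⟩ := hs n
  obtain ⟨U, hU, h1, hf⟩ := h m
  exact isOpen_stabilizer_of_le τ _ U hU h1 fun σ hσ => by rw [← hφ, hf σ hσ]

lemma ratQuot_w : (QuotientGroup.mk' (constRat K f).range).comp (constRat K f) = 1 :=
  MonoidHom.ext fun c => (QuotientGroup.eq_one_iff _).2 ⟨c, rfl⟩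

variable [Algebra.IsIntegral k K]

variable (k) in
/-- `K^×` as a discrete Galois module. -/
def constMod : DiscMod Gal(K/k) := DiscMod.of Kˣ (constAction k K) fun c => by
  obtain ⟨U, hU, h1, h⟩ := exists_open_fixing_const K (k := k) c.1
  exact isOpen_stabilizer_of_le _ _ U hU h1 fun σ hσ => Units.ext (h σ hσ)

/-- `K(X)^×` as a discrete Galois module. -/
def ratMod : DiscMod Gal(K/k) :=
  DiscMod.of (geom K f).functionFieldˣ (ratAction K f) fun φ => by
    obtain ⟨U, hU, h1, h⟩ := exists_open_fixing_ratUnit K f φ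
    exact isOpen_stabilizer_of_le _ _ U hU h1 h

/-- `K(X)^× / K^×` as a discrete Galois module. -/
def ratQuotMod : DiscMod Gal(K/k) :=
  DiscMod.of (RatQuot K f) (ratQuotAction K f) <|
    isOpen_stabilizer_of_surjective K (ratAction K f) _ (QuotientGroup.mk' _) (fun _ _ => rfl)
      (QuotientGroup.mk'_surjective _) (exists_open_fixing_ratUnit K f)

section
variable [QuasiCompact f]

/-- The group of divisors of the base change as a discrete Galois module. -/
def divMod : DiscMod Gal(K/k) :=
  DiscMod.of (CartierDiv (geom K f)) (divAction K f) fun D => by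
    obtain ⟨U, hU, h1, h⟩ := exists_open_fixing_div K f D
    exact isOpen_stabilizer_of_le _ _ U hU h1 h

/-- The Picard group of the base change as a discrete Galois module. -/
def picMod : DiscMod Gal(K/k) :=
  DiscMod.of (Pic (geom K f)) (picAction K f) <|
    isOpen_stabilizer_of_surjective K (divAction K f) _ (divToPic _)
      (fun σ D => divToPic_map (galAct K f σ) D) divToPic_surjective (exists_open_fixing_div K f)

end

end Modules

section Obstruction

variable {k : Type u} [Field k] (K : Type u) [Field K] [Algebra k K]
variable {X : Scheme.{u}} (f : X ⟶ Spec (.of k)) [GeometricallyIntegral f]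

/-- The divisor of a rational function modulo constants. -/
def ratQuotDiv : RatQuot K f →* CartierDiv (geom K f) :=
  QuotientGroup.lift _ (principalDiv (geom K f)) (by
    rintro _ ⟨c, rfl⟩
    exact principalDiv_germUnit (constUnits K f c))

lemma ratQuotDiv_equivariant (σ : Gal(K/k)) (φ : RatQuot K f) :
    ratQuotDiv K f (ratQuotAction K f σ φ) = divAction K f σ (ratQuotDiv K f φ) := by
  obtain ⟨φ, rfl⟩ := QuotientGroup.mk_surjective φ
  rfl

lemma ratQuotDiv_injective (h : OnlyConstantUnits K f) : Function.Injective (ratQuotDiv K f) := by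
  rw [injective_iff_map_eq_one]
  intro φ hφ
  obtain ⟨φ, rfl⟩ := QuotientGroup.mk_surjective φ
  obtain ⟨s, rfl⟩ := ker_principalDiv_le (show φ ∈ (principalDiv (geom K f)).ker from hφ)
  obtain ⟨c, rfl⟩ := h s
  exact (QuotientGroup.eq_one_iff _).2 ⟨c, rfl⟩

variable [Algebra.IsIntegral k K]

/-- The sequence `1 ⟶ K^× ⟶ K(X)^× ⟶ K(X)^× / K^× ⟶ 1` of discrete Galois modules. -/
def ratSeq : ShortComplex (DiscMod Gal(K/k)) :=
  ShortComplex.mk (X₁ := constMod k K) (X₂ := ratMod K f) (X₃ := ratQuotMod K f)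
    (DiscMod.ofHom (constRat K f) fun σ c => (ratMap_constRat K f σ c).symm)
    (DiscMod.ofHom (QuotientGroup.mk' _) fun _ _ => rfl)
    (DiscMod.ofHom_comp_eq_zero _ _ _ _ fun c => (QuotientGroup.eq_one_iff _).2 ⟨c, rfl⟩)

lemma ratSeq_shortExact : (ratSeq K f).ShortExact :=
  DiscMod.shortExact _ _ _ _ _ (constRat_injective K f) (QuotientGroup.ker_mk' _).le
    (QuotientGroup.mk'_surjective _)

/-- The elementary obstruction `ob(X)`: the class of the extension
`1 ⟶ K^× ⟶ K(X)^× ⟶ K(X)^× / K^× ⟶ 1`. -/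
def ob : Abelian.Ext.{u + 1} (ratQuotMod K f) (constMod k K) 1 :=
  (ratSeq_shortExact K f).extClass

variable [QuasiCompact f]

/-- The sequence `1 ⟶ K(X)^× / K^× ⟶ Div(X_K) ⟶ Pic(X_K) ⟶ 1` of discrete Galois modules. -/
def divSeq : ShortComplex (DiscMod Gal(K/k)) :=
  ShortComplex.mk (X₁ := ratQuotMod K f) (X₂ := divMod K f) (X₃ := picMod K f)
    (DiscMod.ofHom (ratQuotDiv K f) (ratQuotDiv_equivariant K f))
    (DiscMod.ofHom (divToPic _) fun σ D => divToPic_map (galAct K f σ) D)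
    (DiscMod.ofHom_comp_eq_zero _ _ _ _ fun φ => by
      obtain ⟨φ, rfl⟩ := QuotientGroup.mk_surjective φ
      exact divToPic_principalDiv φ)

/-- The sequence is exact if all invertible functions are constant. -/
lemma divSeq_shortExact (h : OnlyConstantUnits K f) : (divSeq K f).ShortExact :=
  DiscMod.shortExact _ _ _ _ _ (ratQuotDiv_injective K f h) (fun D hD => by
    obtain ⟨φ, rfl⟩ := ker_divToPic_le hD
    exact ⟨QuotientGroup.mk φ, rfl⟩) divToPic_surjective

/-- The connecting homomorphism
`δ : Ext¹(K(X)^× / K^×, K^×) ⟶ Ext²(Pic(X_K), K^×)` of the long exact sequence obtained from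
`1 ⟶ K(X)^× / K^× ⟶ Div(X_K) ⟶ Pic(X_K) ⟶ 1`. -/
def connecting (h : OnlyConstantUnits K f) :
    Abelian.Ext.{u + 1} (ratQuotMod K f) (constMod k K) 1 →+
      Abelian.Ext.{u + 1} (picMod K f) (constMod k K) 2 :=
  (divSeq_shortExact K f h).extClass.precomp (constMod k K) (show 1 + 1 = 2 from rfl)

/-- The class `e(X)` of the extension
`1 ⟶ K^× ⟶ K(X)^× ⟶ Div(X_K) ⟶ Pic(X_K) ⟶ 1`, i.e. the Yoneda product of the classes of
`1 ⟶ K(X)^× / K^× ⟶ Div(X_K) ⟶ Pic(X_K) ⟶ 1` and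
`1 ⟶ K^× ⟶ K(X)^× ⟶ K(X)^× / K^× ⟶ 1`, from which it is spliced. -/
def elemClass (h : OnlyConstantUnits K f) : Abelian.Ext.{u + 1} (picMod K f) (constMod k K) 2 :=
  (divSeq_shortExact K f h).extClass.comp (ratSeq_shortExact K f).extClass
    (show 1 + 1 = 2 from rfl)

end Obstruction

/-! ### Products -/

section Products

variable {k : Type u} [Field k] (K : Type u) [Field K] [Algebra k K]

section Functoriality

variable {X Y : Scheme.{u}} (f : X ⟶ Spec (.of k)) (g : Y ⟶ Spec (.of k)) (p : X ⟶ Y)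
  (hp : p ≫ g = f)

/-- The base change to `K` of a morphism of `k`-schemes. -/
def geomMap : geom K f ⟶ geom K g :=
  (geom_isPullback K g).lift (geomToBase K f ≫ p) (geomStr K f) (by
    rw [Category.assoc, hp, (geom_isPullback K f).w])

@[simp]
lemma geomMap_toBase : geomMap K f g p hp ≫ geomToBase K g = geomToBase K f ≫ p :=
  (geom_isPullback K g).lift_fst _ _ _

@[simp]
lemma geomMap_str : geomMap K f g p hp ≫ geomStr K g = geomStr K f :=
  (geom_isPullback K g).lift_snd _ _ _

lemma galAct_geomMap (σ : Gal(K/k)) :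
    galAct K f σ ≫ geomMap K f g p hp = geomMap K f g p hp ≫ galAct K g σ := by
  apply (geom_isPullback K g).hom_ext
  · rw [Category.assoc, geomMap_toBase, Category.assoc, galAct_toBase, geomMap_toBase,
      ← Category.assoc, galAct_toBase]
  · rw [Category.assoc, geomMap_str, Category.assoc, galAct_str, galAct_str, ← Category.assoc,
      geomMap_str]

lemma geomMap_isPullback : IsPullback (geomToBase K f) (geomMap K f g p hp) p (geomToBase K g) := by
  refine IsPullback.of_bot (?_ : IsPullback (geomToBase K f) (geomMap K f g p hp ≫ geomStr K g)
    (p ≫ g) _) (geomMap_toBase K f g p hp).symm (geom_isPullback K g)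
  rw [geomMap_str, hp]
  exact geom_isPullback K f

lemma geomMap_surjective [Surjective p] : Surjective (geomMap K f g p hp) :=
  MorphismProperty.of_isPullback (geomMap_isPullback K f g p hp) inferInstance

lemma geomMap_const (c : K) :
    (geomMap K f g p hp).appTop (const K g c) = const K f c := by
  change ((Scheme.ΓSpecIso (.of K)).inv ≫ (geomStr K g).appTop ≫ (geomMap K f g p hp).appTop) c = _
  rw [← Scheme.Hom.comp_appTop, geomMap_str]
  rfl

lemma geomMap_isDominant [Surjective p] : IsDominant (geomMap K f g p hp) :=
  have := geomMap_surjective K f g p hp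
  inferInstance

lemma picMap_equivariant (σ : Gal(K/k)) (c : Pic (geom K g)) :
    Pic.map (geomMap K f g p hp) (picAction K g σ c) =
      picAction K f σ (Pic.map (geomMap K f g p hp) c) :=
  (Pic.map_eq_comp _ _ _ (galAct_geomMap K f g p hp σ) c).symm.trans (Pic.map_eq_comp _ _ _ rfl c)

variable [GeometricallyIntegral f] [GeometricallyIntegral g]

lemma ratMap_geomMap_const [IsDominant (geomMap K f g p hp)] (c : Kˣ) :
    ratMap (geomMap K f g p hp) (constRat K g c) = constRat K f c := by
  ext
  change functionFieldMap (geomMap K f g p hp)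
    ((geom K g).presheaf.germ ⊤ (genericPoint (geom K g)) trivial (const K g c)) =
      (geom K f).presheaf.germ ⊤ (genericPoint (geom K f)) trivial (const K f c)
  rw [functionFieldMap_germ (geomMap K f g p hp) (U := ⊤) trivial (V := ⊤) trivial le_top,
    ← geomMap_const K f g p hp]
  congr 1
  simp [Scheme.Hom.appLE]
  rfl

/-- Pullback of rational functions modulo constants. -/
def ratQuotPullHom [IsDominant (geomMap K f g p hp)] : RatQuot K g →* RatQuot K f :=
  QuotientGroup.map _ _ (ratMap (geomMap K f g p hp)) (by
    rintro _ ⟨c, rfl⟩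
    exact ⟨c, (ratMap_geomMap_const K f g p hp c).symm⟩)

lemma ratQuotPullHom_equivariant [IsDominant (geomMap K f g p hp)] (σ : Gal(K/k))
    (φ : RatQuot K g) : ratQuotPullHom K f g p hp (ratQuotAction K g σ φ) =
      ratQuotAction K f σ (ratQuotPullHom K f g p hp φ) := by
  obtain ⟨φ, rfl⟩ := QuotientGroup.mk_surjective φ
  have : IsDominant (galAct K f σ ≫ geomMap K f g p hp) := inferInstance
  refine congrArg QuotientGroup.mk ?_
  exact (ratMap_eq_comp _ _ _ (galAct_geomMap K f g p hp σ) φ).symm.trans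
    (ratMap_eq_comp _ _ _ rfl φ)

variable [Algebra.IsIntegral k K]

/-- Pullback of rational functions modulo constants along a surjective morphism `p : X ⟶ Y`
of `k`-schemes, as a morphism of Galois modules `K(Y)^× / K^× ⟶ K(X)^× / K^×`. -/
def ratQuotPull [Surjective p] : ratQuotMod K g ⟶ ratQuotMod K f :=
  have := geomMap_isDominant K f g p hp
  DiscMod.ofHom (ratQuotPullHom K f g p hp) (ratQuotPullHom_equivariant K f g p hp)

/-- Pullback of line bundles along a morphism `p : X ⟶ Y` of `k`-schemes, as a morphism of Galois
modules `Pic(Y_K) ⟶ Pic(X_K)`. -/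
def picPull [QuasiCompact f] [QuasiCompact g] : picMod K g ⟶ picMod K f :=
  DiscMod.ofHom (Pic.map (geomMap K f g p hp)) (picMap_equivariant K f g p hp)

end Functoriality

section Binary

variable {X Y : Scheme.{u}} (f : X ⟶ Spec (.of k)) (g : Y ⟶ Spec (.of k))

/-- The structure morphism of the product `X ×_k Y`. The base change of the product to `K` is
canonically the product over `K` of the base changes. -/
def prodMor : pullback f g ⟶ Spec (.of k) := pullback.fst f g ≫ f

lemma fst_prodMor : pullback.fst f g ≫ f = prodMor f g := rfl

lemma snd_prodMor : pullback.snd f g ≫ g = prodMor f g := pullback.condition.symm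

instance prodMor_quasiCompact [QuasiCompact f] [QuasiCompact g] : QuasiCompact (prodMor f g) :=
  inferInstanceAs (QuasiCompact (pullback.fst f g ≫ f))

/-- The product of geometrically integral `k`-schemes is geometrically integral. -/
instance prodMor_geometricallyIntegral [GeometricallyIntegral f] [GeometricallyIntegral g]
    [LocallyOfFiniteType f] [LocallyOfFiniteType g] :
    GeometricallyIntegral (prodMor f g) where
  geometrically_isIntegral := by
    intro L _ y Z fst snd h
    have sq : IsPullback (pullback.fst f y) (pullback.snd f y) f y := .of_hasPullback _ _
    let q : Z ⟶ pullback f y := sq.lift (fst ≫ pullback.fst f g) snd (by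
      rw [Category.assoc]; exact h.w)
    have hq1 : q ≫ pullback.fst f y = fst ≫ pullback.fst f g := sq.lift_fst _ _ _
    have hq2 : q ≫ pullback.snd f y = snd := sq.lift_snd _ _ _
    have h1 : IsPullback fst q (pullback.fst f g) (pullback.fst f y) := by
      refine IsPullback.of_bot (?_ : IsPullback fst (q ≫ pullback.snd f y)
        (pullback.fst f g ≫ f) y) hq1.symm sq
      rw [hq2]
      exact h
    have h2 : IsPullback (fst ≫ pullback.snd f g) q g (pullback.fst f y ≫ f) :=
      IsPullback.paste_horiz h1 (IsPullback.of_hasPullback f g).flip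
    have i1 : IsIntegral (pullback f y) :=
      GeometricallyIntegral.geometrically_isIntegral _ _ _ sq
    have i2 : IsLocallyNoetherian (pullback f y) :=
      LocallyOfFiniteType.isLocallyNoetherian (pullback.snd f y)
    have i3 : IsIntegral (pullback g (pullback.fst f y ≫ f)) := inferInstance
    exact .of_isIso h2.isoPullback.inv

section Maps

variable [GeometricallyIntegral f] [GeometricallyIntegral g]
  [LocallyOfFiniteType f] [LocallyOfFiniteType g] [Algebra.IsIntegral k K]

/-- The homomorphism `π : K(X)^× / K^× ⊕ K(Y)^× / K^× ⟶ K(X × Y)^× / K^×`, `(a, b) ↦ a b`. -/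
def piMor : ratQuotMod K f ⊞ ratQuotMod K g ⟶ ratQuotMod K (prodMor f g) :=
  biprod.desc
    (ratQuotPull K (prodMor f g) f (pullback.fst f g) (fst_prodMor f g))
    (ratQuotPull K (prodMor f g) g (pullback.snd f g) (snd_prodMor f g))

/-- The homomorphism on `Ext¹(-, K^×)` induced by `π`, combined with the canonical isomorphism
`Ext¹(A ⊕ B, K^×) ≃ Ext¹(A, K^×) ⊕ Ext¹(B, K^×)`. -/
def piStar : Abelian.Ext.{u + 1} (ratQuotMod K (prodMor f g)) (constMod k K) 1 →+
    Abelian.Ext.{u + 1} (ratQuotMod K f) (constMod k K) 1 ×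
      Abelian.Ext.{u + 1} (ratQuotMod K g) (constMod k K) 1 :=
  Abelian.Ext.biprodAddEquiv.toAddMonoidHom.comp
    ((Abelian.Ext.mk₀ (piMor K f g)).precomp (constMod k K) (zero_add 1))

variable [QuasiCompact f] [QuasiCompact g]

/-- The homomorphism `ψ : Pic(X_K) ⊕ Pic(Y_K) ⟶ Pic((X × Y)_K)` given by pullback of line
bundles along the projections. -/
def psiMor : picMod K f ⊞ picMod K g ⟶ picMod K (prodMor f g) :=
  biprod.desc
    (picPull K (prodMor f g) f (pullback.fst f g) (fst_prodMor f g))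
    (picPull K (prodMor f g) g (pullback.snd f g) (snd_prodMor f g))

/-- The homomorphism on `Ext²(-, K^×)` induced by `ψ`, combined with the canonical isomorphism
`Ext²(A ⊕ B, K^×) ≃ Ext²(A, K^×) ⊕ Ext²(B, K^×)`. -/
def psiStar : Abelian.Ext.{u + 1} (picMod K (prodMor f g)) (constMod k K) 2 →+
    Abelian.Ext.{u + 1} (picMod K f) (constMod k K) 2 ×
      Abelian.Ext.{u + 1} (picMod K g) (constMod k K) 2 :=
  Abelian.Ext.biprodAddEquiv.toAddMonoidHom.comp
    ((Abelian.Ext.mk₀ (psiMor K f g)).precomp (constMod k K) (zero_add 2))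

end Maps
end Binary
end Products

end ElementaryObstruction

end

open ElementaryObstruction

/-!
The identities for `ob` and `e` are naturality of Yoneda classes. The projections of `X × Y` are
surjective, so pullback of functions, divisors and line bundles gives morphisms from the exact
sequences of Galois modules of `X` and of `Y` to those of `X × Y` (`ratSeqPull`, `divSeqPull`), and
the class of an extension is natural for morphisms of short exact sequences. If `π` or `ψ` is an
isomorphism, pullback along it is injective on `Ext`, so the class of the product vanishes exactly
when both components of its image do. As `e = δ(ob)`, injectivity of the connecting homomorphisms
`δ` transfers the criterion between `ob` and `e`. Two facts need an argument.

*Injectivity of `δ`* (`connecting_injective`). By the long exact sequence it suffices that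
`Ext¹(Div, K^×) = 0`. The local rings of a smooth variety over `K` are regular, hence factorial
(`RegularLocal.uniqueFactorizationMonoid`, by way of finite free resolutions and Nagata's
criterion), so `Div` is free on the points of codimension one, which the Galois group permutes
(`exists_basis_div_permuted`). A class in `Ext¹(M, N)` dies under pullback along some epimorphism
`P ⟶ M`, so it vanishes if equivariant maps from the kernel of `P ⟶ M` to `N` always extend to `P`.
For a permutation module `M` this extension problem is solved orbit by orbit, the obstruction being
a continuous `1`-cocycle of a point stabilizer (`exists_equivariant_extension`); for `N = K^×` it is
a coboundary by Hilbert's Theorem 90 (`hilbert90`).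

*Invertible functions on `X × Y` are constant* (`onlyConstantUnits_prodMor`). An invertible function
`u` is constant on each fibre `{x} × Y` and `X × {y}` over rational points `x`, `y`. Comparing the
fibres `{x} × Y` with one fibre `X × {y}` shows that the constant does not depend on `x`, so some
`u - c` vanishes on all fibres `{x} × Y`. Rational points of a smooth variety over a separably
closed field are dense (`RingHom.IsStandardSmooth.exists_ringHom_ne_zero`); expanding `u - c`
on an affine open set in a basis of the functions on `Y`, all coefficients vanish at the rational
points of `X`, so `u = c`.
-/

open IsLocalRing

set_option linter.unusedSectionVars false

/-! ### Regular local rings are domains -/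

namespace RegularLocal

/-- If `m` is generated by `s` and `x ∈ m` is not in `m * m`, then `x` can replace one of the
generators. -/
lemma exists_finset_span_insert {R : Type*} [CommRing R] [IsLocalRing R] (s : Finset R)
    (hs : maximalIdeal R = Ideal.span s) {x : R} (hx : x ∈ maximalIdeal R)
    (hx2 : x ∉ maximalIdeal R * maximalIdeal R) :
    ∃ t : Finset R, t.card + 1 ≤ s.card ∧
      maximalIdeal R = Ideal.span {x} ⊔ Ideal.span (t : Set R) := by
  classical
  have hxs : x ∈ Ideal.span (s : Set R) := hs ▸ hx
  obtain ⟨a, -, ha⟩ := Submodule.mem_span_finset.1 hxs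
  obtain ⟨j, hj, hu⟩ : ∃ j ∈ s, a j ∉ maximalIdeal R := by
    by_contra! h
    refine hx2 (ha ▸ Ideal.sum_mem _ fun j hj => Ideal.mul_mem_mul (h j hj) ?_)
    rw [hs]
    exact Ideal.subset_span hj
  have hu : IsUnit (a j) := by simpa using hu
  refine ⟨s.erase j, (Finset.card_erase_add_one hj).le, le_antisymm ?_ (sup_le ?_ ?_)⟩
  · rw [hs, Ideal.span_le]
    intro i hi
    by_cases hij : i = j
    · subst hij
      rw [← Finset.add_sum_erase _ _ hj] at ha
      have : a i * i ∈ Ideal.span {x} ⊔ Ideal.span ((s.erase i : Finset R) : Set R) := by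
        rw [show a i * i = x - ∑ b ∈ s.erase i, a b • b from eq_sub_of_add_eq ha]
        refine sub_mem (Ideal.mem_sup_left (Ideal.mem_span_singleton_self x)) ?_
        exact Ideal.mem_sup_right (Ideal.sum_mem _ fun b hb =>
          Ideal.mul_mem_left _ _ (Ideal.subset_span hb))
      exact (Ideal.unit_mul_mem_iff_mem _ hu).1 this
    · exact Ideal.mem_sup_right (Ideal.subset_span (Finset.mem_erase.2 ⟨hij, hi⟩))
  · rwa [Ideal.span_singleton_le_iff_mem]
  · rw [hs]
    exact Ideal.span_mono (by simp)

/-- Cutting a regular local ring by an element of `m` outside `m ^ 2` gives a regular local ring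
whose maximal ideal needs one generator less. -/
lemma quotient_span_singleton {R : Type*} [CommRing R] [IsRegularLocalRing R] {x : R}
    (hx : x ∈ maximalIdeal R) (hx2 : x ∉ maximalIdeal R * maximalIdeal R) :
    IsRegularLocalRing (R ⧸ Ideal.span {x}) ∧
      ∀ _ : IsLocalRing (R ⧸ Ideal.span {x}),
      (maximalIdeal (R ⧸ Ideal.span {x})).spanFinrank + 1 ≤ (maximalIdeal R).spanFinrank := by
  classical
  have hlt : Ideal.span {x} ≠ ⊤ := fun h => by
    have : (1 : R) ∈ maximalIdeal R :=
      (Ideal.span_singleton_le_iff_mem _).2 hx (h ▸ Submodule.mem_top)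
    exact (maximalIdeal.isMaximal R).ne_top ((Ideal.eq_top_iff_one _).2 this)
  have : Nontrivial (R ⧸ Ideal.span {x}) := Ideal.Quotient.nontrivial_iff.2 hlt
  have hloc : IsLocalRing (R ⧸ Ideal.span {x}) :=
    IsLocalRing.of_surjective' _ Ideal.Quotient.mk_surjective
  obtain ⟨s, hsc, hs⟩ :=
    Submodule.FG.exists_span_finset_card_eq_spanFinrank (maximalIdeal R).fg_of_isNoetherianRing
  obtain ⟨t, htc, ht⟩ := exists_finset_span_insert s hs.symm hx hx2
  have hmap : maximalIdeal (R ⧸ Ideal.span {x}) =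
      Ideal.span ((t.image (Ideal.Quotient.mk (Ideal.span {x})) : Finset _) : Set _) := by
    rw [← map_maximalIdeal_of_surjective _ (Ideal.Quotient.mk_surjective (I := Ideal.span {x})),
      ht, Ideal.map_sup, Ideal.map_quotient_self, bot_sup_eq, Ideal.map_span, Finset.coe_image]
  have hrank : (maximalIdeal (R ⧸ Ideal.span {x})).spanFinrank + 1 ≤
      (maximalIdeal R).spanFinrank := by
    have h1 : (maximalIdeal (R ⧸ Ideal.span {x})).spanFinrank ≤ t.card := by
      rw [hmap]
      refine (Submodule.spanFinrank_span_le_ncard_of_finite (Finset.finite_toSet _)).trans ?_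
      rw [Set.ncard_coe_finset]
      exact Finset.card_image_le
    omega
  refine ⟨IsRegularLocalRing.of_spanFinrank_maximalIdeal_le _ ?_, fun _ => hrank⟩
  have h2 : ringKrullDim R ≤ ringKrullDim (R ⧸ Ideal.span {x}) + 1 := by
    rw [← maximalIdeal_height_eq_ringKrullDim]
    exact Ideal.height_le_ringKrullDim_quotient_add_one hx
  rw [← (isRegularLocalRing_iff R).1 inferInstance] at h2
  have h3 : (((maximalIdeal (R ⧸ Ideal.span {x})).spanFinrank : WithBot ℕ∞) + 1) ≤
      ringKrullDim (R ⧸ Ideal.span {x}) + 1 := le_trans (by exact_mod_cast hrank) h2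
  exact ENat.WithBot.add_le_add_one_right_iff.1 h3

/-- Nakayama's lemma for the maximal ideal of a Noetherian local ring. -/
lemma maximalIdeal_eq_bot_of_le_sq {R : Type*} [CommRing R] [IsLocalRing R] [IsNoetherianRing R]
    (h : maximalIdeal R ≤ maximalIdeal R * maximalIdeal R) : maximalIdeal R = ⊥ :=
  Submodule.eq_bot_of_le_smul_of_le_jacobson_bot (maximalIdeal R) _
    (IsNoetherian.noetherian _) h (maximalIdeal_le_jacobson _)

/-- A regular local ring is a domain. Choose `x` in the maximal ideal `m`, outside `m ^ 2` and
outside all minimal primes; by induction `(x)` is prime, so it contains a minimal prime `p`, and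
`p = x p` forces `p = 0`. -/
theorem isDomain (R : Type u) [CommRing R] [IsRegularLocalRing R] : IsDomain R := by
  classical
  induction hn : (maximalIdeal R).spanFinrank using Nat.strong_induction_on generalizing R with
  | _ n ih =>
  subst hn
  by_cases h0 : maximalIdeal R = ⊥
  · exact (IsLocalRing.isField_iff_maximalIdeal_eq.2 h0).isDomain
  obtain ⟨x, hx, hx2, hxp⟩ : ∃ x ∈ maximalIdeal R, x ∉ maximalIdeal R * maximalIdeal R ∧
      ∀ p ∈ minimalPrimes R, x ∉ p := by
    by_contra! h
    have hfin := minimalPrimes.finite_of_isNoetherianRing R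
    have hsub : (maximalIdeal R : Set R) ⊆
        ⋃ i ∈ (↑(insert (maximalIdeal R * maximalIdeal R) hfin.toFinset) : Set (Ideal R)),
          (i : Set R) := by
      intro x hx
      by_cases hx2 : x ∈ maximalIdeal R * maximalIdeal R
      · exact Set.mem_biUnion (by simp) hx2
      · obtain ⟨p, hp, hxp⟩ := h x hx hx2
        exact Set.mem_biUnion (x := p) (by simp [hp]) hxp
    obtain ⟨p, hp, hle⟩ := (Ideal.subset_union_prime (f := id)
      (maximalIdeal R * maximalIdeal R) (maximalIdeal R * maximalIdeal R) (by
        intro p hp h1 _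
        have hp : p ∈ minimalPrimes R := by
          rcases Finset.mem_insert.1 hp with h | h
          · exact absurd h h1
          · simpa using h
        exact hp.1.1)).1 hsub
    rcases Finset.mem_insert.1 hp with h | h
    · subst h
      exact h0 (maximalIdeal_eq_bot_of_le_sq hle)
    · have hp : p ∈ minimalPrimes R := by simpa using h
      have hpm : p = maximalIdeal R := le_antisymm (le_maximalIdeal hp.1.1.ne_top) hle
      have hh : (maximalIdeal R).height = 0 := by
        rw [← hpm]
        have := hp.1.1
        exact Ideal.height_eq_zero_iff.2 hp
      have h1 := (isRegularLocalRing_iff R).1 inferInstance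
      rw [← maximalIdeal_height_eq_ringKrullDim, hh] at h1
      have h2 : (maximalIdeal R).spanFinrank = 0 := by exact_mod_cast h1
      exact h0 ((Submodule.spanFinrank_eq_zero_iff_eq_bot
        (maximalIdeal R).fg_of_isNoetherianRing).1 h2)
  obtain ⟨hreg, hrank⟩ := quotient_span_singleton hx hx2
  have hdom : IsDomain (R ⧸ Ideal.span {x}) := ih _ (hrank inferInstance) _ rfl
  have hprime : (Ideal.span {x}).IsPrime := (Ideal.Quotient.isDomain_iff_prime _).1 hdom
  obtain ⟨p, hp, hpx⟩ := Ideal.exists_minimalPrimes_le (I := ⊥) (J := Ideal.span {x}) bot_le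
  have hpp : p.IsPrime := hp.1.1
  have hbot : p = ⊥ := by
    refine Submodule.eq_bot_of_le_smul_of_le_jacobson_bot (maximalIdeal R) _
      (IsNoetherian.noetherian _) ?_ (maximalIdeal_le_jacobson _)
    intro y hy
    obtain ⟨z, rfl⟩ := Ideal.mem_span_singleton'.1 (hpx hy)
    rw [mul_comm]
    exact Ideal.mul_mem_mul hx ((hpp.mem_or_mem hy).resolve_right (hxp p hp))
  rw [hbot] at hpp
  exact IsDomain.of_bot_isPrime R

/-- The maximal ideal of a regular local ring that is not a field contains a prime element with
regular quotient. -/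
lemma exists_prime (R : Type u) [CommRing R] [IsRegularLocalRing R] (h0 : maximalIdeal R ≠ ⊥) :
    ∃ x ∈ maximalIdeal R, Prime x ∧ IsRegularLocalRing (R ⧸ Ideal.span {x}) ∧
      ∀ _ : IsLocalRing (R ⧸ Ideal.span {x}),
      (maximalIdeal (R ⧸ Ideal.span {x})).spanFinrank + 1 ≤ (maximalIdeal R).spanFinrank := by
  obtain ⟨x, hx, hx2⟩ := SetLike.not_le_iff_exists.1 (mt maximalIdeal_eq_bot_of_le_sq h0)
  obtain ⟨hreg, hrank⟩ := quotient_span_singleton hx hx2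
  have hdom := isDomain (R ⧸ Ideal.span {x})
  refine ⟨x, hx, ?_, hreg, hrank⟩
  refine (Ideal.span_singleton_prime ?_).1 ((Ideal.Quotient.isDomain_iff_prime _).1 hdom)
  rintro rfl
  exact hx2 (zero_mem _)

end RegularLocal

/-! ### Finite free resolutions -/

/-- `M` has a resolution of length `n` by finite free `R`-modules. -/
def HasFiniteFreeResolution (R : Type u) [CommRing R] :
    ℕ → ∀ (M : Type u) [AddCommGroup M] [Module R M], Prop
  | 0, M, _, _ => Module.Finite R M ∧ Module.Free R M
  | n + 1, M, _, _ => ∃ (m : ℕ) (φ : (Fin m → R) →ₗ[R] M), Function.Surjective φ ∧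
      HasFiniteFreeResolution R n (LinearMap.ker φ)

namespace HasFiniteFreeResolution

variable {R : Type u} [CommRing R]

lemma of_equiv {n : ℕ} {M N : Type u} [AddCommGroup M] [Module R M] [AddCommGroup N] [Module R N]
    (e : M ≃ₗ[R] N) (h : HasFiniteFreeResolution R n M) : HasFiniteFreeResolution R n N := by
  cases n with
  | zero =>
    obtain ⟨h1, h2⟩ := h
    exact ⟨Module.Finite.equiv e, Module.Free.of_equiv e⟩
  | succ n =>
    obtain ⟨m, φ, hφ, h⟩ := h
    refine ⟨m, e.toLinearMap ∘ₗ φ, e.surjective.comp hφ, ?_⟩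
    rwa [LinearEquiv.ker_comp]

/-- A projective module with a finite free resolution is stably free. -/
lemma isStablyFree {n : ℕ} {M : Type u} [AddCommGroup M] [Module R M] [Module.Projective R M]
    (h : HasFiniteFreeResolution R n M) : Module.IsStablyFree R M := by
  induction n generalizing M with
  | zero =>
    have := h.2
    infer_instance
  | succ n ih =>
    obtain ⟨m, φ, hφ, h⟩ := h
    obtain ⟨s, hs⟩ := Module.projective_lifting_property φ LinearMap.id hφ
    -- the splitting identifies `R ^ m` with `M × ker φ`
    let e : (Fin m → R) ≃ₗ[R] M × LinearMap.ker φ :=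
      { toFun := fun v => (φ v, ⟨v - s (φ v), by
          have : φ (s (φ v)) = φ v := congr($hs (φ v))
          simp [this]⟩)
        map_add' := fun v w => by
          ext1
          · simp
          · ext1
            simp only [map_add, Prod.snd_add, Submodule.coe_add]
            abel
        map_smul' := fun r v => by
          ext1
          · simp
          · ext1
            simp [smul_sub]
        invFun := fun p => s p.1 + p.2
        left_inv := fun v => by simp
        right_inv := fun p => by
          have h1 : φ (s p.1) = p.1 := congr($hs p.1)
          have h2 : φ (p.2 : Fin m → R) = 0 := p.2.2
          ext1
          · simp [h1, h2]
          · ext1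
            simp [h1, h2] }
    have hP : Module.Projective R (M × LinearMap.ker φ) := Module.Projective.of_equiv e
    have hF : Module.Finite R (M × LinearMap.ker φ) := Module.Finite.equiv e
    have : Module.Projective R (LinearMap.ker φ) := Module.Projective.of_split
      (LinearMap.inr R M _) (LinearMap.snd R M _) (LinearMap.ext fun _ => rfl)
    have : Module.Finite R (LinearMap.ker φ) := Module.Finite.of_surjective
      (LinearMap.snd R M (LinearMap.ker φ)) LinearMap.snd_surjective
    have := ih h
    obtain ⟨N, _, _, _, _, _⟩ := Module.IsStablyFree.exist_free_prod R (LinearMap.ker φ)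
    have : Module.Free R (M × LinearMap.ker φ) := Module.Free.of_equiv e
    have : Module.Free R (M × (LinearMap.ker φ × N)) :=
      Module.Free.of_equiv (LinearEquiv.prodAssoc R M (LinearMap.ker φ) N)
    exact Module.IsStablyFree.of_free_prod R M (LinearMap.ker φ × N)

/-- Finite free resolutions localize. -/
lemma localization (S : Submonoid R) {n : ℕ} {M : Type u} [AddCommGroup M] [Module R M]
    (h : HasFiniteFreeResolution R n M) :
    HasFiniteFreeResolution (Localization S) n (LocalizedModule S M) := by
  induction n generalizing M with
  | zero =>
    obtain ⟨h1, h2⟩ := h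
    exact ⟨Module.Finite.of_isLocalizedModule S (LocalizedModule.mkLinearMap S M),
      Module.free_of_isLocalizedModule S (LocalizedModule.mkLinearMap S M)⟩
  | succ n ih =>
    obtain ⟨m, φ, hφ, h⟩ := h
    let ι : (Fin m → R) →ₗ[R] (Fin m → Localization S) :=
      .pi fun i => (Algebra.linearMap R (Localization S)) ∘ₗ .proj i
    let j := LocalizedModule.mkLinearMap S M
    let ψ := (IsLocalizedModule.map S ι j φ).extendScalarsOfIsLocalization S (Localization S)
    refine ⟨m, ψ, IsLocalizedModule.map_surjective S ι j φ hφ, ?_⟩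
    have h2 : IsLocalizedModule S (LinearMap.toKerIsLocalized S ι j φ) :=
      LinearMap.toKerLocalized_isLocalizedModule (Localization S) S ι j φ
    let e := (IsLocalizedModule.iso S (LinearMap.toKerIsLocalized S ι j φ))
    let e' : LocalizedModule S (LinearMap.ker φ) ≃ₗ[R] LinearMap.ker ψ := e
    exact (ih h).of_equiv (e'.extendScalarsOfIsLocalization S (Localization S))

end HasFiniteFreeResolution

namespace RegularLocal

open Pointwise

/-- Finite free resolutions of `M / x M` over `R / x` lift to finite free resolutions of `M`
over `R`, if `x ∈ m` is regular on `R` and `M`. -/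
lemma hasFiniteFreeResolution_of_quotSMulTop {R : Type u} [CommRing R] [IsLocalRing R]
    [IsNoetherianRing R] {x : R} (hx : x ∈ maximalIdeal R) (hR : IsSMulRegular R x) {n : ℕ}
    {M : Type u} [AddCommGroup M] [Module R M] [Module.Finite R M] (hM : IsSMulRegular M x)
    (h : HasFiniteFreeResolution (R ⧸ Ideal.span {x}) n (QuotSMulTop x M)) :
    HasFiniteFreeResolution R n M := by
  have hjac : x ∈ (⊥ : Ideal R).jacobson := maximalIdeal_le_jacobson _ hx
  have hle : Ideal.span {x} ≤ (⊥ : Ideal R).jacobson := by simpa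
  induction n generalizing M with
  | zero =>
    have := Module.finitePresentation_of_finite R M
    exact ⟨inferInstance, (Module.free_quotSMulTop_iff_free R M hjac hM).1 h.2⟩
  | succ n ih =>
    obtain ⟨m, ψ, hψ, h⟩ := h
    let q : (Fin m → R) →ₗ[R] (Fin m → R ⧸ Ideal.span {x}) :=
      .pi fun i => (Submodule.mkQ (Ideal.span {x})) ∘ₗ .proj i
    have hq : Function.Surjective q := fun v => by
      choose w hw using fun i => Submodule.mkQ_surjective (Ideal.span {x}) (v i)
      exact ⟨w, funext hw⟩
    have hq0 : ∀ v, q v = 0 ↔ ∃ w, v = x • w := by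
      intro v
      constructor
      · intro h
        have : ∀ i, ∃ a, a * x = v i := fun i =>
          Ideal.mem_span_singleton'.1 ((Submodule.Quotient.mk_eq_zero _).1 (congrFun h i))
        choose w hw using this
        exact ⟨w, funext fun i => by rw [Pi.smul_apply, smul_eq_mul, mul_comm, hw]⟩
      · rintro ⟨w, rfl⟩
        funext i
        exact (Submodule.Quotient.mk_eq_zero _).2
          (Ideal.mul_mem_right _ _ (Ideal.mem_span_singleton_self x))
    let ψ' : (Fin m → R ⧸ Ideal.span {x}) →ₗ[R] QuotSMulTop x M := ψ.restrictScalars R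
    obtain ⟨φ, hφ⟩ := Module.projective_lifting_property
      (Submodule.mkQ (x • (⊤ : Submodule R M))) (ψ' ∘ₗ q) (Submodule.mkQ_surjective _)
    have hφs : Function.Surjective φ := by
      apply φ.surjective_of_surjective_comp_mkQ (Ideal.span {x}) hle
      rw [Submodule.ideal_span_singleton_smul x ⊤, hφ]
      exact hψ.comp hq
    have hFx : IsSMulRegular (Fin m → R) x := fun v w hvw => funext fun i => hR (congrFun hvw i)
    have hK : IsSMulRegular (LinearMap.ker φ) x := fun v w hvw =>
      Subtype.ext (hFx (congrArg Subtype.val hvw))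
    refine ⟨m, φ, hφs, ih hK ?_⟩
    -- reduction modulo `x` maps `ker φ` onto `ker ψ` with kernel `x • ker φ`
    let r : LinearMap.ker φ →ₗ[R] LinearMap.ker ψ' :=
      (q ∘ₗ (LinearMap.ker φ).subtype).codRestrict _ fun v => by
        have := congr($hφ v)
        simp only [LinearMap.comp_apply, LinearMap.map_coe_ker, map_zero] at this
        simpa using this.symm
    have hr : Function.Surjective r := by
      rintro ⟨w, hw⟩
      obtain ⟨v, rfl⟩ := hq w
      have h1 : Submodule.mkQ (x • (⊤ : Submodule R M)) (φ v) = 0 := congr($hφ v).trans hw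
      rw [Submodule.mkQ_apply, Submodule.Quotient.mk_eq_zero] at h1
      obtain ⟨y, -, hy⟩ := h1
      obtain ⟨z, rfl⟩ := hφs y
      have hy : x • φ z = φ v := hy
      refine ⟨⟨v - x • z, by simp [hy]⟩, Subtype.ext ?_⟩
      change q (v - x • z) = q v
      rw [map_sub, (hq0 _).2 ⟨z, rfl⟩, sub_zero]
    have hrk : LinearMap.ker r = x • (⊤ : Submodule R (LinearMap.ker φ)) := by
      ext v
      constructor
      · intro hv
        obtain ⟨w, hw⟩ := (hq0 _).1 (congrArg Subtype.val hv : q v = 0)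
        have hw0 : φ w = 0 := by
          apply hM
          change x • φ w = x • 0
          rw [← map_smul, ← hw, smul_zero]
          exact v.2
        exact ⟨⟨w, hw0⟩, trivial, Subtype.ext hw.symm⟩
      · rintro ⟨w, -, rfl⟩
        exact Subtype.ext ((hq0 _).2 ⟨w, rfl⟩)
    let e₁ : QuotSMulTop x (LinearMap.ker φ) ≃ₗ[R] LinearMap.ker ψ' :=
      (Submodule.quotEquivOfEq _ _ hrk.symm).trans (LinearMap.quotKerEquivOfSurjective r hr)
    let e₂ : QuotSMulTop x (LinearMap.ker φ) ≃ₗ[R] LinearMap.ker ψ := e₁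
    exact h.of_equiv (e₂.extendScalarsOfSurjective Ideal.Quotient.mk_surjective).symm

/-- Finitely generated modules over a regular local ring have finite free resolutions. -/
theorem exists_hasFiniteFreeResolution (R : Type u) [CommRing R] [IsRegularLocalRing R]
    (M : Type u) [AddCommGroup M] [Module R M] [Module.Finite R M] :
    ∃ n, HasFiniteFreeResolution R n M := by
  induction hn : (maximalIdeal R).spanFinrank using Nat.strong_induction_on generalizing R M with
  | _ n ih =>
  subst hn
  by_cases h0 : maximalIdeal R = ⊥
  · let := (IsLocalRing.isField_iff_maximalIdeal_eq.2 h0).toField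
    exact ⟨0, inferInstance, Module.Free.of_divisionRing R M⟩
  obtain ⟨x, hx, hp, hreg, hrank⟩ := exists_prime R h0
  have := isDomain R
  have hR : IsSMulRegular R x := fun a b hab => mul_left_cancel₀ hp.ne_zero hab
  obtain ⟨m, φ, hφ⟩ := Module.Finite.exists_fin' R M
  have hK : IsSMulRegular (LinearMap.ker φ) x := fun v w hvw =>
    Subtype.ext (funext fun i => hR (congrFun (congrArg Subtype.val hvw) i))
  have : Module.Finite (R ⧸ Ideal.span {x}) (QuotSMulTop x (LinearMap.ker φ)) :=
    Module.Finite.of_restrictScalars_finite R _ _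
  obtain ⟨n, h⟩ := ih _ (hrank inferInstance) (R ⧸ Ideal.span {x})
    (QuotSMulTop x (LinearMap.ker φ)) rfl
  exact ⟨n + 1, m, φ, hφ, hasFiniteFreeResolution_of_quotSMulTop hx hR hK h⟩

end RegularLocal

/-! ### Locally principal ideals and factoriality of regular local rings -/

/-- An ideal of a Noetherian ring that becomes principal in a localization at a submonoid `M` is
principal up to multiplication by a single element of `M`. -/
lemma Ideal.exists_mul_mem_span_singleton_of_isPrincipal_map {R : Type*} [CommRing R]
    [IsNoetherianRing R] (M : Submonoid R) (L : Type*) [CommRing L] [Algebra R L]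
    [IsLocalization M L] (I : Ideal R) (h : (I.map (algebraMap R L)).IsPrincipal) :
    ∃ g ∈ I, ∃ s ∈ M, ∀ a ∈ I, s * a ∈ Ideal.span {g} := by
  obtain ⟨γ, hγ⟩ := h
  have hγ' : I.map (algebraMap R L) = Ideal.span {γ} := hγ
  have hγI : γ ∈ I.map (algebraMap R L) := hγ' ▸ Ideal.mem_span_singleton_self γ
  obtain ⟨⟨g, t⟩, hg⟩ := (IsLocalization.mem_map_algebraMap_iff M L).1 hγI
  have hone : ∀ a ∈ I, ∃ s ∈ M, s * a ∈ Ideal.span {(g : R)} := by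
    intro a ha
    have h1 : algebraMap R L a ∈ Ideal.span {γ} := hγ' ▸ Ideal.mem_map_of_mem _ ha
    obtain ⟨c, hc⟩ := Ideal.mem_span_singleton'.1 h1
    rw [← IsLocalization.algebraMap_mem_map_algebraMap_iff M L, Ideal.map_span, Set.image_singleton,
      ← hc, ← Ideal.unit_mul_mem_iff_mem _ (IsLocalization.map_units L t), ← mul_assoc,
      mul_comm (algebraMap R L _), mul_assoc, mul_comm (algebraMap R L _), hg]
    exact Ideal.mul_mem_left _ _ (Ideal.mem_span_singleton_self _)
  obtain ⟨T, hT⟩ := (IsNoetherian.noetherian I : I.FG)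
  choose! s hsM hs using hone
  refine ⟨g, g.2, ∏ a ∈ T, s a,
    Submonoid.prod_mem M fun a ha => hsM a (hT ▸ Ideal.subset_span ha), ?_⟩
  intro a ha
  rw [← hT] at ha
  induction ha using Submodule.span_induction with
  | mem a ha =>
    obtain ⟨c, hc⟩ := Finset.dvd_prod_of_mem s ha
    rw [hc, mul_right_comm]
    exact Ideal.mul_mem_right _ _ (hs a (hT ▸ Ideal.subset_span ha))
  | zero => simp
  | add a b _ _ ha hb => rw [mul_add]; exact add_mem ha hb
  | smul r a _ ha => rw [smul_eq_mul, mul_left_comm]; exact Ideal.mul_mem_left _ _ ha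

/-- A nonzero locally principal ideal of a domain is invertible. -/
lemma Ideal.invertible_of_locally_principal {S : Type u} [CommRing S] [IsDomain S] (I : Ideal S)
    (h0 : I ≠ ⊥) (h : ∀ q : Ideal S, q.IsMaximal → ∃ g ∈ I, ∃ s ∉ q, ∀ a ∈ I,
      s * a ∈ Ideal.span {g}) : Module.Invertible S I := by
  obtain ⟨a, haI, ha0⟩ := Submodule.exists_mem_ne_zero_of_ne_bot h0
  let J : Ideal S := (Ideal.span {a}).colon (I : Set S)
  have hmemJ : ∀ c, c ∈ J ↔ ∀ b ∈ I, c * b ∈ Ideal.span {a} := fun c => Submodule.mem_colon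
  -- locally at `q` we have `I = (g)`, so that `a / g ∈ J`
  have hIJ : a ∈ I * J := by
    by_contra hcon
    have hne : (I * J).colon {a} ≠ ⊤ := fun h => hcon (by
      have := (Ideal.eq_top_iff_one _).1 h
      rw [Submodule.mem_colon_singleton] at this
      simpa using this)
    obtain ⟨q, hq, hle⟩ := Ideal.exists_le_maximal _ hne
    obtain ⟨g, hg, s, hs, hsI⟩ := h q hq
    obtain ⟨c, hc⟩ := Ideal.mem_span_singleton'.1 (hsI a haI)
    have hs0 : s ≠ 0 := fun h => hs (h ▸ zero_mem q)
    have hcJ : c ∈ J := by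
      rw [hmemJ]
      intro b hb
      obtain ⟨d, hd⟩ := Ideal.mem_span_singleton'.1 (hsI b hb)
      refine Ideal.mem_span_singleton'.2 ⟨d, mul_left_cancel₀ hs0 ?_⟩
      calc s * (d * a) = d * (s * a) := by ring
        _ = c * (d * g) := by rw [← hc]; ring
        _ = s * (c * b) := by rw [hd]; ring
    refine hs (hle ?_)
    rw [Submodule.mem_colon_singleton, smul_eq_mul, ← hc, mul_comm c g]
    exact Ideal.mul_mem_mul hg hcJ
  let F := FractionRing S
  let A : Submodule S F := Submodule.map (Algebra.linearMap S F) I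
  let B : Submodule S F := Submodule.map (Algebra.linearMap S F) J *
    Submodule.span S {(algebraMap S F a)⁻¹}
  have ha0' : algebraMap S F a ≠ 0 := by simpa using ha0
  have hAB : A * B = 1 := by
    have h1 : Submodule.map (Algebra.linearMap S F) I * Submodule.map (Algebra.linearMap S F) J =
        Submodule.span S {algebraMap S F a} := by
      apply le_antisymm
      · rw [Submodule.mul_le]
        rintro _ ⟨b, hb, rfl⟩ _ ⟨c, hc, rfl⟩
        obtain ⟨d, hd⟩ := Ideal.mem_span_singleton'.1 ((hmemJ c).1 hc b hb)
        refine Submodule.mem_span_singleton.2 ⟨d, ?_⟩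
        rw [Algebra.smul_def, Algebra.linearMap_apply, Algebra.linearMap_apply, ← map_mul,
          ← map_mul, hd, mul_comm]
      · rw [Submodule.span_singleton_le_iff_mem]
        refine Submodule.mul_induction_on hIJ (C := fun y =>
          algebraMap S F y ∈ Submodule.map (Algebra.linearMap S F) I *
            Submodule.map (Algebra.linearMap S F) J) ?_ ?_
        · intro b hb c hc
          rw [map_mul]
          exact Submodule.mul_mem_mul ⟨b, hb, rfl⟩ ⟨c, hc, rfl⟩
        · intro y z hy hz
          rw [map_add]
          exact add_mem hy hz
    change Submodule.map _ I * (Submodule.map _ J * _) = 1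
    rw [← mul_assoc, h1, Submodule.span_mul_span, Set.singleton_mul_singleton,
      mul_inv_cancel₀ ha0', Submodule.one_eq_span]
  let U : (Submodule S F)ˣ := ⟨A, B, hAB, by rw [mul_comm, hAB]⟩
  let e : I ≃ₗ[S] A := Submodule.equivMapOfInjective (Algebra.linearMap S F)
    (IsFractionRing.injective S F) I
  have : FaithfulSMul S F :=
    (faithfulSMul_iff_algebraMap_injective S F).2 (IsFractionRing.injective S F)
  have : Module.Invertible S A := .left (Submodule.tensorInvEquiv U)
  exact Module.Invertible.congr e.symm

lemma Ideal.isPrincipal_of_invertible_of_free {S : Type u} [CommRing S] (I : Ideal S)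
    [Module.Invertible S I] [Module.Free S I] : I.IsPrincipal := by
  obtain ⟨e⟩ := Module.Invertible.free_iff_linearEquiv.1 (inferInstance : Module.Free S I)
  refine ⟨e.symm 1, le_antisymm (fun y hy => ?_) ?_⟩
  · refine Submodule.mem_span_singleton.2 ⟨e ⟨y, hy⟩, ?_⟩
    have : e ⟨y, hy⟩ • e.symm 1 = ⟨y, hy⟩ := by rw [← map_smul, smul_eq_mul, mul_one]; simp
    exact congrArg Subtype.val this
  · rw [Submodule.span_singleton_le_iff_mem]
    exact (e.symm 1).2

/-- Localizations of regular rings at primes are regular rings. -/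
lemma IsRegularRing.localization_atPrime {R : Type u} [CommRing R] [IsRegularRing R] (q : Ideal R)
    [q.IsPrime] : IsRegularRing (Localization.AtPrime q) := by
  rw [isRegularRing_iff]
  intro p hp
  exact IsRegularLocalRing.of_ringEquiv (IsLocalization.algEquiv
    (p.comap (algebraMap R _)).primeCompl
    (Localization.AtPrime (p.comap (algebraMap R (Localization.AtPrime q))))
    (Localization.AtPrime p)).toRingEquiv

/-- A prime of height one generates a principal ideal in every factorial local ring `A_q`. -/
lemma Ideal.isPrincipal_map_of_height_eq_one {A : Type*} [CommRing A] (q : Ideal A) [q.IsPrime]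
    (B : Type*) [CommRing B] [IsDomain B] [Algebra A B] [IsLocalization.AtPrime B q]
    [UniqueFactorizationMonoid B] (p : Ideal A) [p.IsPrime] (hp : p.height = 1) :
    (p.map (algebraMap A B)).IsPrincipal := by
  by_cases hd : Disjoint (q.primeCompl : Set A) (p : Set A)
  · have := IsLocalization.isPrime_of_isPrime_disjoint q.primeCompl B p inferInstance hd
    refine UniqueFactorizationMonoid.isPrincipal_of_height_eq_one ?_
    rw [← IsLocalization.height_under q.primeCompl,
      IsLocalization.under_map_of_isPrime_disjoint q.primeCompl _ inferInstance hd, hp]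
  · rw [← IsLocalization.map_algebraMap_ne_top_iff_disjoint q.primeCompl B, not_not] at hd
    rw [hd]
    exact top_isPrincipal

/-- Auslander–Buchsbaum: a local ring all of whose localizations are regular is factorial.
By Nagata's criterion it suffices to invert a prime element `x` of the maximal ideal. A prime of
height one of the localization is invertible by induction on the dimension, and stably free since
all finitely generated modules have finite free resolutions; hence it is principal. -/
theorem RegularLocal.uniqueFactorizationMonoid (R : Type u) [CommRing R] [IsRegularLocalRing R]
    [IsRegularRing R] [IsDomain R] : UniqueFactorizationMonoid R := by
  induction hn : (maximalIdeal R).spanFinrank using Nat.strong_induction_on generalizing R with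
  | _ n ih =>
  subst hn
  by_cases h0 : maximalIdeal R = ⊥
  · let := (IsLocalRing.isField_iff_maximalIdeal_eq.2 h0).toField
    infer_instance
  obtain ⟨x, hx, hp, -, -⟩ := exists_prime R h0
  let S := Localization.Away x
  have hMle : Submonoid.powers x ≤ nonZeroDivisors R :=
    powers_le_nonZeroDivisors_of_noZeroDivisors hp.ne_zero
  have : IsDomain S := IsLocalization.isDomain_localization hMle
  have : IsNoetherianRing S := IsLocalization.isNoetherianRing (Submonoid.powers x) S inferInstance
  rw [UniqueFactorizationMonoid.iff_localizationAway_of_prime hp]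
  refine UniqueFactorizationMonoid.of_forall_isPrincipal_of_height_eq_one fun p _ hp1 => ?_
  let P : Ideal R := p.under R
  have hPp : P.map (algebraMap R S) = p := IsLocalization.map_under (Submonoid.powers x) S p
  have hP1 : P.height = 1 := by rw [← hp1]; exact IsLocalization.height_under (Submonoid.powers x) p
  have : Module.Invertible S p := by
    refine Ideal.invertible_of_locally_principal p (p.ne_bot_of_height_eq_one hp1) fun q hq => ?_
    let Q : Ideal R := q.under R
    have hxQ : x ∉ Q := fun h => hq.ne_top (Ideal.eq_top_of_isUnit_mem _ h
      (IsLocalization.map_units S (⟨x, Submonoid.mem_powers x⟩ : Submonoid.powers x)))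
    have hQm : Q < maximalIdeal R := lt_of_le_of_ne (le_maximalIdeal (Ideal.IsPrime.ne_top'))
      fun h => hxQ (h ▸ hx)
    have := IsRegularRing.localization_atPrime Q
    have : IsRegularLocalRing (Localization.AtPrime Q) :=
      IsRegularRing.isRegularLocalRing_localization Q
    have hlt : (maximalIdeal (Localization.AtPrime Q)).spanFinrank <
        (maximalIdeal R).spanFinrank := by
      have h1 : ((maximalIdeal (Localization.AtPrime Q)).height : WithBot ℕ∞) <
          (maximalIdeal R).height := by
        rw [← IsLocalization.height_under Q.primeCompl,
          IsLocalization.AtPrime.under_maximalIdeal _ Q]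
        exact_mod_cast Ideal.height_strict_mono_of_isPrime_of_isPrime hQm
      rw [maximalIdeal_height_eq_ringKrullDim, maximalIdeal_height_eq_ringKrullDim,
        ← (isRegularLocalRing_iff _).1 inferInstance,
        ← (isRegularLocalRing_iff _).1 inferInstance] at h1
      exact_mod_cast h1
    have : UniqueFactorizationMonoid (Localization.AtPrime Q) := ih _ hlt _ rfl
    have hprinc : (P.map (algebraMap R (Localization.AtPrime Q))).IsPrincipal :=
      Ideal.isPrincipal_map_of_height_eq_one Q _ P hP1
    obtain ⟨g, hg, s, hs, hsP⟩ :=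
      Ideal.exists_mul_mem_span_singleton_of_isPrincipal_map Q.primeCompl _ P hprinc
    refine ⟨algebraMap R S g, hg, algebraMap R S s, hs, fun a ha => ?_⟩
    rw [← hPp] at ha
    refine Submodule.span_induction (p := fun a _ => algebraMap R S s * a ∈
      Ideal.span {algebraMap R S g}) ?_ ?_ ?_ ?_ ha
    · rintro _ ⟨b, hb, rfl⟩
      rw [← map_mul, ← Set.image_singleton, ← Ideal.map_span]
      exact Ideal.mem_map_of_mem _ (hsP b hb)
    · simp
    · intro a b _ _ ha hb
      rw [mul_add]
      exact add_mem ha hb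
    · intro r a _ ha
      rw [smul_eq_mul, mul_left_comm]
      exact Ideal.mul_mem_left _ _ ha
  obtain ⟨n, hn⟩ := exists_hasFiniteFreeResolution R P
  have hn' := hn.localization (Submonoid.powers x)
  let e : LocalizedModule (Submonoid.powers x) P ≃ₗ[R] P.map (algebraMap R S) :=
    IsLocalizedModule.iso (Submonoid.powers x) (Algebra.idealMap P (S := S))
  let e' : LocalizedModule (Submonoid.powers x) P ≃ₗ[S] P.map (algebraMap R S) :=
    e.extendScalarsOfIsLocalization (Submonoid.powers x) S
  have h2 : HasFiniteFreeResolution S n p := by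
    have := hn'.of_equiv e'
    rwa [hPp] at this
  have := h2.isStablyFree
  have := Module.free_of_isStablyFree_of_invertible S p
  exact Ideal.isPrincipal_of_invertible_of_free p

/-! ### Smooth algebras over a field -/

/-- An étale algebra over a regular ring is regular: the extension of local rings
`R_p → S_q` is flat and unramified, so generators of the maximal ideal of `R_p` generate that of
`S_q`, while going down bounds the dimension of `S_q` from below. -/
lemma IsRegularRing.of_etale (R S : Type*) [CommRing R] [CommRing S] [Algebra R S]
    [IsRegularRing R] [Algebra.Etale R S] : IsRegularRing S := by
  have : IsNoetherianRing S := Algebra.FiniteType.isNoetherianRing R S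
  have : Algebra.HasGoingDown R S := Algebra.HasGoingDown.of_flat
  refine isRegularRing_iff.2 fun q _ => ?_
  let p := q.under R
  let Rp := Localization.AtPrime p
  let Sq := Localization.AtPrime q
  let : Algebra Rp Sq := Localization.AtPrime.algebraOfLiesOver p q
  have : Algebra.EssFiniteType Rp Sq := Algebra.EssFiniteType.of_comp R Rp Sq
  have : Algebra.FormallyUnramified Rp Sq := Algebra.FormallyUnramified.of_restrictScalars R Rp Sq
  have hm : (maximalIdeal Rp).map (algebraMap Rp Sq) = maximalIdeal Sq :=
    Algebra.FormallyUnramified.map_maximalIdeal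
  have hR : IsRegularLocalRing Rp := IsRegularRing.isRegularLocalRing_localization p
  have hRp : (maximalIdeal Rp).height = p.height := by
    rw [← IsLocalization.height_under p.primeCompl, IsLocalization.AtPrime.under_maximalIdeal _ p]
  have hSq : (maximalIdeal Sq).height = q.height := by
    rw [← IsLocalization.height_under q.primeCompl, IsLocalization.AtPrime.under_maximalIdeal _ q]
  refine IsRegularLocalRing.of_spanFinrank_maximalIdeal_le Sq ?_
  have h1 : (maximalIdeal Sq).spanFinrank ≤ (maximalIdeal Rp).spanFinrank := by
    rw [← hm]
    exact Ideal.spanFinrank_map_le_of_fg _ (IsNoetherian.noetherian _)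
  have h2 : p.height ≤ q.height := by
    rw [Ideal.height_eq_height_add_of_liesOver_of_hasGoingDown p q]
    exact le_self_add
  calc ((maximalIdeal Sq).spanFinrank : WithBot ℕ∞) ≤ (maximalIdeal Rp).spanFinrank := by
        exact_mod_cast h1
    _ = ((maximalIdeal Rp).height : WithBot ℕ∞) := by
        rw [maximalIdeal_height_eq_ringKrullDim]; exact hR.spanFinrank_maximalIdeal
    _ ≤ (maximalIdeal Sq).height := by rw [hRp, hSq]; exact_mod_cast h2
    _ = ringKrullDim Sq := maximalIdeal_height_eq_ringKrullDim

lemma RingHom.IsStandardSmooth.isRegularRing {R S : Type*} [CommRing R] [CommRing S]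
    [IsRegularRing R] {f : R →+* S} (hf : f.IsStandardSmooth) : IsRegularRing S := by
  obtain ⟨n, g, -, hg⟩ := hf.exists_etale_mvPolynomial
  algebraize [g]
  have := MvPolynomial.isRegularRing_of_isRegularRing R (ι := Fin n)
  exact .of_etale (MvPolynomial (Fin n) R) S

/-- The `K`-points of a standard smooth algebra over a separably closed field are dense.
The algebra is étale over a polynomial ring, so the locus where `a` does not vanish has open image
in affine space; the fibre over a `K`-point of this image is étale over `K`, that is,
a product of copies of `K`. -/
lemma RingHom.IsStandardSmooth.exists_ringHom_ne_zero {K A : Type u} [Field K] [IsSepClosed K]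
    [CommRing A] {f : K →+* A} (hf : f.IsStandardSmooth) {a : A} (ha : ¬ IsNilpotent a) :
    ∃ φ : A →+* K, φ.comp f = RingHom.id K ∧ φ a ≠ 0 := by
  obtain ⟨n, g, rfl, hg⟩ := hf.exists_etale_mvPolynomial
  let R := MvPolynomial (Fin n) K
  let : Algebra R A := g.toAlgebra
  have : Algebra.Etale R A := hg
  have : Algebra.HasGoingDown R A := Algebra.HasGoingDown.of_flat
  have hopen := PrimeSpectrum.isOpenMap_comap_of_hasGoingDown_of_finitePresentation (R := R)
    (S := A) _ (PrimeSpectrum.basicOpen a).isOpen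
  obtain ⟨x, hx⟩ : (PrimeSpectrum.basicOpen a : Set (PrimeSpectrum A)).Nonempty := by
    rw [Set.nonempty_iff_ne_empty, Ne, TopologicalSpace.Opens.coe_eq_empty]
    exact fun h => ha ((PrimeSpectrum.basicOpen_eq_bot_iff a).1 h)
  obtain ⟨_, ⟨_, ⟨r, rfl⟩, rfl⟩, hxr, hr⟩ :=
    PrimeSpectrum.isBasis_basic_opens.exists_subset_of_mem_open
      (Set.mem_image_of_mem (PrimeSpectrum.comap (algebraMap R A)) hx) hopen
  have hr0 : r ≠ 0 := by rintro rfl; simp at hxr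
  -- a finite field is perfect, and algebraically closed fields are infinite
  have : Infinite K := by
    by_contra h
    have : _root_.Finite K := not_infinite_iff_finite.1 h
    have : IsAlgClosed K := inferInstance
    exact h inferInstance
  obtain ⟨c, hc⟩ : ∃ c : Fin n → K, MvPolynomial.eval c r ≠ 0 := by
    by_contra! h
    exact hr0 (MvPolynomial.funext fun c => by simpa using h c)
  let p : PrimeSpectrum R := ⟨RingHom.ker (MvPolynomial.eval c), RingHom.ker_isPrime _⟩
  obtain ⟨q, hq, hqp⟩ := hr (show p ∈ PrimeSpectrum.basicOpen r from hc)
  let : Algebra R K := (MvPolynomial.eval c).toAlgebra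
  let fbar : K →+* A ⧸ q.asIdeal := (Ideal.Quotient.mk q.asIdeal).comp (g.comp MvPolynomial.C)
  have hcomm : ∀ s : R, fbar (MvPolynomial.eval c s) = Ideal.Quotient.mk q.asIdeal (g s) := by
    intro s
    rw [← sub_eq_zero]
    have h1 : fbar (MvPolynomial.eval c s) =
        Ideal.Quotient.mk q.asIdeal (g (MvPolynomial.C (MvPolynomial.eval c s))) := by
      rfl
    rw [h1, ← map_sub, ← map_sub, Ideal.Quotient.eq_zero_iff_mem]
    have h2 : MvPolynomial.C (MvPolynomial.eval c s) - s ∈ p.asIdeal := by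
      change MvPolynomial.eval c _ = 0
      simp
    rw [← hqp] at h2
    exact h2
  let φ₁ : K →ₐ[R] A ⧸ q.asIdeal := { fbar with commutes' := hcomm }
  let ψ : TensorProduct R K A →ₐ[R] A ⧸ q.asIdeal :=
    Algebra.TensorProduct.productMap φ₁ (Ideal.Quotient.mkₐ R q.asIdeal)
  let a' : TensorProduct R K A := Algebra.TensorProduct.includeRight a
  have ha' : a' ≠ 0 := by
    intro h0
    have : ψ a' = Ideal.Quotient.mk q.asIdeal a := by simp [ψ, a']
    rw [h0, map_zero] at this
    exact hq (Ideal.Quotient.eq_zero_iff_mem.1 this.symm)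
  let e := Algebra.FormallyEtale.equivPiOfIsSepClosed K (TensorProduct R K A)
  have : e a' ≠ 0 := fun h => ha' (by simpa using h)
  obtain ⟨i, hi⟩ := Function.ne_iff.1 this
  refine ⟨((Pi.evalRingHom (fun _ => K) i).comp e.toRingEquiv.toRingHom).comp
    (Algebra.TensorProduct.includeRight : A →ₐ[R] TensorProduct R K A).toRingHom, ?_, hi⟩
  ext x
  have h1 : (Algebra.TensorProduct.includeRight : A →ₐ[R] TensorProduct R K A)
      (g (MvPolynomial.C x)) = algebraMap K (TensorProduct R K A) x := by
    change (Algebra.TensorProduct.includeRight : A →ₐ[R] TensorProduct R K A)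
      (algebraMap R A (MvPolynomial.C x)) = _
    rw [AlgHom.commutes, IsScalarTower.algebraMap_apply R K (TensorProduct R K A)]
    congr 1
    exact MvPolynomial.eval_C x
  change e ((Algebra.TensorProduct.includeRight : A →ₐ[R] TensorProduct R K A)
    (g (MvPolynomial.C x))) i = x
  rw [h1, e.commutes]
  rfl

/-! ### Rational functions regular at a prime -/

section FractionField

variable {A K : Type*} [CommRing A] [IsDomain A] [Field K] [Algebra A K] [IsFractionRing A K]

/-- The element `t` of the fraction field of `A` lies in the local ring `A_p`. -/
def RegularAtPrime (p : Ideal A) (t : K) : Prop :=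
  ∃ a s : A, s ∉ p ∧ t * algebraMap A K s = algebraMap A K a

/-- A fraction `a / s` with `s ∉ p` is a unit of `A_p` if and only if `a ∉ p`. -/
lemma inv_regularAtPrime_iff {p : Ideal A} [p.IsPrime] {t : K} {a s : A} (hs : s ∉ p)
    (e : t * algebraMap A K s = algebraMap A K a) :
    (t ≠ 0 ∧ RegularAtPrime p t⁻¹) ↔ a ∉ p := by
  constructor
  · rintro ⟨h0, b, u, hu, e'⟩ ha
    have : s * u = a * b := by
      apply IsFractionRing.injective A K
      rw [map_mul, map_mul, ← e, ← e']
      field_simp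
    exact ((‹p.IsPrime›.mem_or_mem (this ▸ p.mul_mem_right b ha : s * u ∈ p)).elim hs hu)
  · intro ha
    have h0 : t ≠ 0 := by
      rintro rfl
      rw [zero_mul] at e
      have : a = 0 := IsFractionRing.injective A K (by rw [← e, map_zero])
      exact ha (this ▸ p.zero_mem)
    refine ⟨h0, s, a, ha, ?_⟩
    rw [← e, inv_mul_cancel_left₀ h0]

lemma regularAtPrime_iff_mem_range (q : Ideal A) [q.IsPrime] (B : Type*) [CommRing B] [Algebra A B]
    [IsLocalization.AtPrime B q] [Algebra B K] [IsScalarTower A B K] (t : K) :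
    RegularAtPrime q t ↔ t ∈ (algebraMap B K).range := by
  constructor
  · rintro ⟨a, s, hs, e⟩
    refine ⟨IsLocalization.mk' B a (⟨s, hs⟩ : q.primeCompl), ?_⟩
    have h0 : algebraMap A K s ≠ 0 := by
      rw [Ne, map_eq_zero_iff _ (IsFractionRing.injective A K)]
      rintro rfl
      exact hs q.zero_mem
    apply mul_right_cancel₀ h0
    rw [e, IsScalarTower.algebraMap_apply A B K, ← map_mul, IsLocalization.mk'_spec' B a
      (⟨s, hs⟩ : q.primeCompl) |> fun h => (mul_comm _ _).trans h,
      ← IsScalarTower.algebraMap_apply]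
  · rintro ⟨b, rfl⟩
    obtain ⟨⟨a, s⟩, e⟩ := IsLocalization.surj q.primeCompl b
    refine ⟨a, s.1, s.2, ?_⟩
    rw [IsScalarTower.algebraMap_apply A B K, ← map_mul, e, ← IsScalarTower.algebraMap_apply]

/-- Near `q` the prime divisor `p` has a single local equation `g`: at every prime `q'` not
containing `s`, the multiples of `g` in `A_q'` are the elements vanishing along `p`
(all elements, if `p` does not pass through `q'`). -/
lemma exists_local_equation_of_isPrincipal_map [IsNoetherianRing A] (q : Ideal A) [q.IsPrime]
    (B : Type*) [CommRing B] [Algebra A B] [IsLocalization.AtPrime B q] (p : Ideal A) [p.IsPrime]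
    (hp0 : p ≠ ⊥) (hp : (p.map (algebraMap A B)).IsPrincipal) :
    ∃ g : A, g ≠ 0 ∧ ∃ s ∉ q, ∀ q' : Ideal A, q'.IsPrime → s ∉ q' → ∀ t : K,
      RegularAtPrime q' (t * (algebraMap A K g)⁻¹) ↔ RegularAtPrime q' t ∧
        (p ≤ q' → ¬ (t ≠ 0 ∧ RegularAtPrime p t⁻¹)) := by
  obtain ⟨g, hg, s, hs, hsg⟩ :=
    Ideal.exists_mul_mem_span_singleton_of_isPrincipal_map q.primeCompl B p hp
  have hs0 : s ≠ 0 := fun h => hs (h ▸ q.zero_mem)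
  have hg0 : g ≠ 0 := by
    rintro rfl
    refine hp0 (eq_bot_iff.2 fun a ha => ?_)
    have := hsg a ha
    simp only [Ideal.mem_span_singleton, zero_dvd_iff, mul_eq_zero, hs0, false_or] at this
    exact this
  have hgK : algebraMap A K g ≠ 0 := by
    rwa [Ne, map_eq_zero_iff _ (IsFractionRing.injective A K)]
  refine ⟨g, hg0, s, hs, fun q' hq' hsq' t => ?_⟩
  constructor
  · rintro ⟨b, v, hv, e⟩
    have e' : t * algebraMap A K v = algebraMap A K (g * b) := by
      rw [map_mul, ← e]
      field_simp
    refine ⟨⟨g * b, v, hv, e'⟩, fun hpq => ?_⟩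
    rw [inv_regularAtPrime_iff (fun h => hv (hpq h)) e', not_not]
    exact p.mul_mem_right b hg
  · rintro ⟨⟨a, v, hv, e⟩, h⟩
    by_cases hpq : p ≤ q'
    · have ha : a ∈ p := by
        have := h hpq
        rwa [inv_regularAtPrime_iff (fun h => hv (hpq h)) e, not_not] at this
      obtain ⟨c, hc⟩ := Ideal.mem_span_singleton.1 (hsg a ha)
      refine ⟨c, s * v, fun h => (hq'.mem_or_mem h).elim hsq' hv, ?_⟩
      have hc' := congrArg (algebraMap A K) hc
      rw [map_mul, map_mul, ← e] at hc'
      rw [map_mul]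
      field_simp
      rw [← hc']
      ring
    · obtain ⟨b, hb, hbq⟩ := SetLike.not_le_iff_exists.1 hpq
      obtain ⟨c, hc⟩ := Ideal.mem_span_singleton.1 (hsg b hb)
      refine ⟨a * c, v * (s * b), fun h => (hq'.mem_or_mem h).elim hv fun h =>
        (hq'.mem_or_mem h).elim hsq' hbq, ?_⟩
      rw [hc]
      simp only [map_mul]
      rw [← e]
      field_simp

/-- A rational function which is regular at all primes of height one in a factorial local ring
is regular. -/
lemma regularAtPrime_of_forall_height_eq_one [IsNoetherianRing A] (q : Ideal A) [q.IsPrime]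
    (B : Type*) [CommRing B] [IsDomain B] [Algebra A B] [IsLocalization.AtPrime B q] [Algebra B K]
    [IsScalarTower A B K] [IsFractionRing B K] [UniqueFactorizationMonoid B] {t : K}
    (h : ∀ p : Ideal A, p.IsPrime → p ≤ q → p.height = 1 → RegularAtPrime p t) :
    RegularAtPrime q t := by
  have : IsNoetherianRing B := IsLocalization.isNoetherianRing q.primeCompl B inferInstance
  have : IsLocalRing B := IsLocalization.AtPrime.isLocalRing B q
  obtain ⟨a, b, hab, rfl⟩ := IsFractionRing.exists_reduced_fraction (A := B) t
  rw [regularAtPrime_iff_mem_range q B]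
  have hb0 : (b : B) ≠ 0 := nonZeroDivisors.coe_ne_zero b
  have hbK : algebraMap B K b ≠ 0 := by
    rwa [Ne, map_eq_zero_iff _ (IsFractionRing.injective B K)]
  by_cases hb : IsUnit (b : B)
  · obtain ⟨v, hv⟩ := hb
    refine ⟨a * ((v⁻¹ : Bˣ) : B), ?_⟩
    rw [eq_comm, IsLocalization.mk'_eq_iff_eq_mul, ← map_mul, ← hv, mul_assoc, Units.inv_mul,
      mul_one]
  exfalso
  obtain ⟨π, hπ, hπb⟩ := WfDvdMonoid.exists_irreducible_factor hb hb0
  have hπp : Prime π := UniqueFactorizationMonoid.irreducible_iff_prime.1 hπ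
  have hP : (Ideal.span {π}).IsPrime := (Ideal.span_singleton_prime hπp.ne_zero).2 hπp
  have hPh : (Ideal.span {π}).height = 1 := by
    refine le_antisymm (Ideal.height_le_one_of_isPrincipal_of_mem_minimalPrimes
      (Ideal.span {π}) (Ideal.span {π}) (by rw [Ideal.minimalPrimes_eq_subsingleton_self]; rfl)) ?_
    rw [Order.one_le_iff_ne_zero, Ne, Ideal.height_eq_zero_iff_eq_bot, Ideal.span_singleton_eq_bot]
    exact hπp.ne_zero
  have hpq : (Ideal.span {π}).under A ≤ q := by
    rw [← IsLocalization.AtPrime.under_maximalIdeal B q]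
    exact Ideal.comap_mono (le_maximalIdeal hP.ne_top)
  obtain ⟨c, s, hs, e⟩ := h _ inferInstance hpq
    (by rw [IsLocalization.height_under q.primeCompl, hPh])
  have e' : a * algebraMap A B s = algebraMap A B c * b := by
    apply IsFractionRing.injective B K
    rw [map_mul, map_mul, ← IsScalarTower.algebraMap_apply, ← IsScalarTower.algebraMap_apply, ← e,
      mul_right_comm, IsLocalization.mk'_spec]
  have hdvd : π ∣ a * algebraMap A B s := e' ▸ hπb.mul_left _
  refine hπ.not_isUnit (hab ((hπp.dvd_or_dvd hdvd).resolve_right fun hd => hs ?_) hπb)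
  exact Ideal.mem_span_singleton.2 hd

/-- Only finitely many primes of height one contain a given nonzero element. -/
lemma finite_setOf_height_eq_one_mem [IsNoetherianRing A] {a : A} (ha : a ≠ 0) :
    {p : Ideal A | p.IsPrime ∧ p.height = 1 ∧ a ∈ p}.Finite := by
  refine (Ideal.finite_minimalPrimes_of_isNoetherianRing A (Ideal.span {a})).subset ?_
  rintro p ⟨hp, h1, hap⟩
  refine Ideal.mem_minimalPrimes_of_height_le ((Ideal.span_singleton_le_iff_mem _).2 hap) ?_
  rw [h1, Order.one_le_iff_ne_zero, Ne, Ideal.height_eq_zero_iff_eq_bot,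
    Ideal.span_singleton_eq_bot]
  exact ha

/-- A rational function is a unit at all but finitely many primes of height one. -/
lemma finite_setOf_not_regularAtPrime [IsNoetherianRing A] {t : K} (ht : t ≠ 0) :
    {p : Ideal A | p.IsPrime ∧ p.height = 1 ∧
      ¬ (RegularAtPrime p t ∧ RegularAtPrime p t⁻¹)}.Finite := by
  obtain ⟨a, b, hb, rfl⟩ := IsFractionRing.div_surjective (A := A) t
  have hb0 : b ≠ 0 := nonZeroDivisors.ne_zero hb
  have ha0 : a ≠ 0 := by rintro rfl; simp at ht
  have hbK : algebraMap A K b ≠ 0 := by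
    rwa [Ne, map_eq_zero_iff _ (IsFractionRing.injective A K)]
  have haK : algebraMap A K a ≠ 0 := by
    rwa [Ne, map_eq_zero_iff _ (IsFractionRing.injective A K)]
  refine ((finite_setOf_height_eq_one_mem ha0).union (finite_setOf_height_eq_one_mem hb0)).subset ?_
  rintro p ⟨hp, h1, h⟩
  by_contra hc
  have hap : a ∉ p := fun h' => hc (Or.inl ⟨hp, h1, h'⟩)
  have hbp : b ∉ p := fun h' => hc (Or.inr ⟨hp, h1, h'⟩)
  exact h ⟨⟨a, b, hbp, by field_simp⟩, ⟨b, a, hap, by field_simp⟩⟩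

end FractionField

noncomputable section
namespace ElementaryObstruction

/-! ### Prime divisors on locally factorial schemes -/

section PrimeDivisors

variable {X Y : Scheme.{u}} [IsIntegral X] [IsIntegral Y]

/-- The local ring at `x`, as a subring of the function field. -/
def regularAt (x : X) : Subring X.functionField :=
  (algebraMap (X.presheaf.stalk x) X.functionField).range

lemma mem_localUnits_iff {x : X} (φ : X.functionFieldˣ) :
    φ ∈ localUnits x ↔ (φ : X.functionField) ∈ regularAt x ∧
      (φ : X.functionField)⁻¹ ∈ regularAt x := by
  constructor
  · rintro ⟨v, rfl⟩
    exact ⟨⟨v, rfl⟩, ⟨((v⁻¹ : (X.presheaf.stalk x)ˣ) : X.presheaf.stalk x), by simp⟩⟩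
  · rintro ⟨⟨a, ha⟩, ⟨b, hb⟩⟩
    have hab : a * b = 1 := by
      apply IsFractionRing.injective (X.presheaf.stalk x) X.functionField
      rw [map_mul, ha, hb, map_one, mul_inv_cancel₀ φ.ne_zero]
    exact ⟨⟨a, b, hab, (mul_comm b a).trans hab⟩, Units.ext ha⟩

lemma functionFieldMap_mem_regularAt (f : X ⟶ Y) [IsDominant f] (x : X) {s : Y.functionField}
    (hs : s ∈ regularAt (f x)) : functionFieldMap f s ∈ regularAt x := by
  obtain ⟨t, rfl⟩ := hs
  refine ⟨f.stalkMap x t, ?_⟩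
  obtain ⟨U, hU, t', ht'⟩ := Y.presheaf.exists_germ_eq (t : Y.presheaf.stalk (f x))
  have hU' : x ∈ f ⁻¹ᵁ U := hU
  have : Nonempty U := ⟨⟨_, hU⟩⟩
  have : Nonempty (f ⁻¹ᵁ U : X.Opens) := ⟨⟨_, hU'⟩⟩
  rw [← ht', Scheme.algebraMap_germ_eq_germToFunctionField Y hU, Scheme.Hom.germ_stalkMap_apply,
    Scheme.algebraMap_germ_eq_germToFunctionField X hU',
    functionFieldMap_germ f _ (genericPoint_mem hU') le_rfl, Scheme.Hom.appLE]
  simp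

lemma functionFieldMap_mem_regularAt_iff (f : X ⟶ X) [IsIso f] (x : X) (s : X.functionField) :
    functionFieldMap f s ∈ regularAt x ↔ s ∈ regularAt (f x) := by
  refine ⟨fun h => ?_, functionFieldMap_mem_regularAt f x⟩
  have h1 : (inv f) (f x) = x := by rw [← Scheme.Hom.comp_apply, IsIso.hom_inv_id]; rfl
  have h2 := functionFieldMap_mem_regularAt (inv f) (f x) (s := functionFieldMap f s)
    (by rwa [h1])
  rwa [← functionFieldMap_eq_comp (inv f) f (𝟙 X) (by simp), functionFieldMap_eq_id (𝟙 X) rfl]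
    at h2

section Chart

variable {U : X.Opens} (hU : IsAffineOpen U)

lemma mem_regularAt_iff [Nonempty U] {x : X} (hx : x ∈ U) (t : X.functionField) :
    t ∈ regularAt x ↔ RegularAtPrime (hU.primeIdealOf ⟨x, hx⟩).asIdeal t := by
  have := functionField_isFractionRing_of_isAffineOpen X U hU
  let x' : U := ⟨x, hx⟩
  let _hA := TopCat.Presheaf.algebra_section_stalk X.presheaf x'
  have := hU.isLocalization_stalk x'
  have := functionField_isScalarTower X U x'
  exact (regularAtPrime_iff_mem_range (A := Γ(X, U)) (hU.primeIdealOf x').asIdeal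
    (X.presheaf.stalk x'.1) t).symm

lemma specializes_iff_primeIdealOf_le {x y : X} (hx : x ∈ U) (hy : y ∈ U) :
    x ⤳ y ↔ (hU.primeIdealOf ⟨x, hx⟩).asIdeal ≤ (hU.primeIdealOf ⟨y, hy⟩).asIdeal := by
  rw [PrimeSpectrum.asIdeal_le_asIdeal, PrimeSpectrum.le_iff_specializes]
  have := hU.fromSpec.isOpenEmbedding.isInducing.specializes_iff
    (x := hU.primeIdealOf ⟨x, hx⟩) (y := hU.primeIdealOf ⟨y, hy⟩)
  rwa [hU.fromSpec_primeIdealOf, hU.fromSpec_primeIdealOf] at this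

lemma ringKrullDim_stalk_eq_height {x : X} (hx : x ∈ U) :
    ringKrullDim (X.presheaf.stalk x) = (hU.primeIdealOf ⟨x, hx⟩).asIdeal.height := by
  let x' : U := ⟨x, hx⟩
  let _hA := TopCat.Presheaf.algebra_section_stalk X.presheaf x'
  have := hU.isLocalization_stalk x'
  exact IsLocalization.AtPrime.ringKrullDim_eq_height (hU.primeIdealOf x').asIdeal
    (X.presheaf.stalk x'.1)

lemma exists_primeIdealOf_eq (p : Ideal Γ(X, U)) (hp : p.IsPrime) :
    ∃ (x : X) (hx : x ∈ U), (hU.primeIdealOf ⟨x, hx⟩).asIdeal = p := by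
  have hx : hU.fromSpec ⟨p, hp⟩ ∈ U := by
    have : hU.fromSpec ⟨p, hp⟩ ∈ Set.range hU.fromSpec := ⟨_, rfl⟩
    rwa [hU.range_fromSpec] at this
  refine ⟨_, hx, ?_⟩
  have : hU.primeIdealOf ⟨_, hx⟩ = ⟨p, hp⟩ :=
    hU.fromSpec.isOpenEmbedding.injective (hU.fromSpec_primeIdealOf ⟨_, hx⟩)
  rw [this]

lemma mem_basicOpen_iff_notMem_primeIdealOf {x : X} (hx : x ∈ U) (s : Γ(X, U)) :
    x ∈ X.basicOpen s ↔ s ∉ (hU.primeIdealOf ⟨x, hx⟩).asIdeal := by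
  let x' : U := ⟨x, hx⟩
  let _hA := TopCat.Presheaf.algebra_section_stalk X.presheaf x'
  have := hU.isLocalization_stalk x'
  rw [X.mem_basicOpen s x hx]
  exact IsLocalization.AtPrime.isUnit_to_map_iff (X.presheaf.stalk x'.1)
    (hU.primeIdealOf x').asIdeal s

end Chart

variable (X) in
/-- The points of codimension one of an integral scheme, that is, the generic points of its prime
divisors. -/
abbrev PrimeDivisor : Type u := {x : X // ringKrullDim (X.presheaf.stalk x) = 1}

lemma height_primeIdealOf_eq_one_iff {U : X.Opens} (hU : IsAffineOpen U) {x : X} (hx : x ∈ U) :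
    (hU.primeIdealOf ⟨x, hx⟩).asIdeal.height = 1 ↔ ringKrullDim (X.presheaf.stalk x) = 1 := by
  rw [ringKrullDim_stalk_eq_height hU hx]
  exact_mod_cast Iff.rfl

/-- The function `φ` is a local equation at `y` of the closure of `x`: its multiples in the local
ring at `y` are the elements that are not invertible at `x` (all elements, if the closure of `x`
does not contain `y`). -/
def IsLocalEquation (x y : X) (φ : X.functionFieldˣ) : Prop :=
  ∀ t : X.functionField, t * (φ : X.functionField)⁻¹ ∈ regularAt y ↔ t ∈ regularAt y ∧
    (x ⤳ y → ¬ (t ≠ 0 ∧ t⁻¹ ∈ regularAt x))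

lemma IsLocalEquation.mk_eq {x y : X} {φ ψ : X.functionFieldˣ} (h : IsLocalEquation x y φ)
    (h' : IsLocalEquation x y ψ) :
    (QuotientGroup.mk φ : X.functionFieldˣ ⧸ localUnits y) = QuotientGroup.mk ψ := by
  have key : ∀ φ ψ : X.functionFieldˣ, IsLocalEquation x y φ → IsLocalEquation x y ψ →
      (φ : X.functionField) * (ψ : X.functionField)⁻¹ ∈ regularAt y := by
    intro φ ψ h h'
    rw [h', ← h, mul_inv_cancel₀ φ.ne_zero]
    exact one_mem _
  rw [mk_eq_mk_iff_div_mem, mem_localUnits_iff]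
  refine ⟨by simpa [div_eq_mul_inv] using key φ ψ h h', ?_⟩
  simpa [div_eq_mul_inv, mul_comm] using key ψ φ h' h

variable [IsLocallyNoetherian X] [∀ x : X, UniqueFactorizationMonoid (X.presheaf.stalk x)]

/-- On a locally factorial scheme prime divisors are locally given by one equation. -/
lemma exists_isLocalEquation (x : PrimeDivisor X) (y : X) :
    ∃ (V : X.Opens) (_ : y ∈ V) (φ : X.functionFieldˣ), ∀ z ∈ V, IsLocalEquation x.1 z φ := by
  obtain ⟨_, ⟨U, hU, rfl⟩, hy, -⟩ := X.isBasis_affineOpens.exists_subset_of_mem_open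
    (Set.mem_univ y) isOpen_univ
  replace hy : y ∈ U := hy
  have hUA : IsAffineOpen U := hU
  have : Nonempty U := ⟨⟨y, hy⟩⟩
  by_cases hx : x.1 ∈ U
  swap
  · refine ⟨U, hy, 1, fun z hz t => ?_⟩
    have hxz : ¬ x.1 ⤳ z := fun h => hx (h.mem_open U.isOpen hz)
    simp [hxz]
  have := functionField_isFractionRing_of_isAffineOpen X U hUA
  have : IsNoetherianRing Γ(X, U) := IsLocallyNoetherian.component_noetherian ⟨U, hUA⟩
  let y' : U := ⟨y, hy⟩
  let _hA := TopCat.Presheaf.algebra_section_stalk X.presheaf y'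
  have := hUA.isLocalization_stalk y'
  let p := (hUA.primeIdealOf ⟨x.1, hx⟩).asIdeal
  have hp1 : p.height = 1 := (height_primeIdealOf_eq_one_iff hUA hx).2 x.2
  have hp0 : p ≠ ⊥ := fun h => by rw [h, Ideal.height_bot] at hp1; exact zero_ne_one hp1
  have hp := Ideal.isPrincipal_map_of_height_eq_one (hUA.primeIdealOf y').asIdeal
    (X.presheaf.stalk y'.1) p hp1
  obtain ⟨g, hg, s, hs, hgs⟩ := exists_local_equation_of_isPrincipal_map (K := X.functionField)
    (hUA.primeIdealOf y').asIdeal (X.presheaf.stalk y'.1) p hp0 hp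
  have hgK : algebraMap Γ(X, U) X.functionField g ≠ 0 := by
    rwa [Ne, map_eq_zero_iff _ (IsFractionRing.injective Γ(X, U) X.functionField)]
  refine ⟨X.basicOpen s, (mem_basicOpen_iff_notMem_primeIdealOf hUA hy s).2 hs,
    Units.mk0 _ hgK, fun z hz t => ?_⟩
  have hzU : z ∈ U := X.basicOpen_le s hz
  rw [mem_regularAt_iff hUA hzU, mem_regularAt_iff hUA hzU, mem_regularAt_iff hUA hx,
    specializes_iff_primeIdealOf_le hUA hx hzU]
  exact hgs _ inferInstance ((mem_basicOpen_iff_notMem_primeIdealOf hUA hzU s).1 hz) t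

/-- A prime divisor of a locally factorial scheme as a Cartier divisor. -/
def primeDivisor (x : PrimeDivisor X) : CartierDiv X :=
  ⟨fun y => QuotientGroup.mk (exists_isLocalEquation x y).choose_spec.choose_spec.choose,
    fun y => by
      obtain ⟨V, hy, φ, h⟩ := exists_isLocalEquation x y
      refine ⟨V, hy, φ, fun z hz => IsLocalEquation.mk_eq ?_ (h z hz)⟩
      exact (exists_isLocalEquation x z).choose_spec.choose_spec.choose_spec z
        (exists_isLocalEquation x z).choose_spec.choose⟩

lemma primeDivisor_apply {x : PrimeDivisor X} {y : X} {φ : X.functionFieldˣ}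
    (h : IsLocalEquation x.1 y φ) : (primeDivisor x).1 y = QuotientGroup.mk φ :=
  IsLocalEquation.mk_eq ((exists_isLocalEquation x y).choose_spec.choose_spec.choose_spec y
    (exists_isLocalEquation x y).choose_spec.choose) h

lemma primeDivisor_apply_of_ne {x y : PrimeDivisor X} (hxy : x ≠ y) :
    (primeDivisor x).1 y.1 = 1 := by
  have h : ¬ x.1 ⤳ y.1 := by
    intro h
    obtain ⟨_, ⟨U, hU, rfl⟩, hy, -⟩ := X.isBasis_affineOpens.exists_subset_of_mem_open
      (Set.mem_univ y.1) isOpen_univ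
    have hUA : IsAffineOpen U := hU
    replace hy : y.1 ∈ U := hy
    have hx : x.1 ∈ U := h.mem_open U.isOpen hy
    have hle := (specializes_iff_primeIdealOf_le hUA hx hy).1 h
    have h1 := (height_primeIdealOf_eq_one_iff hUA hx).2 x.2
    have h2 := (height_primeIdealOf_eq_one_iff hUA hy).2 y.2
    have : IsNoetherianRing Γ(X, U) := IsLocallyNoetherian.component_noetherian ⟨U, hUA⟩
    have heq : (hUA.primeIdealOf ⟨x.1, hx⟩).asIdeal = (hUA.primeIdealOf ⟨y.1, hy⟩).asIdeal := by
      by_contra hne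
      have := Ideal.height_strict_mono_of_isPrime_of_isPrime (lt_of_le_of_ne hle hne)
      rw [h1, h2] at this
      exact lt_irrefl _ this
    have h3 : x.1 = y.1 := by
      rw [← hUA.fromSpec_primeIdealOf ⟨x.1, hx⟩, ← hUA.fromSpec_primeIdealOf ⟨y.1, hy⟩]
      congr 1
      exact PrimeSpectrum.ext heq
    exact hxy (Subtype.ext h3)
  exact primeDivisor_apply (φ := 1) fun t => by simp [h]

/-- At a point of codimension one, the group `K^× / O^×` is infinite cyclic, generated by the
prime divisor of the point. -/
lemma primeDivisor_apply_self (x : PrimeDivisor X) :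
    (∀ c : X.functionFieldˣ ⧸ localUnits x.1, ∃ n : ℤ, c = (primeDivisor x).1 x.1 ^ n) ∧
      ∀ n : ℤ, (primeDivisor x).1 x.1 ^ n = 1 → n = 0 := by
  let O := X.presheaf.stalk x.1
  have hdim : ringKrullDim O = 1 := x.2
  have hh : (IsLocalRing.maximalIdeal O).height = 1 := by
    have := IsLocalRing.maximalIdeal_height_eq_ringKrullDim (R := O)
    rw [hdim] at this
    exact_mod_cast this
  have hprinc : (IsLocalRing.maximalIdeal O).IsPrincipal :=
    UniqueFactorizationMonoid.isPrincipal_of_height_eq_one hh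
  obtain ⟨ϖ, hϖ⟩ := hprinc
  have hϖ' : IsLocalRing.maximalIdeal O = Ideal.span {ϖ} := hϖ
  have hϖ0 : ϖ ≠ 0 := by
    rintro rfl
    rw [Ideal.span_singleton_zero] at hϖ'
    rw [hϖ', Ideal.height_bot] at hh
    exact zero_ne_one hh
  have hϖp : Prime ϖ := by
    rw [← Ideal.span_singleton_prime hϖ0, ← hϖ']
    infer_instance
  have : IsDiscreteValuationRing O := by
    refine IsDiscreteValuationRing.ofHasUnitMulPowIrreducibleFactorization
      ⟨ϖ, hϖp.irreducible, fun {a} ha => ?_⟩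
    obtain ⟨n, v, hv, rfl⟩ := WfDvdMonoid.max_power_factor ha hϖp.irreducible
    have hvu : IsUnit v := by
      by_contra hvu
      have : v ∈ IsLocalRing.maximalIdeal O := hvu
      rw [hϖ', Ideal.mem_span_singleton] at this
      exact hv this
    exact ⟨n, associated_mul_unit_right _ _ hvu⟩
  have hinj := IsFractionRing.injective O X.functionField
  let π : X.functionFieldˣ := Units.mk0 (algebraMap O X.functionField ϖ) (by
    rwa [Ne, map_eq_zero_iff _ hinj])
  have hπ : IsLocalEquation x.1 x.1 π := by
    intro t
    constructor
    · rintro ⟨a, ha⟩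
      have ht : t = algebraMap O X.functionField (a * ϖ) := by
        rw [map_mul, ha]
        exact (inv_mul_cancel_right₀ π.ne_zero t).symm
      refine ⟨⟨_, ht.symm⟩, fun _ ⟨h0, b, hb⟩ => hϖp.not_isUnit ?_⟩
      refine IsUnit.of_mul_eq_one (a * b) (hinj ?_)
      have h1 : algebraMap O X.functionField (a * ϖ * b) = 1 := by
        rw [map_mul, ← ht, hb, mul_inv_cancel₀ h0]
      rw [map_one, ← h1]
      congr 1
      ring
    · rintro ⟨⟨a, rfl⟩, h⟩
      have ha : ϖ ∣ a := by
        rw [← Ideal.mem_span_singleton, ← hϖ']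
        intro hu
        obtain ⟨v, rfl⟩ := hu
        refine h specializes_rfl ⟨?_, ((v⁻¹ : Oˣ) : O), ?_⟩
        · rw [Ne, map_eq_zero_iff _ hinj]; exact v.ne_zero
        · simp
      obtain ⟨b, rfl⟩ := ha
      refine ⟨b, ?_⟩
      rw [map_mul, mul_comm (algebraMap O X.functionField ϖ)]
      exact (mul_inv_cancel_right₀ π.ne_zero _).symm
  rw [primeDivisor_apply hπ]
  have hmk : ∀ a : O, ∀ ha : algebraMap O X.functionField a ≠ 0, ∃ n : ℕ,
      (QuotientGroup.mk (Units.mk0 _ ha) : X.functionFieldˣ ⧸ localUnits x.1) =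
        QuotientGroup.mk π ^ n := by
    intro a ha
    have ha0 : a ≠ 0 := by rintro rfl; simp at ha
    obtain ⟨n, v, hv⟩ := IsDiscreteValuationRing.associated_pow_irreducible ha0 hϖp.irreducible
    refine ⟨n, ?_⟩
    rw [← QuotientGroup.mk_pow, QuotientGroup.eq]
    refine ⟨v, Units.ext ?_⟩
    have h1 : algebraMap O X.functionField a * algebraMap O X.functionField v =
        algebraMap O X.functionField ϖ ^ n := by rw [← map_mul, hv, map_pow]
    change algebraMap O X.functionField v =
      (algebraMap O X.functionField a)⁻¹ * algebraMap O X.functionField ϖ ^ n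
    rw [← h1, inv_mul_cancel_left₀ ha]
  constructor
  · intro c
    obtain ⟨c, rfl⟩ := QuotientGroup.mk_surjective c
    obtain ⟨a, b, hb, hab⟩ := IsFractionRing.div_surjective (A := O) (c : X.functionField)
    have hb0 : algebraMap O X.functionField b ≠ 0 := by
      rw [Ne, map_eq_zero_iff _ hinj]; exact nonZeroDivisors.ne_zero hb
    have ha0 : algebraMap O X.functionField a ≠ 0 := by
      intro h0
      rw [h0, zero_div] at hab
      exact c.ne_zero hab.symm
    obtain ⟨m, hm⟩ := hmk a ha0
    obtain ⟨n, hn⟩ := hmk b hb0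
    refine ⟨m - n, ?_⟩
    have : c = Units.mk0 _ ha0 / Units.mk0 _ hb0 := by
      ext; simp [hab]
    rw [this, QuotientGroup.mk_div, hm, hn, zpow_sub, zpow_natCast, zpow_natCast, div_eq_mul_inv]
  · have hpos : ∀ n : ℕ, (QuotientGroup.mk π : X.functionFieldˣ ⧸ localUnits x.1) ^ n = 1 →
        n = 0 := by
      intro n hn
      by_contra h0
      rw [← QuotientGroup.mk_pow, QuotientGroup.eq_one_iff] at hn
      obtain ⟨v, hv⟩ := hn
      have : (v : O) = ϖ ^ n := by
        apply hinj
        have := congrArg Units.val hv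
        rw [map_pow]
        exact this
      exact hϖp.not_isUnit (isUnit_of_dvd_unit (dvd_pow_self ϖ h0) (this ▸ v.isUnit))
    intro n hn
    obtain ⟨m, rfl | rfl⟩ := n.eq_nat_or_neg
    · rw [zpow_natCast] at hn
      rw [hpos m hn, Nat.cast_zero]
    · have hn' :=
        (zpow_neg (QuotientGroup.mk π : X.functionFieldˣ ⧸ localUnits x.1) m).symm.trans hn
      rw [inv_eq_one, zpow_natCast] at hn'
      rw [hpos m hn', Nat.cast_zero, neg_zero]

/-- Cartier divisors on a locally factorial scheme are determined by their values at the points of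
codimension one. -/
lemma eq_one_of_forall_primeDivisor {D : CartierDiv X} (h : ∀ x : PrimeDivisor X, D.1 x.1 = 1) :
    D = 1 := by
  ext y
  obtain ⟨W, hyW, φ, hφ⟩ := D.2 y
  obtain ⟨_, ⟨U, hU, rfl⟩, hy, hUW⟩ := X.isBasis_affineOpens.exists_subset_of_mem_open hyW W.isOpen
  have hUA : IsAffineOpen U := hU
  replace hy : y ∈ U := hy
  replace hUW : U ≤ W := hUW
  have : Nonempty U := ⟨⟨y, hy⟩⟩
  have := functionField_isFractionRing_of_isAffineOpen X U hUA
  have : IsNoetherianRing Γ(X, U) := IsLocallyNoetherian.component_noetherian ⟨U, hUA⟩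
  let y' : U := ⟨y, hy⟩
  let _hA := TopCat.Presheaf.algebra_section_stalk X.presheaf y'
  have := hUA.isLocalization_stalk y'
  have := functionField_isScalarTower X U y'
  have key : ∀ p : Ideal Γ(X, U), p.IsPrime → p.height = 1 →
      RegularAtPrime p (φ : X.functionField) ∧ RegularAtPrime p (φ : X.functionField)⁻¹ := by
    intro p hp hp1
    obtain ⟨x, hx, rfl⟩ := exists_primeIdealOf_eq hUA p hp
    have h1 := h ⟨x, (height_primeIdealOf_eq_one_iff hUA hx).1 hp1⟩
    rw [hφ x (hUW hx), QuotientGroup.eq_one_iff, mem_localUnits_iff, mem_regularAt_iff hUA hx,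
      mem_regularAt_iff hUA hx] at h1
    exact h1
  change D.1 y = 1
  rw [hφ y hyW, QuotientGroup.eq_one_iff, mem_localUnits_iff, mem_regularAt_iff hUA hy,
    mem_regularAt_iff hUA hy]
  exact ⟨regularAtPrime_of_forall_height_eq_one _ (X.presheaf.stalk y'.1)
      fun p hp _ hp1 => (key p hp hp1).1,
    regularAtPrime_of_forall_height_eq_one _ (X.presheaf.stalk y'.1)
      fun p hp _ hp1 => (key p hp hp1).2⟩

/-- A Cartier divisor on a quasi-compact scheme involves finitely many prime divisors. -/
lemma finite_setOf_apply_ne_one [CompactSpace X] (D : CartierDiv X) :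
    {x : PrimeDivisor X | D.1 x.1 ≠ 1}.Finite := by
  have hloc : ∀ y : X, ∃ U : X.Opens, y ∈ U ∧
      {x : PrimeDivisor X | x.1 ∈ U ∧ D.1 x.1 ≠ 1}.Finite := by
    intro y
    obtain ⟨W, hyW, φ, hφ⟩ := D.2 y
    obtain ⟨_, ⟨U, hU, rfl⟩, hy, hUW⟩ :=
      X.isBasis_affineOpens.exists_subset_of_mem_open hyW W.isOpen
    have hUA : IsAffineOpen U := hU
    replace hy : y ∈ U := hy
    replace hUW : U ≤ W := hUW
    have : Nonempty U := ⟨⟨y, hy⟩⟩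
    have := functionField_isFractionRing_of_isAffineOpen X U hUA
    have : IsNoetherianRing Γ(X, U) := IsLocallyNoetherian.component_noetherian ⟨U, hUA⟩
    refine ⟨U, hy, ?_⟩
    let P : PrimeDivisor X → Ideal Γ(X, U) := fun x => by
      classical
      exact if hx : x.1 ∈ U then (hUA.primeIdealOf ⟨x.1, hx⟩).asIdeal else ⊥
    have hP : ∀ x : PrimeDivisor X, ∀ hx : x.1 ∈ U,
        P x = (hUA.primeIdealOf ⟨x.1, hx⟩).asIdeal := fun x hx => dif_pos hx
    refine Set.Finite.of_finite_image (f := P) ?_ ?_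
    · refine (finite_setOf_not_regularAtPrime (A := Γ(X, U)) φ.ne_zero).subset ?_
      rintro _ ⟨x, ⟨hx, hD⟩, rfl⟩
      rw [hP x hx]
      refine ⟨inferInstance, (height_primeIdealOf_eq_one_iff hUA hx).2 x.2, fun h => hD ?_⟩
      rw [hφ x.1 (hUW hx), QuotientGroup.eq_one_iff, mem_localUnits_iff, mem_regularAt_iff hUA hx,
        mem_regularAt_iff hUA hx]
      exact h
    · rintro x ⟨hx, -⟩ x' ⟨hx', -⟩ e
      rw [hP x hx, hP x' hx'] at e
      apply Subtype.ext
      rw [← hUA.fromSpec_primeIdealOf ⟨x.1, hx⟩, ← hUA.fromSpec_primeIdealOf ⟨x'.1, hx'⟩]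
      congr 1
      exact PrimeSpectrum.ext e
  choose U hU hfin using hloc
  obtain ⟨t, -, ht⟩ := (isCompact_univ (X := X)).elim_nhds_subcover (fun x => (U x : Set _))
    (fun x _ => (U x).isOpen.mem_nhds (hU x))
  refine (t.finite_toSet.biUnion fun y _ => hfin y).subset fun x hx => ?_
  obtain ⟨y, hy, hxy⟩ := Set.mem_iUnion₂.1 (ht (Set.mem_univ x.1))
  exact Set.mem_iUnion₂.2 ⟨y, hy, hxy, hx⟩

variable (X) in
/-- Evaluation of divisors at a point. -/
def evalDiv (x : X) : CartierDiv X →* X.functionFieldˣ ⧸ localUnits x where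
  toFun D := D.1 x
  map_one' := rfl
  map_mul' _ _ := rfl

/-- On a quasi-compact locally factorial scheme the prime divisors are a basis of the group of
Cartier divisors. -/
def primeDivisorBasis [CompactSpace X] :
    Module.Basis (PrimeDivisor X) ℤ (Additive (CartierDiv X)) :=
  Module.Basis.mk (v := fun x => Additive.ofMul (primeDivisor x))
    (by
      classical
      rw [linearIndependent_iff']
      intro s c hc x hx
      have h1 : ∏ y ∈ s, primeDivisor y ^ c y = 1 := hc
      have h2 := congrArg (evalDiv X x.1) h1
      rw [map_prod, map_one, Finset.prod_eq_single_of_mem x hx, map_zpow] at h2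
      · exact (primeDivisor_apply_self x).2 _ h2
      · intro y _ hyx
        rw [map_zpow]
        exact (congrArg (· ^ c y) (primeDivisor_apply_of_ne hyx)).trans (one_zpow _))
    (by
      classical
      rintro D -
      obtain ⟨D, rfl⟩ := Additive.ofMul.surjective D
      choose n hn using fun x : PrimeDivisor X => (primeDivisor_apply_self x).1 (D.1 x.1)
      have hfin := finite_setOf_apply_ne_one D
      have hD : D = ∏ x ∈ hfin.toFinset, primeDivisor x ^ n x := by
        rw [← div_eq_one]
        refine eq_one_of_forall_primeDivisor fun x => ?_
        change evalDiv X x.1 (D / ∏ x ∈ hfin.toFinset, primeDivisor x ^ n x) = 1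
        rw [map_div, div_eq_one, map_prod]
        by_cases hx : x ∈ hfin.toFinset
        · rw [Finset.prod_eq_single_of_mem x hx, map_zpow]
          · exact hn x
          · intro y _ hyx
            rw [map_zpow]
            exact (congrArg (· ^ n y) (primeDivisor_apply_of_ne hyx)).trans (one_zpow _)
        · rw [Finset.prod_eq_one]
          · rw [Set.Finite.mem_toFinset] at hx
            exact not_not.1 hx
          · intro y hy
            have hyx : y ≠ x := fun h => hx (h ▸ hy)
            rw [map_zpow]
            exact (congrArg (· ^ n y) (primeDivisor_apply_of_ne hyx)).trans (one_zpow _)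
      rw [hD, ofMul_prod]
      refine Submodule.sum_mem _ fun x _ => ?_
      exact Submodule.smul_mem _ (n x) (Submodule.subset_span ⟨x, rfl⟩))

lemma primeDivisorBasis_apply [CompactSpace X] (x : PrimeDivisor X) :
    primeDivisorBasis x = Additive.ofMul (primeDivisor x) :=
  Module.Basis.mk_apply _ _ _

/-- Automorphisms permute the prime divisors. -/
lemma exists_map_primeDivisor_eq (f : X ⟶ X) [IsIso f] (x : PrimeDivisor X) :
    ∃ x' : PrimeDivisor X, CartierDiv.map f (primeDivisor x) = primeDivisor x' := by
  have hfx : f ((inv f) x.1) = x.1 := by rw [← Scheme.Hom.comp_apply, IsIso.inv_hom_id]; rfl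
  have hdim : ringKrullDim (X.presheaf.stalk ((inv f) x.1)) = 1 := by
    have e : X.presheaf.stalk x.1 ≅ X.presheaf.stalk ((inv f) x.1) :=
      X.presheaf.stalkCongr (.of_eq hfx.symm) ≪≫ asIso (f.stalkMap ((inv f) x.1))
    rw [← ringKrullDim_eq_of_ringEquiv e.commRingCatIsoToRingEquiv]
    exact x.2
  refine ⟨⟨_, hdim⟩, ?_⟩
  ext y
  obtain ⟨V, hy, φ, h⟩ := exists_isLocalEquation x (f y)
  have hφ := h (f y) hy
  rw [CartierDiv.map_apply f _ y φ (primeDivisor_apply hφ), primeDivisor_apply]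
  intro t
  obtain ⟨t, rfl⟩ : ∃ t', functionFieldMap f t' = t := by
    refine ⟨functionFieldMap (inv f) t, ?_⟩
    rw [← functionFieldMap_eq_comp f (inv f) (𝟙 X) (by simp), functionFieldMap_eq_id (𝟙 X) rfl]
  have hsp : (inv f) x.1 ⤳ y ↔ x.1 ⤳ f y := by
    rw [← f.isOpenEmbedding.isInducing.specializes_iff, hfx]
  change functionFieldMap f t * (functionFieldMap f φ)⁻¹ ∈ regularAt y ↔
    functionFieldMap f t ∈ regularAt y ∧ ((inv f) x.1 ⤳ y →
      ¬ (functionFieldMap f t ≠ 0 ∧ (functionFieldMap f t)⁻¹ ∈ regularAt ((inv f) x.1)))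
  rw [← map_inv₀, ← map_inv₀, ← map_mul, functionFieldMap_mem_regularAt_iff,
    functionFieldMap_mem_regularAt_iff, functionFieldMap_mem_regularAt_iff, hsp, hfx, hφ t,
    map_ne_zero_iff _ (functionFieldMap f).injective]

end PrimeDivisors

/-- A smooth scheme over a field `K` is covered by spectra of standard smooth `K`-algebras. -/
lemma exists_isStandardSmooth_of_smooth {K : Type u} [Field K] {X : Scheme.{u}}
    (f : X ⟶ Spec (.of K)) [Smooth f] (x : X) :
    ∃ V : X.Opens, IsAffineOpen V ∧ x ∈ V ∧
      ((Scheme.ΓSpecIso (.of K)).inv ≫ f.appLE ⊤ V le_top).hom.IsStandardSmooth := by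
  obtain ⟨U, hU, V, hV, hx, e, h⟩ := Smooth.exists_isStandardSmooth f x
  have hUtop : U = ⊤ := by
    have : Subsingleton (Spec (.of K)) := inferInstanceAs (Subsingleton (PrimeSpectrum K))
    refine top_le_iff.1 fun y _ => ?_
    rw [Subsingleton.elim y (f x)]
    exact e hx
  subst hUtop
  refine ⟨V, hV, hx, ?_⟩
  rw [CommRingCat.hom_comp]
  exact RingHom.isStandardSmooth_respectsIso.2 (f.appLE ⊤ V e).hom
    (Scheme.ΓSpecIso (.of K)).symm.commRingCatIsoToRingEquiv h

/-- The local rings of a smooth scheme over a field are factorial. -/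
lemma uniqueFactorizationMonoid_stalk_of_smooth {K : Type u} [Field K] {X : Scheme.{u}}
    [IsIntegral X] (f : X ⟶ Spec (.of K)) [Smooth f] (x : X) :
    UniqueFactorizationMonoid (X.presheaf.stalk x) := by
  obtain ⟨V, hV, hx, h⟩ := exists_isStandardSmooth_of_smooth f x
  have : IsRegularRing Γ(X, V) := h.isRegularRing
  let x' : V := ⟨x, hx⟩
  let _hA := TopCat.Presheaf.algebra_section_stalk X.presheaf x'
  have hloc := hV.isLocalization_stalk x'
  let q := (hV.primeIdealOf x').asIdeal
  let e : Localization.AtPrime q ≃ₐ[Γ(X, V)] X.presheaf.stalk x'.1 :=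
    IsLocalization.algEquiv q.primeCompl _ _
  have : IsDomain (Localization.AtPrime q) :=
    MulEquiv.isDomain (X.presheaf.stalk x'.1) e.toRingEquiv.toMulEquiv
  have := IsRegularRing.localization_atPrime q
  have := IsRegularRing.isRegularLocalRing_localization q
  exact e.toMulEquiv.uniqueFactorizationMonoid
    (RegularLocal.uniqueFactorizationMonoid (Localization.AtPrime q))

section Basis

variable {k : Type u} [Field k] (K : Type u) [Field K] [Algebra k K]
variable {X : Scheme.{u}} (f : X ⟶ Spec (.of k))

instance geomStr_smooth [Smooth f] : Smooth (geomStr K f) :=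
  MorphismProperty.of_isPullback (geom_isPullback K f) inferInstance

instance geomStr_quasiCompact [QuasiCompact f] : QuasiCompact (geomStr K f) :=
  MorphismProperty.of_isPullback (geom_isPullback K f) inferInstance

instance geom_compactSpace [QuasiCompact f] : CompactSpace (geom K f) :=
  QuasiCompact.compactSpace_of_compactSpace (geomStr K f)

instance geom_isLocallyNoetherian [Smooth f] : IsLocallyNoetherian (geom K f) :=
  LocallyOfFiniteType.isLocallyNoetherian (geomStr K f)

/-- The divisors of the base change of a smooth geometrically integral variety have a basis
which is permuted by the Galois group. -/
lemma exists_basis_div_permuted [Smooth f] [QuasiCompact f] [GeometricallyIntegral f] :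
    ∃ (S : Type u) (b : Module.Basis S ℤ (Additive (CartierDiv (geom K f)))),
      ∀ (σ : Gal(K/k)) (s : S), ∃ s', divAction K f σ (b s).toMul = (b s').toMul := by
  have := uniqueFactorizationMonoid_stalk_of_smooth (geomStr K f)
  refine ⟨_, primeDivisorBasis, fun σ s => ?_⟩
  obtain ⟨s', hs'⟩ := exists_map_primeDivisor_eq (galAct K f σ) s
  refine ⟨s', ?_⟩
  rw [primeDivisorBasis_apply, primeDivisorBasis_apply]
  exact hs'

end Basis

end ElementaryObstruction
end

noncomputable section

/-! ### Effaceability of `Ext` -/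

section Effaceable

universe w v u'

variable {C : Type u'} [Category.{v} C] [Abelian C] [HasExt.{w} C]

open DerivedCategory

/-- A quasi-isomorphism to a complex concentrated in degree `0` is an epimorphism in degree `0`. -/
lemma CochainComplex.epi_f_zero_of_quasiIso {X : CochainComplex C ℤ} {M : C}
    (s : X ⟶ (HomologicalComplex.single C (ComplexShape.up ℤ) 0).obj M) [QuasiIso s] :
    Epi (s.f 0) := by
  have h1 : Epi (HomologicalComplex.cyclesMap s 0 ≫
      ((HomologicalComplex.single C (ComplexShape.up ℤ) 0).obj M).homologyπ 0) := by
    rw [← HomologicalComplex.homologyπ_naturality]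
    infer_instance
  have h2 : IsIso (((HomologicalComplex.single C (ComplexShape.up ℤ) 0).obj M).homologyπ 0) :=
    HomologicalComplex.isIso_homologyπ _ (-1) 0 (by simp)
      ((HomologicalComplex.isZero_single_obj_X _ _ _ _ (by simp)).eq_of_src _ _)
  have h3 : IsIso (((HomologicalComplex.single C (ComplexShape.up ℤ) 0).obj M).iCycles 0) :=
    HomologicalComplex.isIso_iCycles _ 0 1 (by simp)
      ((HomologicalComplex.isZero_single_obj_X _ _ _ _ (by simp)).eq_of_tgt _ _)
  have h4 : Epi (HomologicalComplex.cyclesMap s 0) := by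
    have := epi_comp (HomologicalComplex.cyclesMap s 0 ≫
      ((HomologicalComplex.single C (ComplexShape.up ℤ) 0).obj M).homologyπ 0)
      (inv (((HomologicalComplex.single C (ComplexShape.up ℤ) 0).obj M).homologyπ 0))
    simpa using this
  have h5 : Epi (X.iCycles 0 ≫ s.f 0) := by
    rw [← HomologicalComplex.cyclesMap_i]
    infer_instance
  exact epi_of_epi (X.iCycles 0) (s.f 0)

/-- Every `Ext` class of positive degree vanishes after pullback along some epimorphism. -/
lemma CategoryTheory.Abelian.Ext.exists_epi_mk₀_comp_eq_zero {M N : C} {n : ℕ} (hn : n ≠ 0)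
    (α : Ext.{w} M N n) :
    ∃ (P : C) (π : P ⟶ M), Epi π ∧ (Ext.mk₀ π).comp α (zero_add n) = 0 := by
  let := HasDerivedCategory.standard C
  let M₀ := (HomologicalComplex.single C (ComplexShape.up ℤ) 0).obj M
  let N₀ := (HomologicalComplex.single C (ComplexShape.up ℤ) 0).obj N
  let e : Q.obj (N₀⟦(n : ℤ)⟧) ≅ (Q.obj N₀)⟦(n : ℤ)⟧ := (Q.commShiftIso (n : ℤ)).app N₀
  let a : Q.obj M₀ ⟶ (Q.obj N₀)⟦(n : ℤ)⟧ := α.hom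
  let f : Q.obj M₀ ⟶ Q.obj (N₀⟦(n : ℤ)⟧) := a ≫ e.inv
  obtain ⟨X, hX, s, hs, g, hf⟩ := right_fac_of_isStrictlyLE f 0
  have : QuasiIso s := (isIso_Q_map_iff_quasiIso C s).1 hs
  have hepi := CochainComplex.epi_f_zero_of_quasiIso s
  let π : X.X 0 ⟶ M := s.f 0 ≫ (HomologicalComplex.singleObjXSelf _ 0 M).hom
  let ι : (HomologicalComplex.single C (ComplexShape.up ℤ) 0).obj (X.X 0) ⟶ X :=
    HomologicalComplex.mkHomFromSingle (𝟙 (X.X 0)) fun k hk =>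
      (X.isZero_of_isStrictlyLE 0 k (by simp at hk; lia)).eq_of_tgt _ _
  have hι : ι ≫ s = (HomologicalComplex.single C (ComplexShape.up ℤ) 0).map π := by
    apply HomologicalComplex.from_single_hom_ext
    rw [HomologicalComplex.comp_f, HomologicalComplex.single_map_f_self,
      HomologicalComplex.mkHomFromSingle_f, Category.comp_id, Category.assoc,
      Iso.hom_inv_id]
    exact congrArg _ (Category.comp_id _).symm
  have hg : ι ≫ g = 0 := by
    apply HomologicalComplex.from_single_hom_ext
    refine IsZero.eq_of_tgt ?_ _ _
    exact HomologicalComplex.isZero_single_obj_X (ComplexShape.up ℤ) _ _ _ (by simpa using hn)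
  refine ⟨X.X 0, π, epi_comp _ _, ?_⟩
  apply Ext.ext
  rw [← Ext.singleFunctor_map_comp_hom, Ext.zero_hom]
  have h1 : Q.map ((HomologicalComplex.single C (ComplexShape.up ℤ) 0).map π) ≫ f = 0 := by
    rw [← hι, hf, Functor.map_comp, Category.assoc, IsIso.hom_inv_id_assoc, ← Functor.map_comp, hg,
      Functor.map_zero]
  have h2 : Q.map ((HomologicalComplex.single C (ComplexShape.up ℤ) 0).map π) ≫ a = 0 := by
    rw [← cancel_mono e.inv, Category.assoc, CategoryTheory.Limits.zero_comp]
    exact h1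
  exact h2

/-- A criterion for the vanishing of `Ext¹(M, N)`: for every epimorphism to `M`, morphisms from
its kernel to `N` extend. -/
lemma CategoryTheory.Abelian.Ext.eq_zero_of_forall_exists_extension {M N : C}
    (h : ∀ (P : C) (π : P ⟶ M), Epi π → ∀ φ : kernel π ⟶ N, ∃ ψ : P ⟶ N, kernel.ι π ≫ ψ = φ)
    (α : Ext.{w} M N 1) : α = 0 := by
  obtain ⟨P, π, hπ, hα⟩ := Ext.exists_epi_mk₀_comp_eq_zero one_ne_zero α
  let S := ShortComplex.mk _ _ (kernel.condition π)
  have hS : S.ShortExact := { exact := ShortComplex.exact_kernel π }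
  obtain ⟨β, rfl⟩ := Ext.contravariant_sequence_exact₃ hS N α hα (n₀ := 0) rfl
  obtain ⟨φ, rfl⟩ := Ext.addEquiv₀.symm.surjective β
  obtain ⟨ψ, rfl⟩ := h P π hπ φ
  change hS.extClass.comp (Ext.mk₀ (S.f ≫ ψ)) _ = 0
  rw [← Ext.mk₀_comp_mk₀, ← Ext.comp_assoc_of_third_deg_zero, hS.extClass_comp, Ext.zero_comp]

end Effaceable

/-! ### Extending equivariant maps along permutation modules -/

section Permutation

variable {G : Type*} [Group G] [TopologicalSpace G]

/-- Every continuous `1`-cocycle of a subgroup of `G` with values in the module `N` is a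
coboundary. Cocycles are recorded as functions on `G`, and a cocycle is continuous if it vanishes
on a neighbourhood of `1`. -/
def HasTrivialH1 {N : Type*} [AddCommGroup N] (τ : G → N →+ N) : Prop :=
  ∀ (H : Subgroup G) (b : G → N), (∀ g ∈ H, ∀ h ∈ H, b (g * h) = b g + τ g (b h)) →
    ∀ U ∈ nhds (1 : G), (∀ h ∈ H, h ∈ U → b h = 0) → ∃ n : N, ∀ h ∈ H, b h = τ h n - n

lemma Module.Basis.addMonoidHom_ext {M N S : Type*} [AddCommGroup M] [AddCommGroup N]
    (b : Module.Basis S ℤ M) (f g : M →+ N) (h : ∀ s, f (b s) = g (b s)) (m : M) : f m = g m :=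
  LinearMap.congr_fun (b.ext h : f.toIntLinearMap = g.toIntLinearMap) m

/-- Let `π : P → M` be an equivariant surjection onto a permutation module. Equivariant maps from
the kernel of `π` to a module with trivial `H¹` extend to `P`: for a representative `s` of an orbit
and a lift `t` of the basis vector of `s`, the cocycle `h ↦ φ (h t - t)` on the stabilizer of `s`
is the coboundary of some `n`, and the extension maps `σ t` to `σ n`. -/
lemma exists_equivariant_extension {P M N S : Type*} [AddCommGroup P] [AddCommGroup M]
    [AddCommGroup N] [MulAction G S] (υ : G → P →+ P) (ρ : G → M →+ M) (τ : G → N →+ N)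
    (υmul : ∀ g h p, υ (g * h) p = υ g (υ h p)) (τmul : ∀ g h n, τ (g * h) n = τ g (τ h n))
    (hN : HasTrivialH1 τ)
    (hP : ∀ p : P, {g : G | υ g p = p} ∈ nhds (1 : G))
    (b : Module.Basis S ℤ M) (hb : ∀ g s, ρ g (b s) = b (g • s))
    (π : P →+ M) (hπ : Function.Surjective π) (hπe : ∀ g p, π (υ g p) = ρ g (π p))
    (φ : π.ker →+ N)
    (hφ : ∀ g (p p' : π.ker), υ g p.1 = p'.1 → φ p' = τ g (φ p)) :
    ∃ ψ : P →+ N, (∀ g p, ψ (υ g p) = τ g (ψ p)) ∧ ∀ p : π.ker, ψ p = φ p := by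
  -- the orbit representative of `s`, and an element moving it to `s`
  let r : S → S := fun s => (Quotient.mk (MulAction.orbitRel G S) s).out
  have hr : ∀ (g : G) (s : S), r (g • s) = r s := fun g s => by
    have : Quotient.mk (MulAction.orbitRel G S) (g • s) = Quotient.mk (MulAction.orbitRel G S) s :=
      Quotient.sound ⟨g, rfl⟩
    simp only [r, this]
  have hex : ∀ s, ∃ g : G, g • r s = s := fun s =>
    (MulAction.orbitRel G S).symm' (Quotient.mk_out (s := MulAction.orbitRel G S) s)
  choose γ hγ using hex
  choose t₀ ht₀ using fun s => hπ (b s)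
  let t : S → P := fun s => t₀ (r s)
  have ht : ∀ s, π (t s) = b (r s) := fun s => ht₀ _
  have hker : ∀ (s : S), ∀ h ∈ MulAction.stabilizer G (r s), υ h (t s) - t s ∈ π.ker := by
    intro s h hh
    rw [AddMonoidHom.mem_ker, map_sub, hπe, ht, hb, MulAction.mem_stabilizer_iff.1 hh, sub_self]
  have hcob : ∀ s : S, ∃ n : N, ∀ h, ∀ hh : h ∈ MulAction.stabilizer G (r s),
      φ ⟨_, hker s h hh⟩ = τ h n - n := by
    classical
    intro s
    let B : G → N := fun h =>
      if hh : h ∈ MulAction.stabilizer G (r s) then φ ⟨_, hker s h hh⟩ else 0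
    have hB : ∀ h, ∀ hh : h ∈ MulAction.stabilizer G (r s), B h = φ ⟨_, hker s h hh⟩ :=
      fun h hh => dif_pos hh
    obtain ⟨n, hn⟩ := hN (MulAction.stabilizer G (r s)) B (fun g hg h hh => by
      have hgh := mul_mem hg hh
      have hmem : υ g (υ h (t s) - t s) ∈ π.ker := by
        rw [AddMonoidHom.mem_ker, hπe, AddMonoidHom.mem_ker.1 (hker s h hh), map_zero]
      rw [hB _ hgh, hB _ hg, hB _ hh, ← hφ g ⟨_, hker s h hh⟩ ⟨_, hmem⟩ rfl, ← map_add]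
      congr 1
      apply Subtype.ext
      change υ (g * h) (t s) - t s = (υ g (t s) - t s) + υ g (υ h (t s) - t s)
      rw [υmul, map_sub]
      abel) _ (hP (t s)) (fun h hh hU => by
        rw [hB h hh, ← map_zero φ]
        congr 1
        apply Subtype.ext
        change υ h (t s) - t s = 0
        rw [show υ h (t s) = t s from hU, sub_self])
    exact ⟨n, fun h hh => by rw [← hB h hh, hn h hh]⟩
  choose n₀ hn₀ using hcob
  let n₁ : S → N := fun s => n₀ (r s)
  have hrr : ∀ s, r (r s) = r s := fun s => by
    have := hr (γ s) (r s)
    rw [hγ] at this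
    exact this.symm
  have ht₁ : ∀ s, t (r s) = t s := fun s => by simp only [t, hrr]
  have hn₁ : ∀ s, ∀ h ∈ MulAction.stabilizer G (r s), ∀ p : π.ker,
      υ h (t s) - t s = p.1 → φ p = τ h (n₁ s) - n₁ s := by
    intro s h hh p hp
    have hh' : h ∈ MulAction.stabilizer G (r (r s)) := by rwa [hrr]
    rw [← hn₀ (r s) h hh']
    refine congrArg φ (Subtype.ext ?_)
    change p.1 = υ h (t (r s)) - t (r s)
    rw [← hp, ht₁]
  let e : S → P := fun s => υ (γ s) (t s)
  let n : S → N := fun s => τ (γ s) (n₁ s)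
  have he : ∀ s, π (e s) = b s := fun s => by rw [hπe, ht, hb, hγ]
  have hen : ∀ g s, ∀ p : π.ker, υ g (e s) - e (g • s) = p.1 →
      φ p = τ g (n s) - n (g • s) := by
    intro g s p hp
    have htr : t (g • s) = t s := by simp only [t, hr]
    have hnr : n₁ (g • s) = n₁ s := by simp only [n₁, hr]
    obtain ⟨h, hgh⟩ : ∃ h, g * γ s = γ (g • s) * h := ⟨_, (mul_inv_cancel_left _ _).symm⟩
    have hh : h ∈ MulAction.stabilizer G (r s) := by
      have h1 := congrArg (· • r s) hgh
      simp only [mul_smul, hγ] at h1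
      have h2 := hγ (g • s)
      rw [hr] at h2
      exact smul_left_cancel _ (h1.symm.trans h2.symm)
    rw [hφ (γ (g • s)) ⟨_, hker s h hh⟩ p, hn₁ s h hh ⟨_, hker s h hh⟩ rfl]
    · change _ = τ g (τ (γ s) (n₁ s)) - τ (γ (g • s)) (n₁ (g • s))
      rw [hnr, ← τmul, hgh, τmul, map_sub]
    · change υ (γ (g • s)) (υ h (t s) - t s) = p.1
      rw [← hp]
      change _ = υ g (υ (γ s) (t s)) - υ (γ (g • s)) (t (g • s))
      rw [htr, ← υmul, hgh, υmul, map_sub]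
  let T : M →+ P := (b.constr ℤ e).toAddMonoidHom
  let ν : M →+ N := (b.constr ℤ n).toAddMonoidHom
  have hTb : ∀ s, T (b s) = e s := fun s => b.constr_basis ℤ e s
  have hνb : ∀ s, ν (b s) = n s := fun s => b.constr_basis ℤ n s
  have hT : ∀ m, π (T m) = m := b.addMonoidHom_ext (π.comp T) (AddMonoidHom.id M) fun s => by
    rw [AddMonoidHom.comp_apply, hTb, he, AddMonoidHom.id_apply]
  let Q : P →+ π.ker := (AddMonoidHom.id P - T.comp π).codRestrict _ fun p => by
    rw [AddMonoidHom.mem_ker, AddMonoidHom.sub_apply, map_sub, AddMonoidHom.comp_apply, hT,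
      AddMonoidHom.id_apply, sub_self]
  have hQ : ∀ p, (Q p).1 = p - T (π p) := fun _ => rfl
  let ψ : P →+ N := φ.comp Q + ν.comp π
  have hψ : ∀ p, ψ p = φ (Q p) + ν (π p) := fun _ => rfl
  have hψker : ∀ p : π.ker, ψ p = φ p := by
    intro p
    rw [hψ, AddMonoidHom.mem_ker.1 p.2, map_zero, add_zero]
    congr 1
    apply Subtype.ext
    rw [hQ, AddMonoidHom.mem_ker.1 p.2, map_zero, sub_zero]
  refine ⟨ψ, fun g p => ?_, hψker⟩
  have hψT : ∀ m, ψ (υ g (T m)) = τ g (ψ (T m)) :=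
    b.addMonoidHom_ext ((ψ.comp (υ g)).comp T) (((τ g).comp ψ).comp T) fun s => by
      simp only [AddMonoidHom.comp_apply]
      have h2 : Q (e s) = 0 := by
        apply Subtype.ext
        rw [hQ, he, hTb]
        exact sub_self _
      rw [hTb, hψ, hψ, h2, he, hπe, he, hb, hνb, hνb, map_zero, zero_add,
        hen g s (Q (υ g (e s))), sub_add_cancel]
      rw [hQ, hπe, he, hb, hTb]
  have hdec : p = (Q p).1 + T (π p) := by rw [hQ, sub_add_cancel]
  have hmem : υ g (Q p).1 ∈ π.ker := by
    rw [AddMonoidHom.mem_ker, hπe, AddMonoidHom.mem_ker.1 (Q p).2, map_zero]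
  rw [hdec, map_add, map_add, hψT, map_add, map_add, hψker, hψker ⟨_, hmem⟩,
    hφ g (Q p) ⟨_, hmem⟩ rfl]

end Permutation

namespace ElementaryObstruction

/-! ### Hilbert 90 -/

section Hilbert90

variable {k K : Type u} [Field k] [Field K] [Algebra k K] [Algebra.IsIntegral k K]

/-- Hilbert's Theorem 90: a continuous cocycle of a subgroup of the Galois group with values in
`K^×` is a coboundary. A cocycle that is trivial on the automorphisms fixing a finite subextension
`E` depends only on the restrictions to `E`; by Dedekind's lemma some sum `∑ b τ * τ x`, over the
embeddings `τ` of `E` induced by `H`, does not vanish, and its inverse trivializes the cocycle. -/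
lemma hilbert90 (H : Subgroup Gal(K/k)) (b : Gal(K/k) → Kˣ)
    (hb : ∀ g ∈ H, ∀ h ∈ H, b (g * h) = b g * Units.map (g : K →* K) (b h))
    (U : Set Gal(K/k)) (hU : U ∈ nhds 1) (hbU : ∀ h ∈ H, h ∈ U → b h = 1) :
    ∃ n : Kˣ, ∀ h ∈ H, b h = Units.map (h : K →* K) n / n := by
  classical
  obtain ⟨E, hfin, hE⟩ := (krullTopology_mem_nhds_one_iff k K U).1 hU
  have hone : b 1 = 1 := hbU 1 (one_mem H) (hE (one_mem _))
  let res : Gal(K/k) → (E →ₐ[k] K) := fun g => (g : K →ₐ[k] K).comp E.val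
  have hres : ∀ g ∈ H, ∀ h ∈ H, res g = res h → b g = b h := by
    intro g hg h hh e
    have h1 : h⁻¹ * g ∈ E.fixingSubgroup := by
      rw [IntermediateField.mem_fixingSubgroup_iff]
      intro x hx
      have : g x = h x := DFunLike.congr_fun e ⟨x, hx⟩
      rw [AlgEquiv.mul_apply, this]
      exact h.symm_apply_apply x
    have h2 : b (h⁻¹ * g) = 1 := hbU _ (mul_mem (inv_mem hh) hg) (hE h1)
    have h3 := hb h hh (h⁻¹ * g) (mul_mem (inv_mem hh) hg)
    rwa [mul_inv_cancel_left, h2, map_one, mul_one] at h3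
  let c : (E →ₐ[k] K) → K := fun τ => if h : ∃ g ∈ H, res g = τ then b h.choose else 0
  have hc : ∀ g ∈ H, c (res g) = b g := by
    intro g hg
    have h : ∃ g' ∈ H, res g' = res g := ⟨g, hg, rfl⟩
    simp only [c, dif_pos h]
    rw [hres _ h.choose_spec.1 g hg h.choose_spec.2]
  let comp : Gal(K/k) → (E →ₐ[k] K) → (E →ₐ[k] K) := fun g τ => (g : K →ₐ[k] K).comp τ
  have hcomp : ∀ h ∈ H, ∀ τ, c (comp h τ) = b h * h (c τ) := by
    intro h hh τ
    by_cases hτ : ∃ g ∈ H, res g = τ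
    · obtain ⟨g, hg, rfl⟩ := hτ
      have : comp h (res g) = res (h * g) := rfl
      rw [this, hc _ (mul_mem hh hg), hc g hg, hb h hh g hg]
      rfl
    · have hτ' : ¬ ∃ g ∈ H, res g = comp h τ := by
        rintro ⟨g, hg, e⟩
        refine hτ ⟨h⁻¹ * g, mul_mem (inv_mem hh) hg, ?_⟩
        ext x
        have : g x = h (τ x) := DFunLike.congr_fun e x
        change h⁻¹ (g x) = τ x
        rw [this]
        exact h.symm_apply_apply _
      simp only [c, dif_neg hτ, dif_neg hτ', map_zero, mul_zero]
  have hli := linearIndependent_toLinearMap k E K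
  obtain ⟨x, hx⟩ : ∃ x : E, ∑ τ : E →ₐ[k] K, c τ * τ x ≠ 0 := by
    by_contra! hzero
    have h0 : ∑ τ : E →ₐ[k] K, c τ • τ.toLinearMap = 0 := by
      ext x
      simpa using hzero x
    have := Fintype.linearIndependent_iff.1 hli c h0 (res 1)
    rw [hc 1 (one_mem H), hone] at this
    exact one_ne_zero this
  refine ⟨(Units.mk0 _ hx)⁻¹, fun h hh => ?_⟩
  have key : (b h : K) * h (∑ τ : E →ₐ[k] K, c τ * τ x) = ∑ τ : E →ₐ[k] K, c τ * τ x := by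
    rw [map_sum, Finset.mul_sum]
    have hbij : Function.Bijective (comp h) := by
      refine Function.bijective_iff_has_inverse.2 ⟨comp h⁻¹, fun τ => ?_, fun τ => ?_⟩
      · ext x; exact h.symm_apply_apply _
      · ext x; exact h.apply_symm_apply _
    refine Fintype.sum_bijective (comp h) hbij _ _ fun τ => ?_
    rw [hcomp h hh, map_mul, mul_assoc]
    rfl
  rw [map_inv, div_inv_eq_mul, eq_inv_mul_iff_mul_eq, mul_comm]
  ext
  exact key

/-- Hilbert's Theorem 90 in the form used for extending equivariant maps. -/
lemma hasTrivialH1_constMod : HasTrivialH1 fun g => ((constMod k K).obj.ρ g).toAddMonoidHom := by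
  intro H b hb U hU hbU
  obtain ⟨n, hn⟩ := hilbert90 H (fun g => (b g : Additive Kˣ).toMul) hb U hU hbU
  exact ⟨Additive.ofMul n, hn⟩

end Hilbert90

/-! ### Extensions of the divisor group by the constants -/

section Ext

lemma exists_hom_eq_of_exact {G : Type u} [Group G] {R : Type} [Ring R]
    {S : ShortComplex (Rep.{u} R G)} (h : S.Exact) (x : S.X₂) (hx : S.g.hom x = 0) :
    ∃ y, S.f.hom y = x := by
  rw [← ShortComplex.exact_map_iff_of_faithful _ (forget₂ (Rep.{u} R G) (ModuleCat.{u} R)),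
    ShortComplex.moduleCat_exact_iff] at h
  exact h x hx

/-- An additive equivariant map is a morphism of representations if it is linear. Over `ℤ` linearity
is automatic, but the `ℤ`-module structure of a representation is a field of the structure and not
by definition the canonical one. -/
lemma exists_hom_apply_eq {G : Type u} [Group G] {R : Type} [Ring R] {A B : Rep.{u} R G}
    (ψ : A →+ B) (hc : ∀ (c : R) x, ψ (c • x) = c • ψ x) (hψ : ∀ g x, ψ (A.ρ g x) = B.ρ g (ψ x)) :
    ∃ F : A ⟶ B, ∀ x, F.hom x = ψ x :=
  ⟨Rep.ofHom
    { toFun := ψ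
      map_add' := map_add ψ
      map_smul' := hc
      isIntertwining' := fun g => LinearMap.ext (hψ g) }, fun _ => rfl⟩

/-- `Ext¹(M, N) = 0` in the category of discrete modules if `M` is a permutation module and `N` has
trivial `H¹`. -/
lemma ext_one_eq_zero_of_basis {G : Type u} [Group G] [TopologicalSpace G] [IsTopologicalGroup G]
    {M : DiscMod G} {N : DiscMod G} (hN : HasTrivialH1 fun g => (N.obj.ρ g).toAddMonoidHom)
    {S : Type u} (b : Module.Basis S ℤ M.obj) (hb : ∀ (g : G) (s : S), ∃ s', M.obj.ρ g (b s) = b s')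
    (α : Abelian.Ext.{u + 1} M N 1) : α = 0 := by
  refine Abelian.Ext.eq_zero_of_forall_exists_extension (fun P π hπ φ => ?_) α
  choose a ha using hb
  have hinj : Function.Injective b := b.injective
  let _act : MulAction G S :=
    { smul := a
      one_smul := fun s => hinj (by
        change b (a 1 s) = b s
        rw [← ha, map_one]
        rfl)
      mul_smul := fun g h s => hinj (by
        change b (a (g * h) s) = b (a g (a h s))
        rw [← ha, ← ha, ← ha, map_mul]
        rfl) }
  have p1 : (isDiscrete G).ι.PreservesHomology :=
    { preservesKernels := fun _ _ f => (isDiscrete G).preservesKernels_ι f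
      preservesCokernels := fun _ _ f => (isDiscrete G).preservesCokernels_ι f }
  have hsurj : Function.Surjective π.hom.hom := by
    rw [← Rep.epi_iff_surjective]
    exact inferInstanceAs (Epi ((isDiscrete G).ι.map π))
  let κ : kernel π ⟶ P := kernel.ι π
  have hκ : κ ≫ π = 0 := kernel.condition π
  have hkinj : Function.Injective κ.hom.hom := by
    rw [← Rep.mono_iff_injective]
    exact inferInstanceAs (Mono ((isDiscrete G).ι.map (kernel.ι π)))
  have hex : ∀ x : P.obj, π.hom.hom x = 0 → ∃ y : (kernel π).obj, κ.hom.hom y = x := by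
    have h1 := (ShortComplex.exact_kernel π).map (isDiscrete G).ι
    exact exists_hom_eq_of_exact h1
  have hzero : ∀ y : (kernel π).obj, π.hom.hom (κ.hom.hom y) = 0 := fun y =>
    DFunLike.congr_fun (congrArg (fun f : kernel π ⟶ M => f.hom.hom) hκ) y
  let π' : P.obj →+ M.obj := AddMonoidHom.mk' (fun x => π.hom.hom x) (map_add π.hom.hom)
  let i : (kernel π).obj →+ π'.ker :=
    (AddMonoidHom.mk' (fun x => κ.hom.hom x) (map_add κ.hom.hom)).codRestrict _ hzero
  let e : (kernel π).obj ≃+ π'.ker := AddEquiv.ofBijective i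
    ⟨fun x y h => hkinj (congrArg Subtype.val h), fun x => by
      obtain ⟨y, hy⟩ := hex x.1 x.2
      exact ⟨y, Subtype.ext hy⟩⟩
  obtain ⟨ψ, hψ, hψφ⟩ := exists_equivariant_extension (fun g => (P.obj.ρ g).toAddMonoidHom)
    (fun g => (M.obj.ρ g).toAddMonoidHom) (fun g => (N.obj.ρ g).toAddMonoidHom)
    (fun g h p => by rw [map_mul]; rfl) (fun g h p => by rw [map_mul]; rfl) hN
    (fun p => (P.property p).mem_nhds (by simp)) b ha π' hsurj
    (fun g p => Rep.hom_comm_apply π.hom g p)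
    ((AddMonoidHom.mk' (fun x => φ.hom.hom x) (map_add φ.hom.hom)).comp e.symm.toAddMonoidHom)
    (fun g p p' h => by
      obtain ⟨x, rfl⟩ := e.surjective p
      obtain ⟨x', rfl⟩ := e.surjective p'
      have hx : (kernel π).obj.ρ g x = x' := by
        apply hkinj
        rw [Rep.hom_comm_apply]
        exact h
      change φ.hom.hom (e.symm (e x')) = N.obj.ρ g (φ.hom.hom (e.symm (e x)))
      rw [e.symm_apply_apply, e.symm_apply_apply, ← hx]
      exact Rep.hom_comm_apply φ.hom g x)
  obtain ⟨F, hF⟩ := exists_hom_apply_eq ψ (fun c x =>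
    (congrArg ψ (int_smul_eq_zsmul P.obj.hV2 c x)).trans ((map_zsmul ψ c x).trans
      (int_smul_eq_zsmul N.obj.hV2 c _).symm)) hψ
  refine ⟨ObjectProperty.homMk F, ?_⟩
  apply ObjectProperty.hom_ext
  apply Rep.hom_ext
  refine DFunLike.ext _ _ fun x => ?_
  have := hψφ (e x)
  change _ = φ.hom.hom (e.symm (e x)) at this
  rw [e.symm_apply_apply] at this
  exact (hF _).trans this

variable {k : Type u} [Field k] (K : Type u) [Field K] [Algebra k K] [Algebra.IsIntegral k K]
variable {X : Scheme.{u}} (f : X ⟶ Spec (.of k)) [GeometricallyIntegral f] [Smooth f]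
  [QuasiCompact f]

/-- `Ext¹(Div, K^×) = 0`, since the group of divisors is a permutation module. -/
lemma ext_one_divMod_eq_zero (α : Abelian.Ext.{u + 1} (divMod K f) (constMod k K) 1) : α = 0 := by
  obtain ⟨S, b, hb⟩ := exists_basis_div_permuted K f
  exact ext_one_eq_zero_of_basis hasTrivialH1_constMod (M := divMod K f) b hb α

/-- The connecting homomorphism `Ext¹(K(X)^× / K^×, K^×) ⟶ Ext²(Pic, K^×)` is injective. -/
lemma connecting_injective (h : OnlyConstantUnits K f) : Function.Injective (connecting K f h) := by
  rw [injective_iff_map_eq_zero]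
  intro α hα
  obtain ⟨β, rfl⟩ := Abelian.Ext.contravariant_sequence_exact₁ (divSeq_shortExact K f h)
    (constMod k K) α (show 1 + 1 = 2 from rfl) hα
  rw [show β = 0 from ext_one_divMod_eq_zero K f β]
  exact Abelian.Ext.comp_zero ..

end Ext

end ElementaryObstruction
end

noncomputable section

/-! ### Invertible functions on products -/

section TensorProduct

open TensorProduct

/-- An element of `A ⊗ B` vanishes if all its specializations at `K`-rational points of the smooth
algebra `A` do: expand it in a basis of `B`, the coefficients vanish at all rational points of `A`,
and these are dense. -/
lemma RingHom.IsStandardSmooth.tensorProduct_eq_zero {K A B : Type u} [Field K] [IsSepClosed K]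
    [CommRing A] [IsReduced A] [CommRing B] [Algebra K A] [Algebra K B]
    (hA : (algebraMap K A).IsStandardSmooth) (w : A ⊗[K] B)
    (h : ∀ φ : A →ₐ[K] K, Algebra.TensorProduct.lift ((Algebra.ofId K B).comp φ) (AlgHom.id K B)
      (fun _ _ => Commute.all _ _) w = 0) : w = 0 := by
  let b := Module.Free.chooseBasis K B
  let b' := Algebra.TensorProduct.basis A b
  refine b'.ext_elem fun i => ?_
  rw [map_zero, Finsupp.zero_apply]
  by_contra hi
  obtain ⟨φ, hφ, hφi⟩ := hA.exists_ringHom_ne_zero (mt IsNilpotent.eq_zero hi)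
  let φ' : A →ₐ[K] K := { φ with commutes' := fun c => DFunLike.congr_fun hφ c }
  refine hφi ?_
  have key : ∀ v : A ⊗[K] B, b.repr (Algebra.TensorProduct.lift ((Algebra.ofId K B).comp φ')
      (AlgHom.id K B) (fun _ _ => Commute.all _ _) v) i = φ' (b'.repr v i) := by
    intro v
    induction v with
    | zero => simp
    | add x y hx hy => simp only [map_add, Finsupp.add_apply, hx, hy]
    | tmul x y =>
      rw [Algebra.TensorProduct.lift_tmul, Algebra.TensorProduct.basis_repr_tmul]
      have : ((Algebra.ofId K B).comp φ') x * (AlgHom.id K B) y = φ' x • y := by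
        rw [Algebra.smul_def]; rfl
      rw [this, map_smul, Finsupp.smul_apply, Finsupp.smul_apply, Finsupp.mapRange_apply,
        smul_eq_mul, smul_eq_mul, map_mul, AlgHom.commutes]
      rfl
  have := key w
  rw [h, map_zero] at this
  exact this.symm

/-- The criterion for the vanishing of an element of `A ⊗ B`, for an arbitrary pushout. -/
lemma CategoryTheory.IsPushout.eq_zero_of_isStandardSmooth {K : Type u} [Field K] [IsSepClosed K]
    {A B C : CommRingCat.{u}} {i : .of K ⟶ A} {j : .of K ⟶ B} {a : A ⟶ C} {b : B ⟶ C}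
    (hp : IsPushout i j a b) [IsReduced A] (hi : i.hom.IsStandardSmooth) (w : C)
    (h : ∀ φ : A ⟶ .of K, i ≫ φ = 𝟙 _ →
      ∃ ψ : C ⟶ B, a ≫ ψ = φ ≫ j ∧ b ≫ ψ = 𝟙 _ ∧ ψ w = 0) : w = 0 := by
  let := i.hom.toAlgebra
  let := j.hom.toAlgebra
  have ht := CommRingCat.isPushout_tensorProduct K A B
  let e : CommRingCat.of (A ⊗[K] B) ≅ C := ht.isoIsPushout _ _ hp
  have he1 : CommRingCat.ofHom Algebra.TensorProduct.includeLeftRingHom ≫ e.hom = a :=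
    ht.inl_isoIsPushout_hom _ _ hp
  have he2 : CommRingCat.ofHom Algebra.TensorProduct.includeRight.toRingHom ≫ e.hom = b :=
    ht.inr_isoIsPushout_hom _ _ hp
  have hw : e.inv w = 0 := by
    refine RingHom.IsStandardSmooth.tensorProduct_eq_zero (K := K) (A := A) (B := B) hi _
      fun φ => ?_
    obtain ⟨ψ, h1, h2, h3⟩ := h (CommRingCat.ofHom φ.toRingHom) (by
      ext c
      exact φ.commutes c)
    let ψ' : CommRingCat.of (A ⊗[K] B) ⟶ B := CommRingCat.ofHom
      (Algebra.TensorProduct.lift ((Algebra.ofId K B).comp φ) (AlgHom.id K B)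
        (fun _ _ => Commute.all _ _)).toRingHom
    have : e.hom ≫ ψ = ψ' := by
      apply ht.hom_ext
      · rw [← Category.assoc, he1, h1]
        ext x
        simp [ψ']
        rfl
      · rw [← Category.assoc, he2, h2]
        ext x
        simp [ψ']
    change ψ' (e.inv w) = 0
    rw [← this, ← h3]
    exact congrArg ψ congr($(e.inv_hom_id) w)
  have := congr($(e.inv_hom_id) w)
  change e.hom (e.inv w) = w at this
  rw [← this, hw, map_zero]

end TensorProduct

namespace AlgebraicGeometry

variable {K : Type u} [Field K] {X Y P : Scheme.{u}}

/-- A rational point of an affine open set, from a homomorphism on functions. -/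
lemma IsAffineOpen.exists_rational_point (s : X ⟶ Spec (.of K)) {U : X.Opens} (hU : IsAffineOpen U)
    (φ : Γ(X, U) ⟶ .of K) (hφ : ((Scheme.ΓSpecIso (.of K)).inv ≫ s.appLE ⊤ U le_top) ≫ φ = 𝟙 _) :
    ∃ x : Spec (.of K) ⟶ X, x ≫ s = 𝟙 _ ∧ ∃ h : ⊤ ≤ x ⁻¹ᵁ U,
      x.appLE U ⊤ h = φ ≫ (Scheme.ΓSpecIso (.of K)).inv := by
  have hle : ⊤ ≤ (Spec.map φ ≫ hU.fromSpec) ⁻¹ᵁ U := by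
    rw [Scheme.Hom.comp_preimage, hU.fromSpec_preimage_self]
    rfl
  have htop : hU.fromSpec.appLE U ⊤ hU.fromSpec_preimage_self.ge =
      (Scheme.ΓSpecIso Γ(X, U)).inv := by
    rw [Scheme.Hom.appLE, hU.fromSpec_app_self, Category.assoc, ← Functor.map_comp]
    exact (congrArg _ ((Spec Γ(X, U)).presheaf.map_id _)).trans (Category.comp_id _)
  have key : (Spec.map φ ≫ hU.fromSpec).appLE U ⊤ hle = φ ≫ (Scheme.ΓSpecIso (.of K)).inv := by
    refine (Scheme.Hom.appLE_comp_appLE (Spec.map φ) hU.fromSpec U ⊤ ⊤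
      hU.fromSpec_preimage_self.ge le_top).symm.trans ?_
    rw [htop, Scheme.ΓSpecIso_inv_naturality]
    congr 1
  refine ⟨Spec.map φ ≫ hU.fromSpec, ?_, hle, key⟩
  apply ext_of_isAffine
  have h1 : s.appLE ⊤ U le_top ≫ φ = (Scheme.ΓSpecIso (.of K)).hom := by
    rw [← Category.comp_id (Scheme.ΓSpecIso (.of K)).hom, ← hφ, Category.assoc,
      Iso.hom_inv_id_assoc]
  have h2 : ((Spec.map φ ≫ hU.fromSpec) ≫ s).appTop =
      s.appLE ⊤ U le_top ≫ (Spec.map φ ≫ hU.fromSpec).appLE U ⊤ hle :=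
    (Scheme.Hom.app_eq_appLE _).trans
      (Scheme.Hom.appLE_comp_appLE (Spec.map φ ≫ hU.fromSpec) s ⊤ U ⊤ le_top hle).symm
  rw [h2, key, ← Category.assoc, h1, Iso.hom_inv_id]
  rfl

/-- A nonempty smooth scheme over a separably closed field has a rational point. -/
lemma exists_rational_point_of_smooth [IsSepClosed K] (s : X ⟶ Spec (.of K)) [Smooth s]
    [Nonempty X] : ∃ x : Spec (.of K) ⟶ X, x ≫ s = 𝟙 _ := by
  obtain ⟨U, hU, hx, hs⟩ := ElementaryObstruction.exists_isStandardSmooth_of_smooth s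
    (Classical.arbitrary X)
  have : Nonempty U := ⟨⟨_, hx⟩⟩
  have : Nontrivial Γ(X, U) := inferInstance
  obtain ⟨φ, hφ, -⟩ := hs.exists_ringHom_ne_zero (a := 1) not_isNilpotent_one
  obtain ⟨x, hx, -⟩ := hU.exists_rational_point s (CommRingCat.ofHom φ) (CommRingCat.hom_ext hφ)
  exact ⟨x, hx⟩

variable {s : X ⟶ Spec (.of K)} {t : Y ⟶ Spec (.of K)} {q₁ : P ⟶ X} {q₂ : P ⟶ Y}

/-- A function on the product `P` of `X` and `Y` over a separably closed field vanishes if its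
restrictions to the fibres `{x} × Y` over the rational points `x` of `X` do. -/
lemma eq_zero_of_forall_fibre [IsSepClosed K] [Smooth s] [IsIntegral X] [Nonempty Y]
    [IsIntegral P] (h : IsPullback q₁ q₂ s t) (v : Γ(P, ⊤))
    (hv : ∀ (x : Spec (.of K) ⟶ X) (hx : x ≫ s = 𝟙 _),
      (h.lift (t ≫ x) (𝟙 Y) (by simp [hx])).appTop v = 0) : v = 0 := by
  obtain ⟨U, hU, hxU, hs⟩ := ElementaryObstruction.exists_isStandardSmooth_of_smooth s
    (Classical.arbitrary X)
  obtain ⟨_, ⟨V, hV, rfl⟩, hyV, -⟩ := Y.isBasis_affineOpens.exists_subset_of_mem_open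
    (Set.mem_univ (Classical.arbitrary Y)) isOpen_univ
  have : Nonempty U := ⟨⟨_, hxU⟩⟩
  let W : P.Opens := q₁ ⁻¹ᵁ U ⊓ q₂ ⁻¹ᵁ V
  have hWU : W ≤ q₁ ⁻¹ᵁ U := inf_le_left
  have hWV : W ≤ q₂ ⁻¹ᵁ V := inf_le_right
  have hp := (isIso_pushoutSection_iff h (US := ⊤) (UT := V) (UX := U) (UY := W)
    le_top le_top rfl).1 (isIso_pushoutSection_of_isAffineOpen _ _ _ _ (isAffineOpen_top _) hV hU)
  have hp' : IsPushout ((Scheme.ΓSpecIso (.of K)).inv ≫ s.appLE ⊤ U le_top)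
      ((Scheme.ΓSpecIso (.of K)).inv ≫ t.appLE ⊤ V le_top) (q₁.appLE U W hWU)
      (q₂.appLE V W hWV) :=
    hp.of_iso (Scheme.ΓSpecIso (.of K)) (.refl _) (.refl _) (.refl _) (by simp) (by simp)
      (by simp) (by simp)
  -- The fibre over the rational point given by `φ`, with its open set `V`.
  have hfib : ∀ φ : Γ(X, U) ⟶ .of K,
      ((Scheme.ΓSpecIso (.of K)).inv ≫ s.appLE ⊤ U le_top) ≫ φ = 𝟙 _ →
      ∃ (x : Spec (.of K) ⟶ X) (hx : x ≫ s = 𝟙 _)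
        (hVW : V ≤ (h.lift (t ≫ x) (𝟙 Y) (by simp [hx])) ⁻¹ᵁ W),
        q₁.appLE U W hWU ≫ (h.lift (t ≫ x) (𝟙 Y) (by simp [hx])).appLE W V hVW =
          φ ≫ (Scheme.ΓSpecIso (.of K)).inv ≫ t.appLE ⊤ V le_top := by
    intro φ hφ
    obtain ⟨x, hx, hle, hxφ⟩ := hU.exists_rational_point s φ hφ
    let j : Y ⟶ P := h.lift (t ≫ x) (𝟙 Y) (by simp [hx])
    have hj₁ : j ≫ q₁ = t ≫ x := h.lift_fst _ _ _
    have hj₂ : j ≫ q₂ = 𝟙 Y := h.lift_snd _ _ _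
    have hV₁ : V ≤ (j ≫ q₁) ⁻¹ᵁ U := by
      rw [hj₁]
      exact fun y _ => hle trivial
    have hV₂ : V ≤ (j ≫ q₂) ⁻¹ᵁ V := by
      rw [hj₂]
      rfl
    have hVW : V ≤ j ⁻¹ᵁ W := fun y hy => ⟨hV₁ hy, hV₂ hy⟩
    refine ⟨x, hx, hVW, (Scheme.Hom.appLE_comp_appLE j q₁ U W V hWU hVW).trans ?_⟩
    rw [← Category.assoc, ← hxφ]
    refine Eq.trans ?_ (Scheme.Hom.appLE_comp_appLE t x U ⊤ V hle le_top).symm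
    simp only [hj₁]
  have : Nonempty W := by
    have : Nontrivial Γ(X, U) := inferInstance
    obtain ⟨φ, hφ, -⟩ := hs.exists_ringHom_ne_zero (a := 1) not_isNilpotent_one
    obtain ⟨x, hx, hVW, -⟩ := hfib (CommRingCat.ofHom φ) (CommRingCat.hom_ext hφ)
    exact ⟨⟨_, hVW hyV⟩⟩
  apply map_injective_of_isIntegral P (homOfLE (le_top : W ≤ ⊤))
  rw [map_zero]
  have : _root_.IsReduced Γ(X, U) := inferInstance
  refine hp'.eq_zero_of_isStandardSmooth hs _ fun φ hφ => ?_
  obtain ⟨x, hx, hVW, hq⟩ := hfib φ hφ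
  refine ⟨_, hq, ?_, ?_⟩
  · rw [Scheme.Hom.appLE_comp_appLE]
    simp only [h.lift_snd]
    exact (Category.id_comp _).trans (Y.presheaf.map_id _)
  · have key : P.presheaf.map (homOfLE (le_top : W ≤ ⊤)).op ≫
        (h.lift (t ≫ x) (𝟙 Y) (by simp [hx])).appLE W V hVW =
        (h.lift (t ≫ x) (𝟙 Y) (by simp [hx])).appTop ≫
          Y.presheaf.map (homOfLE (le_top : V ≤ ⊤)).op := by
      rw [Scheme.Hom.map_appLE]
      rfl
    have := congr($(key) v)
    simp only [CommRingCat.comp_apply] at this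
    rw [this, hv x hx, map_zero]

/-- If all invertible functions on `X` and `Y` are constant, so are those on the product. -/
lemma exists_eq_const_of_isUnit [IsSepClosed K] [Smooth s] [Smooth t] [IsIntegral X] [IsIntegral Y]
    [IsIntegral P] (h : IsPullback q₁ q₂ s t)
    (hX : ∀ a : Γ(X, ⊤), IsUnit a → ∃ c, a = s.appTop c)
    (hY : ∀ a : Γ(Y, ⊤), IsUnit a → ∃ c, a = t.appTop c) (u : Γ(P, ⊤)) (hu : IsUnit u) :
    ∃ c, u = (q₁ ≫ s).appTop c := by
  obtain ⟨y, hy⟩ := exists_rational_point_of_smooth t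
  -- The value of `u` on the fibre `X × {y}`.
  obtain ⟨d, hd⟩ := hX _ (hu.map (h.lift (𝟙 X) (s ≫ y) (by simp [hy])).appTop.hom)
  refine ⟨d, sub_eq_zero.1 (eq_zero_of_forall_fibre h _ fun x hx => ?_)⟩
  obtain ⟨c, hc⟩ := hY _ (hu.map (h.lift (t ≫ x) (𝟙 Y) (by simp [hx])).appTop.hom)
  have hcd : c = d := by
    have e : y ≫ h.lift (t ≫ x) (𝟙 Y) (by simp [hx]) =
        x ≫ h.lift (𝟙 X) (s ≫ y) (by simp [hy]) := by
      apply h.hom_ext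
      · simp only [Category.assoc, h.lift_fst, Category.comp_id]
        rw [← Category.assoc, hy, Category.id_comp]
      · simp only [Category.assoc, h.lift_snd, Category.comp_id]
        rw [← Category.assoc, hx, Category.id_comp]
    have e1 := congr(($e).appTop u)
    have e2 : y.appTop (t.appTop c) = x.appTop (s.appTop d) := by
      rw [← hc, ← hd]
      exact e1
    have e3 : y.appTop (t.appTop c) = c := congr(($hy).appTop c)
    have e4 : x.appTop (s.appTop d) = d := congr(($hx).appTop d)
    rw [← e3, e2, e4]
  rw [map_sub, sub_eq_zero]
  refine hc.trans ?_
  rw [hcd, h.w]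
  have e : h.lift (t ≫ x) (𝟙 Y) (by simp [hx]) ≫ q₂ ≫ t = t := by
    rw [h.lift_snd_assoc, Category.id_comp]
  exact congr(($e.symm).appTop d)

end AlgebraicGeometry

namespace ElementaryObstruction

variable {k : Type u} [Field k] (K : Type u) [Field K] [Algebra k K]
variable {X Y : Scheme.{u}} (f : X ⟶ Spec (.of k)) (g : Y ⟶ Spec (.of k))

lemma exists_eq_appTop_of_isUnit {f : X ⟶ Spec (.of k)} (h : OnlyConstantUnits K f)
    (a : Γ(geom K f, ⊤)) (ha : IsUnit a) : ∃ c, a = (geomStr K f).appTop c := by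
  obtain ⟨c, hc⟩ := h ha.unit
  exact ⟨(Scheme.ΓSpecIso (.of K)).inv c.1, congrArg Units.val hc.symm⟩

/-- The base change of the product is the product of the base changes. -/
lemma geom_prodMor_isPullback :
    IsPullback (geomMap K (prodMor f g) f (pullback.fst f g) (fst_prodMor f g))
      (geomMap K (prodMor f g) g (pullback.snd f g) (snd_prodMor f g))
      (geomStr K f) (geomStr K g) := by
  have h := (geomMap_isPullback K (prodMor f g) f (pullback.fst f g)
    (fst_prodMor f g)).flip.paste_vert (IsPullback.of_hasPullback f g)
  rw [← geomMap_toBase K (prodMor f g) g (pullback.snd f g) (snd_prodMor f g),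
    (geom_isPullback K f).w] at h
  exact IsPullback.of_bot h (by rw [geomMap_str, geomMap_str]) (geom_isPullback K g).flip

instance prodMor_smooth [Smooth f] [Smooth g] : Smooth (prodMor f g) :=
  inferInstanceAs (Smooth (pullback.fst f g ≫ f))

lemma onlyConstantUnits_prodMor [IsSepClosed K] [Smooth f] [Smooth g] [GeometricallyIntegral f]
    [GeometricallyIntegral g] (hX : OnlyConstantUnits K f) (hY : OnlyConstantUnits K g) :
    OnlyConstantUnits K (prodMor f g) := by
  intro u
  obtain ⟨c, hc⟩ := exists_eq_const_of_isUnit (geom_prodMor_isPullback K f g)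
    (exists_eq_appTop_of_isUnit K hX) (exists_eq_appTop_of_isUnit K hY) u.1 u.isUnit
  have hc' : u.1 = const K (prodMor f g) ((Scheme.ΓSpecIso (.of K)).hom c) := by
    rw [hc, geomMap_str]
    exact congrArg _ congr($((Scheme.ΓSpecIso (.of K)).hom_inv_id) c).symm
  have hne : (Scheme.ΓSpecIso (.of K)).hom c ≠ 0 := by
    intro h0
    rw [h0, map_zero] at hc'
    exact u.ne_zero hc'
  exact ⟨Units.mk0 _ hne, Units.ext hc'.symm⟩

end ElementaryObstruction
end

noncomputable section

namespace ElementaryObstruction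

/-! ### Functoriality of the obstruction classes -/

section Naturality

open Abelian

lemma Ext.mk₀_comp_injective {C : Type*} [Category C] [Abelian C] [HasExt C] {M M' N : C}
    (φ : M ⟶ M') [IsIso φ] (n : ℕ) :
    Function.Injective fun α : Abelian.Ext M' N n => (Ext.mk₀ φ).comp α (zero_add n) := by
  intro α β h
  have := congrArg (fun γ : Abelian.Ext M N n => (Ext.mk₀ (inv φ)).comp γ (zero_add n)) h
  simpa using this

/-- The connecting homomorphisms of `Ext` are natural in the short exact sequence. -/
lemma Ext.mk₀_comp_extClass_comp {C : Type*} [Category C] [Abelian C] [HasExt C]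
    {S₁ S₂ : ShortComplex C} (h₁ : S₁.ShortExact) (h₂ : S₂.ShortExact) (φ : S₁ ⟶ S₂) {N : C}
    (α : Abelian.Ext S₂.X₁ N 1) :
    (Ext.mk₀ φ.τ₃).comp (h₂.extClass.comp α (show 1 + 1 = 2 from rfl)) (zero_add 2) =
      h₁.extClass.comp ((Ext.mk₀ φ.τ₁).comp α (zero_add 1)) (show 1 + 1 = 2 from rfl) := by
  rw [← Ext.comp_assoc _ _ _ (zero_add 1) (show 1 + 1 = 2 from rfl) (by omega),
    ← Ext.comp_assoc _ _ _ (add_zero 1) (zero_add 1) (by omega), h₁.extClass_naturality h₂ φ]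

variable {k : Type u} [Field k] (K : Type u) [Field K] [Algebra k K] [Algebra.IsIntegral k K]
variable {X Y : Scheme.{u}} (f : X ⟶ Spec (.of k)) (g : Y ⟶ Spec (.of k)) (p : X ⟶ Y)
  (hp : p ≫ g = f) [GeometricallyIntegral f] [GeometricallyIntegral g] [Surjective p]

/-- Pullback of rational functions along a surjective morphism, as a morphism of Galois modules. -/
def ratPull : ratMod K g ⟶ ratMod K f :=
  have := geomMap_isDominant K f g p hp
  DiscMod.ofHom (ratMap (geomMap K f g p hp)) fun σ φ =>
    have : IsDominant (galAct K f σ ≫ geomMap K f g p hp) := inferInstance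
    (ratMap_eq_comp _ _ _ (galAct_geomMap K f g p hp σ) φ).symm.trans
      (ratMap_eq_comp _ _ _ rfl φ)

/-- Pullback along `p : X ⟶ Y`, as a morphism from the sequence
`1 ⟶ K^× ⟶ K(Y)^× ⟶ K(Y)^× / K^× ⟶ 1` to the corresponding sequence of `X`. -/
def ratSeqPull : ratSeq K g ⟶ ratSeq K f where
  τ₁ := 𝟙 (constMod k K)
  τ₂ := ratPull K f g p hp
  τ₃ := ratQuotPull K f g p hp
  comm₁₂ := by
    have := geomMap_isDominant K f g p hp
    ext c
    exact (ratMap_geomMap_const K f g p hp c.toMul).symm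
  comm₂₃ := by
    ext φ
    rfl

/-- The elementary obstruction of `X` pulls back to that of `Y` along
`K(Y)^× / K^× ⟶ K(X)^× / K^×`. -/
lemma ratQuotPull_comp_ob :
    (Ext.mk₀ (ratQuotPull K f g p hp)).comp (ob K f) (zero_add 1) = ob K g := by
  have := (ratSeq_shortExact K g).extClass_naturality (ratSeq_shortExact K f)
    (ratSeqPull K f g p hp)
  exact this.symm.trans (Ext.comp_mk₀_id _)

variable [QuasiCompact f] [QuasiCompact g]

/-- Pullback of divisors along a surjective morphism, as a morphism of Galois modules. -/
def divPull : divMod K g ⟶ divMod K f :=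
  have := geomMap_isDominant K f g p hp
  DiscMod.ofHom (CartierDiv.map (geomMap K f g p hp)) fun σ D =>
    have : IsDominant (galAct K f σ ≫ geomMap K f g p hp) := inferInstance
    (CartierDiv.map_eq_comp _ _ _ (galAct_geomMap K f g p hp σ) D).symm.trans
      (CartierDiv.map_eq_comp _ _ _ rfl D)

/-- Pullback along `p : X ⟶ Y`, as a morphism from the sequence
`1 ⟶ K(Y)^× / K^× ⟶ Div(Y_K) ⟶ Pic(Y_K) ⟶ 1` to the corresponding sequence of `X`. -/
def divSeqPull : divSeq K g ⟶ divSeq K f where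
  τ₁ := ratQuotPull K f g p hp
  τ₂ := divPull K f g p hp
  τ₃ := picPull K f g p hp
  comm₁₂ := by
    have := geomMap_isDominant K f g p hp
    ext φ
    obtain ⟨φ, rfl⟩ := QuotientGroup.mk_surjective φ.toMul
    rfl
  comm₂₃ := by
    have := geomMap_isDominant K f g p hp
    ext D
    exact divToPic_map (geomMap K f g p hp) D.toMul

/-- The connecting homomorphisms are compatible with pullback. -/
lemma picPull_comp_connecting (hf : OnlyConstantUnits K f) (hg : OnlyConstantUnits K g)
    (α : Abelian.Ext.{u + 1} (ratQuotMod K f) (constMod k K) 1) :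
    (Ext.mk₀ (picPull K f g p hp)).comp (connecting K f hf α) (zero_add 2) =
      connecting K g hg ((Ext.mk₀ (ratQuotPull K f g p hp)).comp α (zero_add 1)) :=
  Ext.mk₀_comp_extClass_comp (divSeq_shortExact K g hg) (divSeq_shortExact K f hf)
    (divSeqPull K f g p hp) α

end Naturality

section Products

variable {k : Type u} [Field k] (K : Type u) [Field K] [Algebra k K] [Algebra.IsIntegral k K]
variable {X Y : Scheme.{u}} (f : X ⟶ Spec (.of k)) (g : Y ⟶ Spec (.of k))
  [GeometricallyIntegral f] [GeometricallyIntegral g]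
  [LocallyOfFiniteType f] [LocallyOfFiniteType g]

lemma piStar_apply (α : Abelian.Ext.{u + 1} (ratQuotMod K (prodMor f g)) (constMod k K) 1) :
    piStar K f g α =
      ((Abelian.Ext.mk₀ (ratQuotPull K (prodMor f g) f (pullback.fst f g) (fst_prodMor f g))).comp α
        (zero_add 1),
      (Abelian.Ext.mk₀ (ratQuotPull K (prodMor f g) g (pullback.snd f g) (snd_prodMor f g))).comp α
        (zero_add 1)) := by
  change Abelian.Ext.biprodAddEquiv ((Abelian.Ext.mk₀ (piMor K f g)).comp α (zero_add 1)) = _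
  ext <;> simp [piMor]

lemma piStar_ob : piStar K f g (ob K (prodMor f g)) = (ob K f, ob K g) := by
  rw [piStar_apply, ratQuotPull_comp_ob, ratQuotPull_comp_ob]

lemma piStar_injective [IsIso (piMor K f g)] : Function.Injective (piStar K f g) :=
  Abelian.Ext.biprodAddEquiv.injective.comp (Ext.mk₀_comp_injective (piMor K f g) 1)

lemma ob_prodMor_eq_zero_iff [IsIso (piMor K f g)] :
    ob K (prodMor f g) = 0 ↔ ob K f = 0 ∧ ob K g = 0 := by
  rw [← map_eq_zero_iff _ (piStar_injective K f g), piStar_ob, Prod.mk_eq_zero]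

variable [QuasiCompact f] [QuasiCompact g]

lemma psiStar_apply (α : Abelian.Ext.{u + 1} (picMod K (prodMor f g)) (constMod k K) 2) :
    psiStar K f g α =
      ((Abelian.Ext.mk₀ (picPull K (prodMor f g) f (pullback.fst f g) (fst_prodMor f g))).comp α
        (zero_add 2),
      (Abelian.Ext.mk₀ (picPull K (prodMor f g) g (pullback.snd f g) (snd_prodMor f g))).comp α
        (zero_add 2)) := by
  change Abelian.Ext.biprodAddEquiv ((Abelian.Ext.mk₀ (psiMor K f g)).comp α (zero_add 2)) = _
  ext <;> simp [psiMor]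

variable (hX : OnlyConstantUnits K f) (hY : OnlyConstantUnits K g)
  (hXY : OnlyConstantUnits K (prodMor f g))

lemma psiStar_connecting
    (α : Abelian.Ext.{u + 1} (ratQuotMod K (prodMor f g)) (constMod k K) 1) :
    psiStar K f g (connecting K (prodMor f g) hXY α) =
      (connecting K f hX (piStar K f g α).1, connecting K g hY (piStar K f g α).2) := by
  rw [psiStar_apply, picPull_comp_connecting K _ _ _ _ hXY hX,
    picPull_comp_connecting K _ _ _ _ hXY hY, piStar_apply]

lemma psiStar_elemClass :
    psiStar K f g (elemClass K (prodMor f g) hXY) = (elemClass K f hX, elemClass K g hY) := by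
  refine (psiStar_connecting K f g hX hY hXY (ob K (prodMor f g))).trans ?_
  rw [piStar_ob]
  rfl

lemma psiStar_injective [IsIso (psiMor K f g)] : Function.Injective (psiStar K f g) :=
  Abelian.Ext.biprodAddEquiv.injective.comp (Ext.mk₀_comp_injective (psiMor K f g) 2)

lemma elemClass_prodMor_eq_zero_iff [IsIso (psiMor K f g)] :
    elemClass K (prodMor f g) hXY = 0 ↔ elemClass K f hX = 0 ∧ elemClass K g hY = 0 := by
  rw [← map_eq_zero_iff _ (psiStar_injective K f g), psiStar_elemClass K f g hX hY hXY,
    Prod.mk_eq_zero]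

end Products

/-- By injectivity of the connecting homomorphism, `e(X)` and `ob(X)` vanish simultaneously. -/
lemma elemClass_eq_zero_iff {k : Type u} [Field k] (K : Type u) [Field K] [Algebra k K]
    [Algebra.IsIntegral k K] {X : Scheme.{u}} (f : X ⟶ Spec (.of k)) [GeometricallyIntegral f]
    [Smooth f] [QuasiCompact f] (h : OnlyConstantUnits K f) :
    elemClass K f h = 0 ↔ ob K f = 0 :=
  map_eq_zero_iff (connecting K f h) (connecting_injective K f h)

end ElementaryObstruction
end

theorem theorem2p1 {k K : Type u} [Field k] [Field K] [Algebra k K] [IsSepClosure k K]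
    {X Y : Scheme.{u}} (f : X ⟶ Spec (.of k)) (g : Y ⟶ Spec (.of k))
    [Smooth f] [IsSeparated f] [QuasiCompact f] [GeometricallyIntegral f]
    [Smooth g] [IsSeparated g] [QuasiCompact g] [GeometricallyIntegral g] :
    piStar K f g (ob K (prodMor f g)) = (ob K f, ob K g) ∧
    (IsIso (piMor K f g) → (ob K (prodMor f g) = 0 ↔ ob K f = 0 ∧ ob K g = 0)) ∧
    ∀ (hX : OnlyConstantUnits K f) (hY : OnlyConstantUnits K g),
      ∃ hXY : OnlyConstantUnits K (prodMor f g),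
        psiStar K f g (elemClass K (prodMor f g) hXY) = (elemClass K f hX, elemClass K g hY) ∧
        (∀ α : Abelian.Ext.{u + 1} (ratQuotMod K (prodMor f g)) (constMod k K) 1,
          psiStar K f g (connecting K (prodMor f g) hXY α) =
            (connecting K f hX (piStar K f g α).1, connecting K g hY (piStar K f g α).2)) ∧
        Function.Injective (connecting K (prodMor f g) hXY) ∧
        Function.Injective (connecting K f hX) ∧ Function.Injective (connecting K g hY) ∧
        (IsIso (piMor K f g) ∨ IsIso (psiMor K f g) →
          (elemClass K (prodMor f g) hXY = 0 ↔ elemClass K f hX = 0 ∧ elemClass K g hY = 0) ∧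
          (ob K (prodMor f g) = 0 ↔ ob K f = 0 ∧ ob K g = 0)) := by
  have : IsSepClosed K := IsSepClosure.sep_closed k
  refine ⟨piStar_ob K f g, fun _ => ob_prodMor_eq_zero_iff K f g, fun hX hY => ?_⟩
  have hXY := onlyConstantUnits_prodMor K f g hX hY
  have eX := elemClass_eq_zero_iff K f hX
  have eY := elemClass_eq_zero_iff K g hY
  have eXY := elemClass_eq_zero_iff K (prodMor f g) hXY
  refine ⟨hXY, psiStar_elemClass K f g hX hY hXY, psiStar_connecting K f g hX hY hXY,
    connecting_injective K _ hXY, connecting_injective K f hX, connecting_injective K g hY, ?_⟩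
  rintro (_ | _)
  · have := ob_prodMor_eq_zero_iff K f g
    rw [eX, eY, eXY]
    exact ⟨this, this⟩
  · have := elemClass_prodMor_eq_zero_iff K f g hX hY hXY
    refine ⟨this, ?_⟩
    rwa [eX, eY, eXY] at this
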